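/- **Setting.** Let $N\ge 1$, let the sites $j$ be taken modulo $N$, let $a>0$ and $$H=H_0+H_1,\qquad H_0(x,y)=\tfrac12\sum_{j}\bigl[y_j^2+x_j^2+a(x_j-x_{j-1})^2\bigr],\qquad H_1(x,y)=\tfrac14\sum_j x_j^4 ,$$ on $\mathbb R^{2N}$. Set $\mu=\frac{a}{1+2a}$ and write $H_0=\frac12 y\cdot y+\frac12 x\cdot Ax$, where $A=(1+2a)[\mathbb I-\mu(\tau+\tau^\top)]$ and $\tau$ is the cyclic permutation matrix. Let $\Omega$ be the average of the square roots of the eigenvalues of $A$. Let $\sigma_0=-\ln(2\mu)$, $\sigma_1=\sigma_0/2$, $\sigma_*=\sigma_0/4$, $\mu_\flat=e^{-\sigma_*}$. For a polynomial $f$ in the $2N$ variables let $\|f\|$ be the sum of the absolute values of its coefficients, $\tau^l f$ its translate by $l$ sites, and $f^\oplus=\sum_{l=1}^{N}\tau^l f$; $F$ is cyclically symmetric if $\tau F=F$. A polynomial $F$ has a seed of class $\mathcal D(C,\sigma)$ if $F=\bigl(\sum_{m=0}^N f^{(m)}\bigr)^\oplus$ with polynomials $f^{(m)}$ that depend only on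 the variables of the sites $0,\dots,m$ (of all sites, if $m\ge N-1$) and satisfy $\|f^{(m)}\|\le Ce^{-\sigma m}$. In the canonical coordinates $q=A^{1/4}x$, $p=A^{-1/4}y$ let $H_\Omega=\bigl[\frac\Omega2(q_0^2+p_0^2)\bigr]^\oplus$ and $Z_0=H_0-H_\Omega$. Let $C_0,C_1>0$ be such that * $Z_0$ (in the variables $q,p$) has a seed of class $\mathcal D(C_0,\sigma_0)$ with $f^{(0)}=0$; * $\mathcal X_0=\frac14\,x\cdot(\ln A)\,y$ has a seed of class $\mathcal D(C_0,\sigma_0)$; * $H_1$, expressed in $q$, has a seed of class $\mathcal D(C_1,\sigma_1)$. Put $$\mu_*=\frac{\Omega(1-e^{-\sigma_0})(1-e^{-(\sigma_0-\sigma_*)})}{8C_0e^{\sigma_1}},\quad \tilde C=\frac{2C_0}{(1-e^{-\sigma_0})(1-e^{-(\sigma_0-\sigma_*)})},\quad \beta^*=\frac{2^6e^{\tilde C-1}}{(1-\mu_\flat^2)(1-\mu_\flat)(1-2a)}\,\frac{C_1}{\Omega},$$ and, for constants $K_1>2$ and $\beta>\sqrt{3/2}$, $$D=\frac{K_1\sqrt{1+4a}}{1-\frac{3}{4\beta^2}}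 .$$ **The adiabatic invariant.** For polynomials $\chi_1,\dots,\chi_r$ define $E_0f=f$ and $E_sf=\sum_{j=1}^s\frac js\{\chi_j,E_{s-j}f\}$. A normal form of order $r$ consists of cyclically symmetric polynomials $\chi_s$ ($1\le s\le r$) and $\mathcal Z_s$ ($0\le s\le r$) in $(q,p)$ such that $\mathcal Z_s$ is homogeneous of degree $2s+2$, $\{H_\Omega,\mathcal Z_s\}=0$, $\chi_s=\{H_\Omega,g_s\}$ for some homogeneous $g_s$ of degree $2s+2$, and $$\sum_{l=0}^sE_{s-l}\mathcal Z_l=\begin{cases}H_0,&s=0,\\ H_1,&s=1,\\ 0,&2\le s\le r.\end{cases}$$ Its adiabatic invariant is $\Phi=\sum_{s=0}^rE_sH_\Omega$, regarded as a function of $(x,y)$. **Proposition.** Let $K_1>2$ and $\beta_0>0$. There exist positive constants $\mu_2,\beta_3,\beta_4$, depending only on $K_1$ and $\beta_0$, such that the following holds for all $N\ge1$, $a>0$, $\beta$, all $C_0,C_1$ as above and all integers $r\ge1$ with $2r\mu<\mu_*$: if $$\mu<\mu_2,\qquad D^2\mu_\flat\le\tfrac12,\qquad \beta>\max\bigl\{\beta_0,\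 \beta_3,\ \beta_4,\ 6e^{\tilde C}\beta^*r^2(r+1),\ \sqrt{3/2}\bigr\},$$ then a normal form of order $r$ exists, and for every normal form of order $r$ the variance of its adiabatic invariant $\Phi$ with respect to the Gibbs measure $e^{-\beta H}\,dx\,dy\big/\int e^{-\beta H}\,dx\,dy$ satisfies $$\sigma^2[\Phi]\ \ge\ \frac{N}{\beta^2}\,\frac{\Omega^2}{10}.$$ -/

import Mathlib

/-!
Klein-Gordon chain of `N` sites with periodic boundary conditions.  The sites are labelled by
`ZMod N`.  A phase point is `z : ZMod N ⊕ ZMod N → ℝ`; the coordinate `Sum.inl j` is the position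
and `Sum.inr j` the momentum at the site `j`.
-/

noncomputable section

namespace KleinGordon

open MvPolynomial

/-- Real polynomials on the phase space of the chain. -/
abbrev Poly (N : ℕ) : Type := MvPolynomial (ZMod N ⊕ ZMod N) ℝ

/-! ### Cyclic symmetry, seeds, norms and interaction range -/

/-- The translated polynomial `τ^l f`: every variable of the site `j` is replaced by the
corresponding variable of the site `j + l`. -/
def shift {N : ℕ} (l : ZMod N) (f : Poly N) : Poly N :=
  rename (Sum.map (fun j => j + l) (fun j => j + l)) f

/-- `F` is cyclically symmetric: `τ F = F`. -/
def IsCyclic {N : ℕ} (F : Poly N) : Prop := shift 1 F = F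

/-- The extensive function `f^⊕ = ∑ τ^l f` generated by the seed `f`. -/
def oplus {N : ℕ} [NeZero N] (f : Poly N) : Poly N := ∑ l : ZMod N, shift l f

/-- The polynomial norm: sum of the absolute values of the coefficients. -/
def polyNorm {N : ℕ} (f : Poly N) : ℝ := ∑ k ∈ f.support, |coeff k f|

/-- The site to which a variable belongs. -/
def site {N : ℕ} : ZMod N ⊕ ZMod N → ZMod N := Sum.elim id id

/-- The decomposed seed `∑_{m=0}^{N} f m` is of class `𝒟(C, σ)`: every `f m` depends only on the
variables of the sites `0, …, m` (left aligned, interaction range at most `m`) and has norm at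
most `C e^{-σ m}`. -/
def ClassD {N : ℕ} (f : ℕ → Poly N) (C σ : ℝ) : Prop :=
  ∀ m ≤ N, (∀ v ∈ (f m).vars, (site v).val ≤ m) ∧ polyNorm (f m) ≤ C * Real.exp (-σ * m)

/-- The extensive polynomial `F` is generated by the decomposed seed `∑_{m=0}^{N} f m`. -/
def HasSeed {N : ℕ} [NeZero N] (F : Poly N) (f : ℕ → Poly N) : Prop :=
  F = oplus (∑ m ∈ Finset.range (N + 1), f m)

/-! ### Poisson brackets and Lie transform -/

/-- The canonical Poisson bracket. -/
def poisson {N : ℕ} [NeZero N] (f g : Poly N) : Poly N :=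
  ∑ j : ZMod N, (pderiv (Sum.inl j) f * pderiv (Sum.inr j) g
    - pderiv (Sum.inr j) f * pderiv (Sum.inl j) g)

/-- The homogeneous components `E_s` of the Lie transform `T_χ = ∑ E_s` generated by
`χ_1, χ_2, …`: `E_0 f = f` and `E_s f = ∑_{j=1}^{s} (j/s) {χ_j, E_{s-j} f}`. -/
def lieE {N : ℕ} [NeZero N] (χ : ℕ → Poly N) : ℕ → Poly N → Poly N
  | 0, f => f
  | s + 1, f => ∑ j : Fin (s + 1),
      (((j : ℕ) + 1 : ℝ) / ((s : ℝ) + 1)) • poisson (χ ((j : ℕ) + 1)) (lieE χ (s - (j : ℕ)) f)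
  termination_by s => s
  decreasing_by omega

/-! ### The Hamiltonian and the normalizing coordinates -/

/-- Quadratic part `½ ∑ [y_j² + x_j² + a (x_j - x_{j-1})²]`. -/
def quadPart (N : ℕ) [NeZero N] (a : ℝ) : Poly N :=
  C (1 / 2) * ∑ j : ZMod N, (X (Sum.inr j) ^ 2 + X (Sum.inl j) ^ 2
    + C a * (X (Sum.inl j) - X (Sum.inl (j - 1))) ^ 2)

/-- Quartic part `¼ ∑ x_j⁴`. -/
def quartPart (N : ℕ) [NeZero N] : Poly N :=
  C (1 / 4) * ∑ j : ZMod N, X (Sum.inl j) ^ 4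

/-- The Hamiltonian of the chain as a function on the phase space. -/
def hamiltonian (N : ℕ) [NeZero N] (a : ℝ) (z : ZMod N ⊕ ZMod N → ℝ) : ℝ :=
  eval z (quadPart N a + quartPart N)

/-- The parameter `μ = a / ω²`, with `ω² = 1 + 2a`. -/
def mu (a : ℝ) : ℝ := a / (1 + 2 * a)

/-- The circulant matrix `A = ω² [1 - μ (τ + τᵀ)]` of the quadratic form of the positions. -/
def matA (N : ℕ) (a : ℝ) : Matrix (ZMod N) (ZMod N) ℝ :=
  (1 + 2 * a) • (1 - mu a • (Matrix.of (fun i j : ZMod N => if i = j + 1 then (1 : ℝ) else 0)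
    + (Matrix.of (fun i j : ZMod N => if i = j + 1 then (1 : ℝ) else 0)).transpose))

theorem matA_isHermitian (N : ℕ) (a : ℝ) : (matA N a).IsHermitian := by
  unfold matA Matrix.IsHermitian
  rw [Matrix.conjTranspose_eq_transpose_of_trivial]
  simp only [Matrix.transpose_smul, Matrix.transpose_sub, Matrix.transpose_add,
    Matrix.transpose_one, Matrix.transpose_transpose]
  rw [add_comm (Matrix.transpose _)]

/-- The real power `A^s` (functional calculus of the symmetric matrix `A`). -/
def powA (N : ℕ) [NeZero N] (a s : ℝ) : Matrix (ZMod N) (ZMod N) ℝ :=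
  cfc (fun t : ℝ => t ^ s) (matA N a)

/-- `Ω`: the average of the square roots of the eigenvalues of `A`. -/
def Om (N : ℕ) [NeZero N] (a : ℝ) : ℝ :=
  (∑ i : ZMod N, Real.sqrt ((matA_isHermitian N a).eigenvalues i)) / N

/-- The polynomial `f(x, y)` rewritten in the canonical coordinates `q = A^{1/4} x`,
`p = A^{-1/4} y`, that is with `x = A^{-1/4} q` and `y = A^{1/4} p` substituted. -/
def toNormal {N : ℕ} [NeZero N] (a : ℝ) (f : Poly N) : Poly N :=
  bind₁ (Sum.elim
    (fun j => ∑ k : ZMod N, C (powA N a (-(1 / 4)) j k) * X (Sum.inl k))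
    (fun j => ∑ k : ZMod N, C (powA N a (1 / 4) j k) * X (Sum.inr k))) f

/-- The value at the phase point `z = (x, y)` of a polynomial given in the coordinates
`q = A^{1/4} x`, `p = A^{-1/4} y`. -/
def evalNormal {N : ℕ} [NeZero N] (a : ℝ) (f : Poly N) (z : ZMod N ⊕ ZMod N → ℝ) : ℝ :=
  eval (Sum.elim
    ((powA N a (1 / 4)).mulVec (fun j => z (Sum.inl j)))
    ((powA N a (-(1 / 4))).mulVec (fun j => z (Sum.inr j)))) f

/-- `H_Ω`, generated by the seed `(Ω/2)(q_0² + p_0²)`. -/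
def HOm (N : ℕ) [NeZero N] (a : ℝ) : Poly N :=
  oplus (C (Om N a / 2) * (X (Sum.inl 0) ^ 2 + X (Sum.inr 0) ^ 2))

/-- `Z_0 = H_0 - H_Ω` in the coordinates `(q, p)`. -/
def Zzero (N : ℕ) [NeZero N] (a : ℝ) : Poly N := toNormal a (quadPart N a) - HOm N a

/-- The quadratic form `x · B y`, `B = ¼ ln A`, whose flow at time one is
`(x, y) ↦ (A^{1/4} x, A^{-1/4} y)`. -/
def chiZero (N : ℕ) [NeZero N] (a : ℝ) : Poly N :=
  ∑ i : ZMod N, ∑ j : ZMod N,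
    C (cfc (fun t : ℝ => Real.log t / 4) (matA N a) i j) * (X (Sum.inl i) * X (Sum.inr j))

/-! ### The adiabatic invariant -/

/-- `χ_1, …, χ_r` is a generating sequence which brings the Hamiltonian (in the coordinates
`(q, p)`) to the normal form `Z_0, …, Z_r` up to order `r`: the homogeneous components of
`T_χ Z = H` of the orders `0, …, r` hold (order `s` is degree `2s + 2`), each `Z_s` commutes with
`H_Ω`, and each `χ_s` is in the range of `{H_Ω, ·}`.  Here `Z 0` is the complete quadratic part
`H_Ω + Z_0`. -/
structure IsNormalForm (N : ℕ) [NeZero N] (a : ℝ) (r : ℕ) (χ Z : ℕ → Poly N) : Prop where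
  gen_range : ∀ s, 1 ≤ s → s ≤ r →
    ∃ g : Poly N, g.IsHomogeneous (2 * s + 2) ∧ χ s = poisson (HOm N a) g
  gen_cyclic : ∀ s, 1 ≤ s → s ≤ r → IsCyclic (χ s)
  normal_homogeneous : ∀ s ≤ r, (Z s).IsHomogeneous (2 * s + 2)
  normal_cyclic : ∀ s ≤ r, IsCyclic (Z s)
  normal_commute : ∀ s ≤ r, poisson (HOm N a) (Z s) = 0
  transform : ∀ s ≤ r, ∑ l ∈ Finset.range (s + 1), lieE χ (s - l) (Z l) =
    if s = 0 then toNormal a (quadPart N a)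
    else if s = 1 then toNormal a (quartPart N) else 0

/-- The adiabatic invariant `Φ = ∑_{s=0}^{r} E_s H_Ω` as a function of the original variables. -/
def adiabaticInvariant (N : ℕ) [NeZero N] (a : ℝ) (r : ℕ) (χ : ℕ → Poly N)
    (z : ZMod N ⊕ ZMod N → ℝ) : ℝ :=
  evalNormal a (∑ s ∈ Finset.range (r + 1), lieE χ s (HOm N a)) z

/-- The Gibbs measure, with density `e^{-βH} / Z(β, a)` with respect to Lebesgue measure. -/
def gibbs (N : ℕ) [NeZero N] (β a : ℝ) : MeasureTheory.Measure (ZMod N ⊕ ZMod N → ℝ) :=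
  (MeasureTheory.volume : MeasureTheory.Measure (ZMod N ⊕ ZMod N → ℝ)).tilted
    (fun z => -β * hamiltonian N a z)

/-! ### The constants -/

/-- `σ_0 = - ln (2μ)`. -/
def sigma0 (a : ℝ) : ℝ := -Real.log (2 * mu a)

/-- `σ_1 = σ_0 / 2`. -/
def sigma1 (a : ℝ) : ℝ := sigma0 a / 2

/-- `σ_* = σ_0 / 4`. -/
def sigmaStar (a : ℝ) : ℝ := sigma0 a / 4

/-- `μ_♭ = e^{-σ_*}`. -/
def muFlat (a : ℝ) : ℝ := Real.exp (-sigmaStar a)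

/-- The threshold `μ_*` of the perturbative construction. -/
def muStar (N : ℕ) [NeZero N] (a C0 : ℝ) : ℝ :=
  Om N a * (1 - Real.exp (-sigma0 a)) * (1 - Real.exp (-(sigma0 a - sigmaStar a)))
    / (8 * C0 * Real.exp (sigma1 a))

/-- The constant `C̃` of the change of coordinates. -/
def Ctilde (a C0 : ℝ) : ℝ :=
  2 * C0 / ((1 - Real.exp (-sigma0 a)) * (1 - Real.exp (-(sigma0 a - sigmaStar a))))

/-- The constant `β^*`, with `A_2² = 1 - 2a`. -/
def betaStar (N : ℕ) [NeZero N] (a C0 C1 : ℝ) : ℝ :=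
  2 ^ 6 * Real.exp (Ctilde a C0 - 1)
    / ((1 - muFlat a ^ 2) * (1 - muFlat a) * (1 - 2 * a)) * (C1 / Om N a)

/-- `D = K_1 A_1 / B`, with `A_1 = √(1 + 4a)` and `B = 1 - 3 / (4β²)`. -/
def Dconst (K1 a β : ℝ) : ℝ := K1 * Real.sqrt (1 + 4 * a) / (1 - 3 / (4 * β ^ 2))

end KleinGordon

end

open KleinGordon

/-! The variance is bounded below by testing `Φ` against the kinetic energy alone. Under the Gibbs
measure the momenta are independent centred Gaussians of variance 1/β. With S = ∑ y_j² and the Euler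
operator D = ∑ y_j ∂/∂y_j, integration by parts gives Cov(f, S) = E[D f]/β, while Var S = 2N/β².
Cauchy–Schwarz becomes E[D f]² ≤ 2N σ²[f] (`sq_gibbsExp_eulerY_le_variance`). Hence only the mean of
D Φ has to be estimated, and no decay of correlations between distant sites is needed.

Leading term: D has the same form in the momenta p, so E[D H_Ω] = Ω tr(A^{-1/2})/β exactly. Since N
≤ Ω tr(A^{-1/2}) (`card_le_trace_powA`) and Ω ≤ 1.001 for small μ, this is at least 0.999 NΩ/β. The
corrections E_s H_Ω with s ≥ 1 contribute at most 0.54 NΩ/β, and 0.459²/2 > 1/10.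

Corrections: in the variables ξ = q + ip, η = q - ip the operator {H_Ω, ·} is diagonal on monomials,
with eigenvalue iΩ times the phase. In even degree the phases are even, so on polynomials without
phase zero it expands norms by at least 2Ω. The condition 2rμ < μ_* makes Z_0 a small perturbation,
so {·, H_0} is still bounded below on them. This gives both the existence of the normal form and a
priori bounds valid for every normal form. Norms are coefficient sums per site: cyclic symmetry
alone makes the bracket estimate `siteNorm_poisson_le` uniform in N, so the seeds enter only through
symmetry and total norm. The resulting recursion has ratio g proportional to r²κ/Ω, where κ bounds
the norm of H_1 per site (`IsNormalForm.rhs_le`, `IsNormalForm.siteNorm_lieE_HOm_le`).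

Expectations: the mean of a polynomial of degree 2k is at most its coefficient norm times bounds of
2k-th moments (`abs_gibbsExp_bind₁_le`). The moments of the x_j and y_j obey the Gaussian bound
(2k-1)!! β^{-k} by a maximum principle over the sites (`gibbsExp_pow_le`), and passing to (q, p)
costs the row sums of A^{±1/4}, at most e^{C̃/2}. The lower bound on β is what makes the series of
corrections small (`tail_le`). -/

noncomputable section

namespace KleinGordon

open MvPolynomial

/-! ### The coefficient norm of polynomials. -/

section CoeffNorm

variable {σ τ 𝕜 : Type*} [NormedField 𝕜]

/-- The sum of the norms of the coefficients of a polynomial. -/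
def coeffNorm (f : MvPolynomial σ 𝕜) : ℝ := ∑ k ∈ f.support, ‖coeff k f‖

theorem coeffNorm_nonneg (f : MvPolynomial σ 𝕜) : 0 ≤ coeffNorm f :=
  Finset.sum_nonneg fun _ _ => norm_nonneg _

theorem coeffNorm_eq_sum_of_subset {f : MvPolynomial σ 𝕜} {s : Finset (σ →₀ ℕ)}
    (h : f.support ⊆ s) : coeffNorm f = ∑ k ∈ s, ‖coeff k f‖ :=
  Finset.sum_subset h fun k _ hk => by rw [notMem_support_iff.1 hk, norm_zero]

theorem coeffNorm_zero : coeffNorm (0 : MvPolynomial σ 𝕜) = 0 := by simp [coeffNorm]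

theorem coeffNorm_add_le (f g : MvPolynomial σ 𝕜) :
    coeffNorm (f + g) ≤ coeffNorm f + coeffNorm g := by
  classical
  rw [coeffNorm_eq_sum_of_subset (support_add (p := f) (q := g)),
    coeffNorm_eq_sum_of_subset (f := f) (s := f.support ∪ g.support) Finset.subset_union_left,
    coeffNorm_eq_sum_of_subset (f := g) (s := f.support ∪ g.support) Finset.subset_union_right,
    ← Finset.sum_add_distrib]
  exact Finset.sum_le_sum fun k _ => by rw [coeff_add]; exact norm_add_le _ _

theorem coeffNorm_sum_le {ι : Type*} (s : Finset ι) (f : ι → MvPolynomial σ 𝕜) :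
    coeffNorm (∑ i ∈ s, f i) ≤ ∑ i ∈ s, coeffNorm (f i) :=
  Finset.le_sum_of_subadditive _ coeffNorm_zero.le coeffNorm_add_le s f

theorem coeffNorm_monomial (k : σ →₀ ℕ) (c : 𝕜) : coeffNorm (monomial k c) = ‖c‖ := by
  classical
  rw [coeffNorm_eq_sum_of_subset (support_monomial_subset)]
  simp

theorem coeffNorm_X (v : σ) : coeffNorm (X v : MvPolynomial σ 𝕜) = 1 := by
  rw [X, coeffNorm_monomial, norm_one]

theorem coeffNorm_C (c : 𝕜) : coeffNorm (C c : MvPolynomial σ 𝕜) = ‖c‖ := by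
  rw [← monomial_zero', coeffNorm_monomial]

theorem coeffNorm_smul (c : 𝕜) (f : MvPolynomial σ 𝕜) :
    coeffNorm (c • f) = ‖c‖ * coeffNorm f := by
  rw [coeffNorm_eq_sum_of_subset (support_smul (a := c) (f := f)), coeffNorm, Finset.mul_sum]
  exact Finset.sum_congr rfl fun k _ => by rw [coeff_smul, smul_eq_mul, norm_mul]

theorem coeffNorm_C_mul (c : 𝕜) (f : MvPolynomial σ 𝕜) :
    coeffNorm (C c * f) = ‖c‖ * coeffNorm f := by rw [C_mul', coeffNorm_smul]

theorem coeffNorm_neg (f : MvPolynomial σ 𝕜) : coeffNorm (-f) = coeffNorm f := by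
  rw [← neg_one_smul 𝕜, coeffNorm_smul, norm_neg, norm_one, one_mul]

theorem coeffNorm_sub_le (f g : MvPolynomial σ 𝕜) :
    coeffNorm (f - g) ≤ coeffNorm f + coeffNorm g := by
  rw [sub_eq_add_neg, ← coeffNorm_neg g]; exact coeffNorm_add_le _ _

theorem coeffNorm_mul_le (f g : MvPolynomial σ 𝕜) :
    coeffNorm (f * g) ≤ coeffNorm f * coeffNorm g := by
  conv_lhs => rw [f.as_sum, g.as_sum, Finset.sum_mul_sum]
  refine (coeffNorm_sum_le _ _).trans ?_
  rw [coeffNorm, coeffNorm, Finset.sum_mul_sum]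
  refine Finset.sum_le_sum fun k _ => (coeffNorm_sum_le _ _).trans
    (Finset.sum_le_sum fun l _ => ?_)
  rw [monomial_mul, coeffNorm_monomial, norm_mul]

theorem coeffNorm_one : coeffNorm (1 : MvPolynomial σ 𝕜) = 1 := by
  rw [← C_1, coeffNorm_C, norm_one]

theorem coeffNorm_pow_le_one {f : MvPolynomial σ 𝕜} (h : coeffNorm f ≤ 1) (n : ℕ) :
    coeffNorm (f ^ n) ≤ 1 := by
  induction n with
  | zero => rw [pow_zero, coeffNorm_one]
  | succ n ih =>
    rw [pow_succ]
    exact (coeffNorm_mul_le _ _).trans (mul_le_one₀ ih (coeffNorm_nonneg _) h)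

theorem coeffNorm_prod_le_one {ι : Type*} (s : Finset ι) (f : ι → MvPolynomial σ 𝕜)
    (h : ∀ i ∈ s, coeffNorm (f i) ≤ 1) : coeffNorm (∏ i ∈ s, f i) ≤ 1 := by
  classical
  induction s using Finset.induction_on with
  | empty => rw [Finset.prod_empty, coeffNorm_one]
  | insert i s hi ih =>
    rw [Finset.prod_insert hi]
    exact (coeffNorm_mul_le _ _).trans (mul_le_one₀ (h i (Finset.mem_insert_self _ _))
      (coeffNorm_nonneg _) (ih fun j hj => h j (Finset.mem_insert_of_mem hj)))

theorem coeffNorm_rename {e : σ → τ} (he : Function.Injective e) (f : MvPolynomial σ 𝕜) :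
    coeffNorm (rename e f) = coeffNorm f := by
  classical
  rw [coeffNorm, support_rename_of_injective he, Finset.sum_image
    ((Finsupp.mapDomain_injective he).injOn)]
  exact Finset.sum_congr rfl fun k _ => by rw [coeff_rename_mapDomain _ he]

theorem coeffNorm_eq_zero {f : MvPolynomial σ 𝕜} (h : coeffNorm f = 0) : f = 0 := by
  by_contra hf
  obtain ⟨k, hk⟩ := support_nonempty.2 hf
  rw [coeffNorm, Finset.sum_eq_zero_iff_of_nonneg fun _ _ => norm_nonneg _] at h
  exact mem_support_iff.1 hk (norm_eq_zero.1 (h k hk))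

theorem coeffNorm_le_of_coeff_le {f g : MvPolynomial σ 𝕜} (h : ∀ k, ‖coeff k f‖ ≤ ‖coeff k g‖) :
    coeffNorm f ≤ coeffNorm g := by
  have hs : f.support ⊆ g.support := fun k hk => by
    rw [mem_support_iff] at hk ⊢
    exact norm_pos_iff.1 ((norm_pos_iff.2 hk).trans_le (h k))
  rw [coeffNorm_eq_sum_of_subset hs]
  exact Finset.sum_le_sum fun k _ => h k

theorem coeffNorm_pderiv_le [NormedAlgebra ℝ 𝕜] (v : σ) (f : MvPolynomial σ 𝕜) :
    coeffNorm (pderiv v f) ≤ ∑ k ∈ f.support, (k v : ℝ) * ‖coeff k f‖ := by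
  conv_lhs => rw [f.as_sum, map_sum]
  refine (coeffNorm_sum_le _ _).trans (Finset.sum_le_sum fun k _ => ?_)
  rw [pderiv_monomial, coeffNorm_monomial, norm_mul, mul_comm]
  gcongr
  rw [← map_natCast (algebraMap ℝ 𝕜), norm_algebraMap']
  simp

/-- Differentiation multiplies a monomial by one of its exponents, and over all variables these
exponents add up to the degree. -/
theorem sum_coeffNorm_pderiv_le [NormedAlgebra ℝ 𝕜] [Fintype σ] {n : ℕ} {f : MvPolynomial σ 𝕜}
    (hf : f.IsHomogeneous n) : ∑ v, coeffNorm (pderiv v f) ≤ n * coeffNorm f := by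
  refine (Finset.sum_le_sum fun v _ => coeffNorm_pderiv_le v f).trans ?_
  rw [Finset.sum_comm, coeffNorm, Finset.mul_sum]
  refine Finset.sum_le_sum fun k hk => ?_
  rw [← Finset.sum_mul, ← Nat.cast_sum, ← hf (mem_support_iff.1 hk), Finsupp.weight_apply,
    Finsupp.sum_fintype _ _ (by simp)]
  simp

end CoeffNorm

end KleinGordon
end

noncomputable section

namespace KleinGordon

open MvPolynomial

set_option linter.unusedSimpArgs false
set_option linter.unusedSectionVars false

/-! ### Complex variables, translations and the bracket estimate. -/

section Complexification

variable {N : ℕ}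

/-- Complex polynomials in the variables `ξ_j` (`Sum.inl j`) and `η_j` (`Sum.inr j`). -/
abbrev CPoly (N : ℕ) : Type := MvPolynomial (ZMod N ⊕ ZMod N) ℂ

/-- A real polynomial in `(q, p)` written in the variables `ξ = q + i p`, `η = q - i p`. -/
def cplx : Poly N →ₐ[ℝ] CPoly N :=
  aeval (Sum.elim (fun j => C (1 / 2) * (X (Sum.inl j) + X (Sum.inr j)))
    (fun j => C (-Complex.I / 2) * (X (Sum.inl j) - X (Sum.inr j))))

theorem cplx_X_inl (j : ZMod N) :
    cplx (X (Sum.inl j)) = C (1 / 2) * (X (Sum.inl j) + X (Sum.inr j)) := by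
  simp [cplx]

theorem cplx_X_inr (j : ZMod N) :
    cplx (X (Sum.inr j)) = C (-Complex.I / 2) * (X (Sum.inl j) - X (Sum.inr j)) := by
  simp [cplx]

theorem cplx_C (c : ℝ) : cplx (C c : Poly N) = C (c : ℂ) := by
  simp [cplx, MvPolynomial.algebraMap_eq, IsScalarTower.algebraMap_apply ℝ ℂ (CPoly N)]

theorem cplx_smul (c : ℝ) (f : Poly N) : cplx (c • f) = C (c : ℂ) * cplx f := by
  rw [← C_mul', map_mul, cplx_C]

theorem coeffNorm_cplx_X_le (v : ZMod N ⊕ ZMod N) : coeffNorm (cplx (X v)) ≤ 1 := by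
  rcases v with j | j
  · rw [cplx_X_inl, coeffNorm_C_mul]
    have := coeffNorm_add_le (X (Sum.inl j) : CPoly N) (X (Sum.inr j))
    rw [coeffNorm_X, coeffNorm_X] at this
    norm_num
    linarith
  · rw [cplx_X_inr, coeffNorm_C_mul]
    have := coeffNorm_sub_le (X (Sum.inl j) : CPoly N) (X (Sum.inr j))
    rw [coeffNorm_X, coeffNorm_X] at this
    norm_num
    linarith

/-- Each of the two substituted linear forms has norm at most one, so seed bounds carry over to the
variables ξ, η without loss. -/
theorem coeffNorm_cplx_le (f : Poly N) : coeffNorm (cplx f) ≤ coeffNorm f := by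
  conv_lhs => rw [f.as_sum, map_sum]
  refine (coeffNorm_sum_le _ _).trans (Finset.sum_le_sum fun k _ => ?_)
  rw [monomial_eq, map_mul, cplx_C, coeffNorm_C_mul, Complex.norm_real]
  refine mul_le_of_le_one_right (norm_nonneg _) ?_
  rw [Finsupp.prod, map_prod]
  refine coeffNorm_prod_le_one _ _ fun v _ => ?_
  rw [map_pow]
  exact coeffNorm_pow_le_one (coeffNorm_cplx_X_le v) _

theorem cplx_injective : Function.Injective (cplx : Poly N → CPoly N) := by
  -- The inverse substitution ξ = q + ip, η = q - ip.
  obtain ⟨φ, h1, h2⟩ : ∃ φ : CPoly N →ₐ[ℂ] CPoly N,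
      (∀ j, φ (X (Sum.inl j)) = X (Sum.inl j) + C Complex.I * X (Sum.inr j)) ∧
      ∀ j, φ (X (Sum.inr j)) = X (Sum.inl j) - C Complex.I * X (Sum.inr j) :=
    ⟨aeval (Sum.elim (fun j => X (Sum.inl j) + C Complex.I * X (Sum.inr j))
      (fun j => X (Sum.inl j) - C Complex.I * X (Sum.inr j))), fun j => by simp, fun j => by simp⟩
  have hC : ∀ c : ℂ, φ (C c) = C c := fun c => φ.commutes c
  have h : ∀ f : Poly N, φ (cplx f) = map (algebraMap ℝ ℂ) f := by
    intro f
    induction f using MvPolynomial.induction_on with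
    | C c => rw [cplx_C, map_C, hC]; rfl
    | add f g hf hg => simp only [map_add, hf, hg]
    | mul_X f v hf =>
      rw [map_mul, map_mul, map_mul, hf, map_X]
      congr 1
      rcases v with j | j
      · rw [cplx_X_inl, map_mul, map_add, h1, h2, hC]
        have e : (X (Sum.inl j) : CPoly N) = C (1 / 2 + 1 / 2) * X (Sum.inl j) := by
          rw [add_halves, C_1, one_mul]
        conv_rhs => rw [e, C_add]
        generalize (X (Sum.inl j) : CPoly N) = x
        ring
      · rw [cplx_X_inr, map_mul, map_sub, h1, h2, hC]
        have e : (X (Sum.inr j) : CPoly N) =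
            C (-Complex.I / 2 * Complex.I + -Complex.I / 2 * Complex.I) * X (Sum.inr j) := by
          rw [← add_mul, add_halves, neg_mul, Complex.I_mul_I, neg_neg, C_1, one_mul]
        conv_rhs => rw [e, C_add, C_mul]
        generalize (X (Sum.inl j) : CPoly N) = x
        generalize (X (Sum.inr j) : CPoly N) = y
        ring
  intro f g hfg
  apply map_injective (algebraMap ℝ ℂ) (algebraMap ℝ ℂ).injective
  rw [← h, ← h]
  exact congrArg φ hfg

theorem isHomogeneous_cplx {f : Poly N} {n : ℕ} (hf : f.IsHomogeneous n) :
    (cplx f).IsHomogeneous n := by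
  have hX : ∀ v : ZMod N ⊕ ZMod N, (cplx (X v)).IsHomogeneous 1 := by
    rintro (j | j)
    · rw [cplx_X_inl]
      exact ((isHomogeneous_X ℂ _).add (isHomogeneous_X ℂ _)).C_mul _
    · rw [cplx_X_inr]
      exact ((isHomogeneous_X ℂ _).sub (isHomogeneous_X ℂ _)).C_mul _
  have := hf.aeval (fun v => cplx (X v)) hX
  rw [one_mul] at this
  rwa [show (cplx : Poly N →ₐ[ℝ] CPoly N) = aeval fun v => cplx (X v) from
    (aeval_unique cplx)]

theorem cplx_pderiv_inl (j : ZMod N) (f : Poly N) :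
    cplx (pderiv (Sum.inl j) f) = pderiv (Sum.inl j) (cplx f) + pderiv (Sum.inr j) (cplx f) := by
  classical
  induction f using MvPolynomial.induction_on with
  | C c => simp [cplx_C]
  | add f g hf hg => simp only [map_add, hf, hg]; ring
  | mul_X f v hf =>
    have hX : cplx (pderiv (Sum.inl j) (X v : Poly N)) =
        pderiv (Sum.inl j) (cplx (X v)) + pderiv (Sum.inr j) (cplx (X v)) := by
      have h2 : (C 2⁻¹ : CPoly N) + C 2⁻¹ = 1 := by
        rw [← C_add, ← C_1]; norm_num
      rcases v with i | i
      · rw [cplx_X_inl]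
        by_cases hi : i = j
        · subst hi; simp [pderiv_X, Pi.single_apply, pderiv_C_mul, h2]
        · simp [pderiv_X, Pi.single_apply, pderiv_C_mul, hi, Ne.symm hi]
      · rw [cplx_X_inr]
        by_cases hi : i = j
        · subst hi; simp [pderiv_X, Pi.single_apply, pderiv_C_mul]
        · simp [pderiv_X, Pi.single_apply, pderiv_C_mul, hi, Ne.symm hi]
    rw [pderiv_mul, map_add, map_mul, map_mul, map_mul, hf, hX, pderiv_mul, pderiv_mul]
    ring

theorem cplx_pderiv_inr (j : ZMod N) (f : Poly N) :
    cplx (pderiv (Sum.inr j) f) =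
      C Complex.I * (pderiv (Sum.inl j) (cplx f) - pderiv (Sum.inr j) (cplx f)) := by
  classical
  induction f using MvPolynomial.induction_on with
  | C c => simp [cplx_C]
  | add f g hf hg => simp only [map_add, hf, hg]; ring
  | mul_X f v hf =>
    have hX : cplx (pderiv (Sum.inr j) (X v : Poly N)) =
        C Complex.I * (pderiv (Sum.inl j) (cplx (X v)) - pderiv (Sum.inr j) (cplx (X v))) := by
      have h2 : (C Complex.I : CPoly N) * (C (-Complex.I / 2) + C (-Complex.I / 2)) = 1 := by
        rw [← C_add, ← C_mul, ← C_1]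
        congr 1
        linear_combination -Complex.I_mul_I
      rcases v with i | i
      · rw [cplx_X_inl]
        by_cases hi : i = j
        · subst hi; simp [pderiv_X, Pi.single_apply, pderiv_C_mul]
        · simp [pderiv_X, Pi.single_apply, pderiv_C_mul, hi, Ne.symm hi]
      · rw [cplx_X_inr]
        by_cases hi : i = j
        · subst hi; simp [pderiv_X, Pi.single_apply, pderiv_C_mul, h2]
        · simp [pderiv_X, Pi.single_apply, pderiv_C_mul, hi, Ne.symm hi]
    rw [pderiv_mul, map_add, map_mul, map_mul, map_mul, hf, hX, pderiv_mul, pderiv_mul]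
    ring

variable [NeZero N]

/-- The bracket of two polynomials in the variables `(ξ, η)`, treated as conjugate. -/
def cbracket (F G : CPoly N) : CPoly N :=
  ∑ j : ZMod N, (pderiv (Sum.inl j) F * pderiv (Sum.inr j) G
    - pderiv (Sum.inr j) F * pderiv (Sum.inl j) G)

/-- The factor is the value of {ξ_j, η_j} = {q_j + ip_j, q_j - ip_j}. -/
theorem cplx_poisson (f g : Poly N) :
    cplx (poisson f g) = C (-2 * Complex.I) * cbracket (cplx f) (cplx g) := by
  rw [poisson, cbracket, map_sum, Finset.mul_sum]
  refine Finset.sum_congr rfl fun j _ => ?_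
  rw [map_sub, map_mul, map_mul, cplx_pderiv_inl, cplx_pderiv_inr, cplx_pderiv_inl,
    cplx_pderiv_inr, C_mul, C_neg, map_ofNat]
  ring

/-! ### Translations -/

/-- The translation of the variables by `l` sites. -/
def siteShift (l : ZMod N) : ZMod N ⊕ ZMod N → ZMod N ⊕ ZMod N :=
  Sum.map (fun j => j + l) (fun j => j + l)

theorem siteShift_injective (l : ZMod N) : Function.Injective (siteShift l) :=
  Sum.map_injective.2 ⟨add_left_injective l, add_left_injective l⟩

theorem cplx_shift (l : ZMod N) (f : Poly N) :
    cplx (shift l f) = rename (siteShift l) (cplx f) := by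
  induction f using MvPolynomial.induction_on with
  | C c => simp [shift, cplx_C]
  | add f g hf hg => simp only [shift, map_add] at *; rw [hf, hg]
  | mul_X f v hf =>
    simp only [shift, map_mul] at *
    rw [hf, rename_X]
    congr 1
    rcases v with j | j
    · simp [cplx_X_inl, siteShift]
    · simp [cplx_X_inr, siteShift]

theorem shift_poisson (l : ZMod N) (f g : Poly N) :
    shift l (poisson f g) = poisson (shift l f) (shift l g) := by
  rw [poisson, poisson, shift, map_sum]
  conv_rhs => rw [← Equiv.sum_comp (Equiv.addRight l)]
  refine Finset.sum_congr rfl fun j _ => ?_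
  have h1 : ∀ f : Poly N, pderiv (Sum.inl (Equiv.addRight l j)) (shift l f) =
      rename (siteShift l) (pderiv (Sum.inl j) f) := fun f =>
    pderiv_rename (siteShift_injective l) (Sum.inl j) f
  have h2 : ∀ f : Poly N, pderiv (Sum.inr (Equiv.addRight l j)) (shift l f) =
      rename (siteShift l) (pderiv (Sum.inr j) f) := fun f =>
    pderiv_rename (siteShift_injective l) (Sum.inr j) f
  rw [h1, h1, h2, h2, map_sub, map_mul, map_mul]
  rfl

theorem IsCyclic.poisson {f g : Poly N} (hf : IsCyclic f) (hg : IsCyclic g) :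
    IsCyclic (poisson f g) := by
  rw [IsCyclic, shift_poisson, hf, hg]

theorem IsCyclic.add {f g : Poly N} (hf : IsCyclic f) (hg : IsCyclic g) : IsCyclic (f + g) := by
  rw [IsCyclic, shift, map_add]; exact congrArg₂ _ hf hg

theorem IsCyclic.smul {f : Poly N} (hf : IsCyclic f) (c : ℝ) : IsCyclic (c • f) := by
  rw [IsCyclic, shift, map_smul]; exact congrArg _ hf

theorem isCyclic_zero : IsCyclic (0 : Poly N) := by rw [IsCyclic, shift, map_zero]

theorem IsCyclic.neg {f : Poly N} (hf : IsCyclic f) : IsCyclic (-f) := by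
  rw [IsCyclic, shift, map_neg]; exact congrArg _ hf

theorem IsCyclic.sub {f g : Poly N} (hf : IsCyclic f) (hg : IsCyclic g) : IsCyclic (f - g) := by
  rw [sub_eq_add_neg]; exact hf.add hg.neg

theorem IsCyclic.sum {ι : Type*} {s : Finset ι} {f : ι → Poly N} (h : ∀ i ∈ s, IsCyclic (f i)) :
    IsCyclic (∑ i ∈ s, f i) := by
  rw [IsCyclic, shift, map_sum]; exact Finset.sum_congr rfl h

theorem shift_shift (l m : ZMod N) (f : Poly N) : shift l (shift m f) = shift (m + l) f := by
  rw [shift, shift, shift, rename_rename]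
  congr 2
  funext v
  rcases v with j | j <;> simp [add_assoc]

theorem isCyclic_oplus (f : Poly N) : IsCyclic (oplus f) := by
  rw [IsCyclic, oplus]
  conv_rhs => rw [← Equiv.sum_comp (Equiv.addRight (1 : ZMod N))]
  rw [shift, map_sum]
  exact Finset.sum_congr rfl fun l _ => shift_shift 1 l f

theorem apply_eq_of_add_one {α : Type*} {p : ZMod N → α} (h : ∀ j, p (j + 1) = p j)
    (j : ZMod N) : p j = p 0 := by
  have : ∀ n : ℕ, p (n : ZMod N) = p 0 := by
    intro n
    induction n with
    | zero => rw [Nat.cast_zero]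
    | succ n ih => rw [Nat.cast_succ, h, ih]
  rw [← ZMod.natCast_zmod_val j, this]

/-- By cyclic symmetry the derivatives with respect to the N variables of one kind have equal norms,
so each is at most a fraction 1/N of the total m‖f‖ or n‖g‖. The N products in the bracket therefore
sum to order 1/N. This gain makes the norm per site behave well under brackets, uniformly in N,
whatever the interaction range. -/
theorem card_mul_coeffNorm_cbracket_le {f g : Poly N} {m n : ℕ} (hf : f.IsHomogeneous m)
    (hg : g.IsHomogeneous n) (cf : IsCyclic f) (cg : IsCyclic g) :
    N * coeffNorm (cbracket (cplx f) (cplx g)) ≤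
      m * n * (coeffNorm (cplx f) * coeffNorm (cplx g)) := by
  have key : ∀ {f : Poly N} {m : ℕ}, f.IsHomogeneous m → IsCyclic f →
      (∀ j, coeffNorm (pderiv (Sum.inl j) (cplx f)) = coeffNorm (pderiv (Sum.inl 0) (cplx f))) ∧
      (∀ j, coeffNorm (pderiv (Sum.inr j) (cplx f)) = coeffNorm (pderiv (Sum.inr 0) (cplx f))) ∧
      N * (coeffNorm (pderiv (Sum.inl 0) (cplx f)) + coeffNorm (pderiv (Sum.inr 0) (cplx f)))
        ≤ m * coeffNorm (cplx f) := by
    intro f m hf cf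
    have hr : rename (siteShift 1) (cplx f) = cplx f := by rw [← cplx_shift, cf]
    have h1 : ∀ j, coeffNorm (pderiv (Sum.inl j) (cplx f)) =
        coeffNorm (pderiv (Sum.inl 0) (cplx f)) := by
      refine apply_eq_of_add_one fun j => ?_
      have := pderiv_rename (siteShift_injective (1 : ZMod N)) (Sum.inl j) (cplx f)
      rw [hr] at this
      exact (congrArg coeffNorm this).trans (coeffNorm_rename (siteShift_injective _) _)
    have h2 : ∀ j, coeffNorm (pderiv (Sum.inr j) (cplx f)) =
        coeffNorm (pderiv (Sum.inr 0) (cplx f)) := by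
      refine apply_eq_of_add_one fun j => ?_
      have := pderiv_rename (siteShift_injective (1 : ZMod N)) (Sum.inr j) (cplx f)
      rw [hr] at this
      exact (congrArg coeffNorm this).trans (coeffNorm_rename (siteShift_injective _) _)
    refine ⟨h1, h2, ?_⟩
    have h3 := sum_coeffNorm_pderiv_le (isHomogeneous_cplx hf)
    rw [Fintype.sum_sum_type] at h3
    simp only [h1, h2, Finset.sum_const, Finset.card_univ, ZMod.card, nsmul_eq_mul] at h3
    linarith
  obtain ⟨f1, f2, f3⟩ := key hf cf
  obtain ⟨g1, g2, g3⟩ := key hg cg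
  set A := coeffNorm (pderiv (Sum.inl 0) (cplx f)) with hA
  set B := coeffNorm (pderiv (Sum.inr 0) (cplx f)) with hB
  set A' := coeffNorm (pderiv (Sum.inl 0) (cplx g)) with hA'
  set B' := coeffNorm (pderiv (Sum.inr 0) (cplx g)) with hB'
  have hAn : 0 ≤ A := coeffNorm_nonneg _
  have hBn : 0 ≤ B := coeffNorm_nonneg _
  have hAn' : 0 ≤ A' := coeffNorm_nonneg _
  have hBn' : 0 ≤ B' := coeffNorm_nonneg _
  have hN : (0 : ℝ) ≤ N := Nat.cast_nonneg N
  clear_value A B A' B'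
  have hb : coeffNorm (cbracket (cplx f) (cplx g)) ≤ N * (A * B' + B * A') := by
    refine (coeffNorm_sum_le _ _).trans ?_
    refine (Finset.sum_le_sum (g := fun _ => A * B' + B * A') fun j _ => ?_).trans ?_
    · refine (coeffNorm_sub_le _ _).trans (add_le_add ?_ ?_)
      · exact (coeffNorm_mul_le _ _).trans (by rw [f1, g2])
      · exact (coeffNorm_mul_le _ _).trans (by rw [f2, g1])
    · simp [ZMod.card, mul_add]
  calc N * coeffNorm (cbracket (cplx f) (cplx g)) ≤ N * (N * (A * B' + B * A')) :=
      mul_le_mul_of_nonneg_left hb hN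
    _ ≤ (N * (A + B)) * (N * (A' + B')) := by
      have h : 0 ≤ (N : ℝ) * N * (A * A' + B * B') := by positivity
      clear f1 f2 f3 g1 g2 g3 hb key
      linear_combination h
    _ ≤ (m * coeffNorm (cplx f)) * (n * coeffNorm (cplx g)) :=
      mul_le_mul f3 g3 (mul_nonneg hN (add_nonneg hAn' hBn'))
        (mul_nonneg (Nat.cast_nonneg m) (coeffNorm_nonneg _))
    _ = _ := by ring

/-- The norm per site of the complexified polynomial. -/
def siteNorm (f : Poly N) : ℝ := coeffNorm (cplx f) / N

theorem siteNorm_nonneg (f : Poly N) : 0 ≤ siteNorm f :=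
  div_nonneg (coeffNorm_nonneg _) (Nat.cast_nonneg _)

theorem siteNorm_add_le (f g : Poly N) : siteNorm (f + g) ≤ siteNorm f + siteNorm g := by
  rw [siteNorm, siteNorm, siteNorm, ← add_div, map_add]
  gcongr
  exact coeffNorm_add_le _ _

theorem siteNorm_smul (c : ℝ) (f : Poly N) : siteNorm (c • f) = |c| * siteNorm f := by
  rw [siteNorm, siteNorm, cplx_smul, coeffNorm_C_mul, Complex.norm_real, Real.norm_eq_abs,
    mul_div_assoc]

theorem siteNorm_zero : siteNorm (0 : Poly N) = 0 := by
  rw [siteNorm, map_zero, coeffNorm_zero, zero_div]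

theorem siteNorm_sum_le {ι : Type*} (s : Finset ι) (f : ι → Poly N) :
    siteNorm (∑ i ∈ s, f i) ≤ ∑ i ∈ s, siteNorm (f i) :=
  Finset.le_sum_of_subadditive _ siteNorm_zero.le siteNorm_add_le s f

theorem siteNorm_neg (f : Poly N) : siteNorm (-f) = siteNorm f := by
  rw [siteNorm, map_neg, coeffNorm_neg, siteNorm]

theorem siteNorm_sub_le (f g : Poly N) : siteNorm (f - g) ≤ siteNorm f + siteNorm g := by
  rw [sub_eq_add_neg, ← siteNorm_neg g]; exact siteNorm_add_le _ _

theorem siteNorm_poisson_le {f g : Poly N} {m n : ℕ} (hf : f.IsHomogeneous m)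
    (hg : g.IsHomogeneous n) (cf : IsCyclic f) (cg : IsCyclic g) :
    siteNorm (poisson f g) ≤ 2 * m * siteNorm f * (n * siteNorm g) := by
  have hN : (0 : ℝ) < N := Nat.cast_pos.2 (NeZero.pos N)
  have h := card_mul_coeffNorm_cbracket_le hf hg cf cg
  rw [siteNorm, cplx_poisson, coeffNorm_C_mul]
  have : ‖(-2 * Complex.I : ℂ)‖ = 2 := by simp
  rw [this, siteNorm, siteNorm, div_le_iff₀ hN]
  have e : 2 * m * (coeffNorm (cplx f) / N) * (n * (coeffNorm (cplx g) / N)) * N =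
      2 * (m * n * (coeffNorm (cplx f) * coeffNorm (cplx g))) / N := by
    field_simp
  rw [e, le_div_iff₀ hN]
  linarith

end Complexification

end KleinGordon
end

noncomputable section

namespace KleinGordon

open MvPolynomial

set_option linter.unusedSimpArgs false
set_option linter.unusedSectionVars false

/-! ### The spectrum of {H_Ω, ·} and resonant polynomials. -/

section Resonance

variable {N : ℕ} [NeZero N]

/-! ### Algebraic properties of the Poisson bracket -/

theorem poisson_comm (f g : Poly N) : poisson f g = -poisson g f := by
  rw [poisson, poisson, ← Finset.sum_neg_distrib]
  exact Finset.sum_congr rfl fun j _ => by ring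

theorem poisson_add_left (f g h : Poly N) : poisson (f + g) h = poisson f h + poisson g h := by
  simp only [poisson, map_add, ← Finset.sum_add_distrib]
  exact Finset.sum_congr rfl fun j _ => by ring

theorem poisson_add_right (f g h : Poly N) : poisson f (g + h) = poisson f g + poisson f h := by
  simp only [poisson, map_add, ← Finset.sum_add_distrib]
  exact Finset.sum_congr rfl fun j _ => by ring

theorem poisson_smul_left (c : ℝ) (f g : Poly N) : poisson (c • f) g = c • poisson f g := by
  simp only [poisson, ← C_mul', pderiv_C_mul, Finset.mul_sum]
  exact Finset.sum_congr rfl fun j _ => by ring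

theorem poisson_smul_right (c : ℝ) (f g : Poly N) : poisson f (c • g) = c • poisson f g := by
  simp only [poisson, ← C_mul', pderiv_C_mul, Finset.mul_sum]
  exact Finset.sum_congr rfl fun j _ => by ring

theorem poisson_zero_right (f : Poly N) : poisson f 0 = 0 := by
  simp [poisson]

theorem poisson_sum_right {ι : Type*} (s : Finset ι) (f : Poly N) (g : ι → Poly N) :
    poisson f (∑ i ∈ s, g i) = ∑ i ∈ s, poisson f (g i) := by
  classical
  induction s using Finset.induction_on with
  | empty => simp [poisson_zero_right]
  | insert i s hi ih => rw [Finset.sum_insert hi, Finset.sum_insert hi, poisson_add_right, ih]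

theorem isHomogeneous_poisson {f g : Poly N} {m n : ℕ} (hf : f.IsHomogeneous (2 * m + 2))
    (hg : g.IsHomogeneous (2 * n + 2)) : (poisson f g).IsHomogeneous (2 * (m + n) + 2) := by
  have e : (2 * m + 2 - 1) + (2 * n + 2 - 1) = 2 * (m + n) + 2 := by omega
  refine IsHomogeneous.sum _ _ _ fun j _ => ?_
  have h1 := (hf.pderiv (i := Sum.inl j)).mul (hg.pderiv (i := Sum.inr j))
  have h2 := (hf.pderiv (i := Sum.inr j)).mul (hg.pderiv (i := Sum.inl j))
  rw [e] at h1 h2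
  exact h1.sub h2

/-! ### The infinitesimal rotation -/

/-- The difference of the degrees of a monomial in the variables `ξ` and in the variables `η`. -/
def phase (k : (ZMod N ⊕ ZMod N) →₀ ℕ) : ℤ :=
  ∑ j : ZMod N, ((k (Sum.inl j) : ℤ) - k (Sum.inr j))

/-- The derivation `∑ ξ_j ∂_{ξ_j} - η_j ∂_{η_j}`. -/
def rot : Derivation ℂ (CPoly N) (CPoly N) :=
  ∑ j : ZMod N, ((X (Sum.inl j) : CPoly N) • pderiv (Sum.inl j)
    - (X (Sum.inr j) : CPoly N) • pderiv (Sum.inr j))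

theorem rot_apply (F : CPoly N) : rot F = ∑ j : ZMod N,
    (X (Sum.inl j) * pderiv (Sum.inl j) F - X (Sum.inr j) * pderiv (Sum.inr j) F) := by
  have h := map_sum (Derivation.coeFnAddMonoidHom (R := ℂ) (A := CPoly N) (M := CPoly N))
    (fun j : ZMod N => (X (Sum.inl j) : CPoly N) • pderiv (Sum.inl j)
      - (X (Sum.inr j) : CPoly N) • pderiv (Sum.inr j)) Finset.univ
  rw [rot]
  refine (congrFun h F).trans ?_
  rw [Finset.sum_apply]
  rfl

theorem coeff_X_mul_pderiv {σ R : Type*} [CommSemiring R] (i : σ) (F : MvPolynomial σ R)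
    (k : σ →₀ ℕ) : coeff k (X i * pderiv i F) = k i * coeff k F := by
  classical
  induction F using MvPolynomial.induction_on' with
  | monomial m r =>
    rw [X_mul_pderiv_monomial, coeff_smul, coeff_monomial, nsmul_eq_mul]
    split_ifs with h
    · rw [h]
    · simp
  | add f g hf hg => rw [map_add, mul_add, coeff_add, hf, hg, coeff_add, mul_add]

theorem coeff_rot (F : CPoly N) (k : (ZMod N ⊕ ZMod N) →₀ ℕ) :
    coeff k (rot F) = (phase k : ℂ) * coeff k F := by
  rw [rot_apply, coeff_sum, phase, Int.cast_sum, Finset.sum_mul]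
  refine Finset.sum_congr rfl fun j _ => ?_
  rw [coeff_sub, coeff_X_mul_pderiv, coeff_X_mul_pderiv]
  push_cast
  ring

theorem rot_X_inl (j : ZMod N) : rot (X (Sum.inl j)) = X (Sum.inl j) := by
  classical
  rw [rot_apply, Finset.sum_eq_single j]
  · simp [pderiv_X, Pi.single_apply]
  · intro i _ hi; simp [pderiv_X, Pi.single_apply, hi, Ne.symm hi]
  · simp

theorem rot_X_inr (j : ZMod N) : rot (X (Sum.inr j)) = -X (Sum.inr j) := by
  classical
  rw [rot_apply, Finset.sum_eq_single j]
  · simp [pderiv_X, Pi.single_apply]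
  · intro i _ hi; simp [pderiv_X, Pi.single_apply, hi, Ne.symm hi]
  · simp

/-- Differentiation in ξ lowers the phase by one. Both sides are values of derivations, since a
commutator of derivations is one, so the variables suffice for the check. -/
theorem rot_pderiv_inl (j : ZMod N) (F : CPoly N) :
    rot (pderiv (Sum.inl j) F) = pderiv (Sum.inl j) (rot F) - pderiv (Sum.inl j) F := by
  classical
  have : ⁅(rot : Derivation ℂ (CPoly N) (CPoly N)),
      (pderiv (Sum.inl j) : Derivation ℂ (CPoly N) (CPoly N))⁆ = -pderiv (Sum.inl j) := by
    refine derivation_ext fun v => ?_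
    rw [Derivation.commutator_apply]
    rcases v with i | i
    · rw [rot_X_inl]
      by_cases h : i = j
      · subst h; simp [pderiv_X]
      · simp [pderiv_X, Pi.single_apply, h, Ne.symm h]
    · rw [rot_X_inr]; simp [pderiv_X]
  have h := congrArg (fun D : Derivation ℂ (CPoly N) (CPoly N) => D F) this
  simp only [Derivation.commutator_apply, Derivation.neg_apply] at h
  linear_combination h

theorem rot_pderiv_inr (j : ZMod N) (F : CPoly N) :
    rot (pderiv (Sum.inr j) F) = pderiv (Sum.inr j) (rot F) + pderiv (Sum.inr j) F := by
  classical
  have : ⁅(rot : Derivation ℂ (CPoly N) (CPoly N)),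
      (pderiv (Sum.inr j) : Derivation ℂ (CPoly N) (CPoly N))⁆ = pderiv (Sum.inr j) := by
    refine derivation_ext fun v => ?_
    rw [Derivation.commutator_apply]
    rcases v with i | i
    · rw [rot_X_inl]; simp [pderiv_X]
    · rw [rot_X_inr]
      by_cases h : i = j
      · subst h; simp [pderiv_X]
      · simp [pderiv_X, Pi.single_apply, h, Ne.symm h]
  have h := congrArg (fun D : Derivation ℂ (CPoly N) (CPoly N) => D F) this
  simp only [Derivation.commutator_apply] at h
  linear_combination h

/-- The phase shifts -1 of ∂_ξ and +1 of ∂_η cancel in every product of the bracket. -/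
theorem rot_cbracket (F G : CPoly N) :
    rot (cbracket F G) = cbracket (rot F) G + cbracket F (rot G) := by
  rw [cbracket, cbracket, cbracket, map_sum, ← Finset.sum_add_distrib]
  refine Finset.sum_congr rfl fun j _ => ?_
  rw [map_sub, Derivation.leibniz, Derivation.leibniz, rot_pderiv_inl, rot_pderiv_inr,
    rot_pderiv_inl, rot_pderiv_inr]
  simp only [smul_eq_mul]
  ring

theorem cbracket_C_mul_left (c : ℂ) (F G : CPoly N) :
    cbracket (C c * F) G = C c * cbracket F G := by
  simp only [cbracket, pderiv_C_mul, Finset.mul_sum]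
  exact Finset.sum_congr rfl fun j _ => by ring

theorem cbracket_C_mul_right (c : ℂ) (F G : CPoly N) :
    cbracket F (C c * G) = C c * cbracket F G := by
  simp only [cbracket, pderiv_C_mul, Finset.mul_sum]
  exact Finset.sum_congr rfl fun j _ => by ring

/-! ### The Hamiltonian `H_Ω` -/

theorem HOm_eq (a : ℝ) : HOm N a =
    C (Om N a / 2) * ∑ j : ZMod N, (X (Sum.inl j) ^ 2 + X (Sum.inr j) ^ 2) := by
  rw [HOm, oplus, Finset.mul_sum]
  refine Finset.sum_congr rfl fun j _ => ?_
  simp [shift]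

theorem cplx_sq_add_sq (j : ZMod N) :
    cplx (X (Sum.inl j) ^ 2 + X (Sum.inr j) ^ 2) = X (Sum.inl j) * X (Sum.inr j) := by
  rw [map_add, map_pow, map_pow, cplx_X_inl, cplx_X_inr, mul_pow, mul_pow, ← C_pow, ← C_pow]
  have h1 : ((1 : ℂ) / 2) ^ 2 = 1 / 4 := by norm_num
  have h2 : (-Complex.I / 2) ^ 2 = -(1 / 4) := by
    rw [div_pow, neg_sq, Complex.I_sq]; norm_num
  rw [h1, h2, C_neg]
  have e : (X (Sum.inl j) * X (Sum.inr j) : CPoly N) =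
      C (1 / 4 + 1 / 4 + 1 / 4 + 1 / 4) * (X (Sum.inl j) * X (Sum.inr j)) := by
    rw [show (1 / 4 + 1 / 4 + 1 / 4 + 1 / 4 : ℂ) = 1 by norm_num, C_1, one_mul]
  rw [e, C_add, C_add, C_add]
  generalize (X (Sum.inl j) : CPoly N) = x
  generalize (X (Sum.inr j) : CPoly N) = y
  ring

theorem cplx_HOm (a : ℝ) : cplx (HOm N a) =
    C ((Om N a / 2 : ℝ) : ℂ) * ∑ j : ZMod N, X (Sum.inl j) * X (Sum.inr j) := by
  rw [HOm_eq, map_mul, cplx_C, map_sum]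
  simp only [cplx_sq_add_sq]

theorem isHomogeneous_HOm (a : ℝ) : (HOm N a).IsHomogeneous 2 := by
  rw [HOm_eq]
  exact (IsHomogeneous.sum _ _ _ fun j _ =>
    ((isHomogeneous_X ℝ _).pow 2).add ((isHomogeneous_X ℝ _).pow 2)).C_mul _

theorem isCyclic_HOm (a : ℝ) : IsCyclic (HOm N a) := isCyclic_oplus _

/-- The reason for the variables ξ, η: the operator becomes diagonal on monomials, with eigenvalue
iΩ times the phase. -/
theorem cplx_poisson_HOm (a : ℝ) (f : Poly N) :
    cplx (poisson (HOm N a) f) = C (Complex.I * Om N a) * rot (cplx f) := by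
  classical
  have h : cbracket (∑ j : ZMod N, X (Sum.inl j) * X (Sum.inr j)) (cplx f) = -rot (cplx f) := by
    have h1 : ∀ i : ZMod N, pderiv (Sum.inl i)
        (∑ j : ZMod N, (X (Sum.inl j) * X (Sum.inr j) : CPoly N)) = X (Sum.inr i) := by
      intro i
      rw [map_sum, Finset.sum_eq_single i]
      · simp [pderiv_mul, pderiv_X]
      · intro j _ hj; simp [pderiv_mul, pderiv_X, hj, Ne.symm hj]
      · simp
    have h2 : ∀ i : ZMod N, pderiv (Sum.inr i)
        (∑ j : ZMod N, (X (Sum.inl j) * X (Sum.inr j) : CPoly N)) = X (Sum.inl i) := by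
      intro i
      rw [map_sum, Finset.sum_eq_single i]
      · simp [pderiv_mul, pderiv_X]
      · intro j _ hj; simp [pderiv_mul, pderiv_X, hj, Ne.symm hj]
      · simp
    rw [cbracket, rot_apply, ← Finset.sum_neg_distrib]
    refine Finset.sum_congr rfl fun j _ => ?_
    rw [h1, h2]
    ring
  rw [cplx_poisson, cplx_HOm, cbracket_C_mul_left, h, ← mul_assoc, ← C_mul, mul_neg, ← neg_mul,
    ← C_neg]
  congr 2
  push_cast
  ring

/-- The only case of the Jacobi identity that is needed. It is the Leibniz rule of `rot` for the
bracket, transported through the injective map `cplx`. -/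
theorem poisson_HOm_poisson (a : ℝ) (f g : Poly N) :
    poisson (HOm N a) (poisson f g) =
      poisson (poisson (HOm N a) f) g + poisson f (poisson (HOm N a) g) := by
  apply cplx_injective
  rw [map_add, cplx_poisson_HOm, cplx_poisson f, cplx_poisson _ g, cplx_poisson f,
    cplx_poisson_HOm, cplx_poisson_HOm, cbracket_C_mul_left, cbracket_C_mul_right, Derivation.leibniz, rot_cbracket,
    ← algebraMap_eq, Derivation.map_algebraMap]
  simp only [smul_eq_mul]
  ring

/-! ### Resonant and nonresonant polynomials -/

/-- All monomials of `f` in the variables `(ξ, η)` have phase zero. -/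
def IsResonant (f : Poly N) : Prop := ∀ k, phase k ≠ 0 → coeff k (cplx f) = 0

/-- No monomial of `f` in the variables `(ξ, η)` has phase zero. -/
def IsNonresonant (f : Poly N) : Prop := ∀ k, phase k = 0 → coeff k (cplx f) = 0

theorem coeff_cplx_poisson_HOm (a : ℝ) (f : Poly N) (k : (ZMod N ⊕ ZMod N) →₀ ℕ) :
    coeff k (cplx (poisson (HOm N a) f)) = Complex.I * Om N a * phase k * coeff k (cplx f) := by
  rw [cplx_poisson_HOm, coeff_C_mul, coeff_rot]
  ring

theorem isResonant_of_poisson_eq_zero {a : ℝ} (ha : Om N a ≠ 0) {f : Poly N}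
    (h : poisson (HOm N a) f = 0) : IsResonant f := by
  intro k hk
  have := coeff_cplx_poisson_HOm a f k
  rw [h, map_zero, coeff_zero] at this
  have h0 : Complex.I * Om N a * phase k ≠ 0 :=
    mul_ne_zero (mul_ne_zero Complex.I_ne_zero (by exact_mod_cast ha)) (by exact_mod_cast hk)
  exact (mul_eq_zero.1 this.symm).resolve_left h0

theorem isNonresonant_poisson (a : ℝ) (f : Poly N) : IsNonresonant (poisson (HOm N a) f) := by
  intro k hk
  rw [coeff_cplx_poisson_HOm, hk]
  simp

theorem IsResonant.eq_zero {f : Poly N} (h : IsResonant f) (h' : IsNonresonant f) : f = 0 := by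
  apply cplx_injective
  rw [map_zero]
  ext k
  by_cases hk : phase k = 0
  · rw [h' k hk, coeff_zero]
  · rw [h k hk, coeff_zero]

theorem siteNorm_le_of_coeff_le {f g : Poly N}
    (h : ∀ k, ‖coeff k (cplx f)‖ ≤ ‖coeff k (cplx g)‖) : siteNorm f ≤ siteNorm g :=
  div_le_div_of_nonneg_right (coeffNorm_le_of_coeff_le h) (Nat.cast_nonneg _)

/-- The two summands have no common monomial in ξ, η, so no cancellation is possible. -/
theorem IsResonant.siteNorm_le_add {f g : Poly N} (hf : IsResonant f) (hg : IsNonresonant g) :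
    siteNorm f ≤ siteNorm (f + g) := by
  refine siteNorm_le_of_coeff_le fun k => ?_
  rw [map_add, coeff_add]
  by_cases hk : phase k = 0
  · rw [hg k hk, add_zero]
  · rw [hf k hk, norm_zero]; exact norm_nonneg _

theorem IsNonresonant.siteNorm_le_add {f g : Poly N} (hf : IsResonant f) (hg : IsNonresonant g) :
    siteNorm g ≤ siteNorm (f + g) := by
  refine siteNorm_le_of_coeff_le fun k => ?_
  rw [map_add, coeff_add]
  by_cases hk : phase k = 0
  · rw [hg k hk, norm_zero]; exact norm_nonneg _
  · rw [hf k hk, zero_add]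

theorem phase_eq_of_weight {n : ℕ} {k : (ZMod N ⊕ ZMod N) →₀ ℕ}
    (h : Finsupp.weight (1 : ZMod N ⊕ ZMod N → ℕ) k = n) :
    phase k = n - 2 * ∑ j : ZMod N, (k (Sum.inr j) : ℤ) := by
  rw [Finsupp.weight_apply, Finsupp.sum_fintype _ _ (by simp), Fintype.sum_sum_type] at h
  rw [phase, Finset.sum_sub_distrib, ← h]
  push_cast
  simp only [smul_eq_mul, Pi.one_apply, mul_one]
  ring

/-- The phase has the parity of the degree. In even degree a nonzero phase is therefore at least 2
in absolute value, which gives the spectral gap 2Ω. -/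
theorem two_mul_siteNorm_le {a : ℝ} (ha : 0 ≤ Om N a) {n : ℕ} {f : Poly N}
    (hf : f.IsHomogeneous (2 * n)) (h : IsNonresonant f) :
    2 * Om N a * siteNorm f ≤ siteNorm (poisson (HOm N a) f) := by
  have : siteNorm ((2 * Om N a) • f) ≤ siteNorm (poisson (HOm N a) f) := by
    refine siteNorm_le_of_coeff_le fun k => ?_
    rw [coeff_cplx_poisson_HOm, cplx_smul, coeff_C_mul]
    by_cases hk : coeff k (cplx f) = 0
    · simp [hk]
    have hp : phase k ≠ 0 := fun hp => hk (h k hp)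
    have hw := phase_eq_of_weight (isHomogeneous_cplx hf hk)
    have h2 : (2 : ℝ) ≤ |(phase k : ℝ)| := by
      have : (2 : ℤ) ≤ |phase k| := by
        have h3 : phase k = 2 * ((n : ℤ) - ∑ j : ZMod N, (k (Sum.inr j) : ℤ)) := by
          rw [hw]; push_cast; ring
        have h4 : (n : ℤ) - ∑ j : ZMod N, (k (Sum.inr j) : ℤ) ≠ 0 := by
          intro h5; rw [h5] at h3; exact hp (by simpa using h3)
        have h6 := Int.one_le_abs h4
        rw [h3, abs_mul]
        norm_num
        exact h6
      exact_mod_cast this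
    rw [norm_mul, norm_mul, norm_mul, norm_mul, Complex.norm_I, one_mul, Complex.norm_real,
      Complex.norm_real, Complex.norm_intCast, Real.norm_eq_abs, Real.norm_eq_abs, abs_mul,
      abs_two]
    gcongr ?_ * _
    rw [mul_comm]
    gcongr
  rwa [siteNorm_smul, abs_mul, abs_two, abs_of_nonneg ha] at this

end Resonance

end KleinGordon
end

noncomputable section

namespace KleinGordon

open MvPolynomial

set_option linter.unusedSectionVars false

/-! ### Recursive identities and estimates for the Lie transform. -/

section LieTransform

variable {N : ℕ} [NeZero N]

/-! ### The Lie transform -/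

theorem succ_smul_lieE (χ : ℕ → Poly N) (s : ℕ) (f : Poly N) :
    ((s : ℝ) + 1) • lieE χ (s + 1) f = ∑ j ∈ Finset.range (s + 1),
      ((j : ℝ) + 1) • poisson (χ (j + 1)) (lieE χ (s - j) f) := by
  rw [lieE, Finset.smul_sum, Finset.sum_range]
  refine Finset.sum_congr rfl fun j _ => ?_
  rw [smul_smul, mul_div_cancel₀ _ (by positivity : (s : ℝ) + 1 ≠ 0)]

theorem lieE_zero (χ : ℕ → Poly N) (f : Poly N) : lieE χ 0 f = f := by rw [lieE]

theorem lieE_succ (χ : ℕ → Poly N) (s : ℕ) (f : Poly N) :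
    lieE χ (s + 1) f = ∑ j ∈ Finset.range (s + 1),
      (((j : ℝ) + 1) / ((s : ℝ) + 1)) • poisson (χ (j + 1)) (lieE χ (s - j) f) := by
  rw [lieE, Finset.sum_range]

theorem lieE_congr {χ χ' : ℕ → Poly N} {s : ℕ} (h : ∀ j, 1 ≤ j → j ≤ s → χ j = χ' j)
    (f : Poly N) : lieE χ s f = lieE χ' s f := by
  induction s using Nat.strong_induction_on with
  | _ s ih =>
    rcases s with _ | s
    · rw [lieE_zero, lieE_zero]
    · rw [lieE_succ, lieE_succ]
      refine Finset.sum_congr rfl fun j hj => ?_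
      have hj' := Finset.mem_range.1 hj
      rw [h (j + 1) (by omega) (by omega),
        ih (s - j) (by omega) fun i hi hi' => h i hi (by omega)]

theorem isHomogeneous_smul {f : Poly N} {n : ℕ} (hf : f.IsHomogeneous n) (c : ℝ) :
    (c • f).IsHomogeneous n := by
  rw [← C_mul']; exact hf.C_mul c

theorem isHomogeneous_lieE {χ : ℕ → Poly N} {s l : ℕ} {f : Poly N}
    (hχ : ∀ j, 1 ≤ j → j ≤ s → (χ j).IsHomogeneous (2 * j + 2))
    (hf : f.IsHomogeneous (2 * l + 2)) : (lieE χ s f).IsHomogeneous (2 * (s + l) + 2) := by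
  induction s using Nat.strong_induction_on with
  | _ s ih =>
    rcases s with _ | s
    · rw [lieE_zero, zero_add]; exact hf
    · rw [lieE_succ]
      refine IsHomogeneous.sum _ _ _ fun j hj => isHomogeneous_smul ?_ _
      have hj' := Finset.mem_range.1 hj
      have h := isHomogeneous_poisson (hχ (j + 1) (by omega) (by omega))
        (ih (s - j) (by omega) fun i hi hi' => hχ i hi (by omega))
      rwa [show j + 1 + (s - j + l) = s + 1 + l by omega] at h

theorem isCyclic_lieE {χ : ℕ → Poly N} {s : ℕ} {f : Poly N}
    (hχ : ∀ j, 1 ≤ j → j ≤ s → IsCyclic (χ j)) (hf : IsCyclic f) : IsCyclic (lieE χ s f) := by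
  induction s using Nat.strong_induction_on with
  | _ s ih =>
    rcases s with _ | s
    · rw [lieE_zero]; exact hf
    · rw [lieE_succ]
      refine IsCyclic.sum fun j hj => IsCyclic.smul ?_ _
      have hj' := Finset.mem_range.1 hj
      exact (hχ (j + 1) (by omega) (by omega)).poisson
        (ih (s - j) (by omega) fun i hi hi' => hχ i hi (by omega))

/-- The relation between consecutive orders of `T_χ Z = H` in which the quadratic part of `Z`
appears only through `H`. -/
theorem succ_smul_transform {χ Z H : ℕ → Poly N} {s : ℕ}
    (h : ∀ t ≤ s + 1, ∑ l ∈ Finset.range (t + 1), lieE χ (t - l) (Z l) = H t) :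
    ((s : ℝ) + 1) • H (s + 1) =
      ∑ j ∈ Finset.range (s + 1), ((j : ℝ) + 1) • poisson (χ (j + 1)) (H (s - j)) +
      ∑ l ∈ Finset.range (s + 2), (l : ℝ) • lieE χ (s + 1 - l) (Z l) := by
  -- The weight s + 1 at order s + 1 is split as (s + 1 - l) + l. The first part clears the
  -- denominator of E_{s+1-l}; after exchanging the sums, the inner sums over l rebuild H_{s-j}. In
  -- the second part Z_0 carries the weight l = 0.
  have h1 : ∑ j ∈ Finset.range (s + 1), ((j : ℝ) + 1) • poisson (χ (j + 1)) (H (s - j)) =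
      ∑ l ∈ Finset.range (s + 1), ((s : ℝ) + 1 - l) • lieE χ (s + 1 - l) (Z l) := by
    have h2 : ∀ l ∈ Finset.range (s + 1), ((s : ℝ) + 1 - l) • lieE χ (s + 1 - l) (Z l) =
        ∑ j ∈ Finset.range (s - l + 1),
          ((j : ℝ) + 1) • poisson (χ (j + 1)) (lieE χ (s - l - j) (Z l)) := by
      intro l hl
      have hl' := Finset.mem_range.1 hl
      rw [← succ_smul_lieE, Nat.cast_sub (by omega), show s + 1 - l = s - l + 1 by omega]
      congr 1
      ring
    have h3 : ∀ j ∈ Finset.range (s + 1), ((j : ℝ) + 1) • poisson (χ (j + 1)) (H (s - j)) =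
        ∑ l ∈ Finset.range (s - j + 1),
          ((j : ℝ) + 1) • poisson (χ (j + 1)) (lieE χ (s - l - j) (Z l)) := by
      intro j hj
      rw [← h (s - j) (by omega), poisson_sum_right, Finset.smul_sum]
      refine Finset.sum_congr rfl fun l _ => ?_
      rw [show s - j - l = s - l - j by omega]
    rw [Finset.sum_congr rfl h2, Finset.sum_congr rfl h3]
    refine Finset.sum_comm' fun j l => ?_
    simp only [Finset.mem_range]
    omega
  have h4 : ∑ l ∈ Finset.range (s + 1), ((s : ℝ) + 1 - l) • lieE χ (s + 1 - l) (Z l) =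
      ∑ l ∈ Finset.range (s + 2), ((s : ℝ) + 1 - l) • lieE χ (s + 1 - l) (Z l) := by
    rw [Finset.sum_range_succ _ (s + 1)]
    push_cast
    rw [sub_self, zero_smul, add_zero]
  rw [h1, h4, ← Finset.sum_add_distrib, ← h (s + 1) le_rfl, Finset.smul_sum]
  refine Finset.sum_congr rfl fun l _ => ?_
  rw [← add_smul, sub_add_cancel]

/-! ### Recursive estimates -/

/-- Assuming the bound at lower orders, the j-th term of the sum is at most (j + 1) u g^s / r,
because g = 3αr² supplies exactly one missing factor g. The sum is then s(s + 1)/(2r) · u g^s, at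
most half of the first term since s ≤ r; hence the factor 3/2. -/
theorem le_of_recursion {r : ℕ} {e : ℕ → ℝ} {α u g : ℝ} (hα : 0 ≤ α) (hu : 0 ≤ u)
    (hg : g = 3 * α * r ^ 2)
    (h : ∀ s, s + 1 ≤ r → ((s : ℝ) + 1) * e (s + 1) ≤ ((s : ℝ) + 1) * (u * g ^ s) +
      ∑ j ∈ Finset.range s, ((j : ℝ) + 1) * (α * g ^ j * (2 * r * e (s - j))))
    {s : ℕ} (hs : s + 1 ≤ r) : e (s + 1) ≤ 3 / 2 * u * g ^ s := by
  induction s using Nat.strong_induction_on with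
  | _ s ih =>
    have hr : (s : ℝ) + 1 ≤ r := by exact_mod_cast hs
    have hr0 : (0 : ℝ) < r := lt_of_lt_of_le (by positivity) hr
    have hg0 : 0 ≤ g := by rw [hg]; positivity
    have h1 : r * ∑ j ∈ Finset.range s, ((j : ℝ) + 1) * (α * g ^ j * (2 * r * e (s - j))) ≤
        ∑ j ∈ Finset.range s, ((j : ℝ) + 1) * (u * g ^ s) := by
      rw [Finset.mul_sum]
      refine Finset.sum_le_sum fun j hj => ?_
      have hj' := Finset.mem_range.1 hj
      obtain ⟨i, rfl⟩ : ∃ i, s = j + i + 1 := ⟨s - j - 1, by omega⟩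
      have hi := ih i (by omega) (by omega)
      rw [show j + i + 1 - j = i + 1 by omega]
      calc r * (((j : ℝ) + 1) * (α * g ^ j * (2 * r * e (i + 1))))
          ≤ r * (((j : ℝ) + 1) * (α * g ^ j * (2 * r * (3 / 2 * u * g ^ i)))) := by gcongr
        _ = ((j : ℝ) + 1) * (u * g ^ j * g ^ i * (3 * α * r ^ 2)) := by ring
        _ = ((j : ℝ) + 1) * (u * g ^ (j + i + 1)) := by rw [← hg]; ring
    have h2 : ∑ j ∈ Finset.range s, ((j : ℝ) + 1) * (u * g ^ s) =
        s * (s + 1) / 2 * (u * g ^ s) := by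
      rw [← Finset.sum_mul]
      congr 1
      clear * -
      induction s with
      | zero => simp
      | succ s ih => rw [Finset.sum_range_succ, ih]; push_cast; ring
    have h3 := h s hs
    have hU : 0 ≤ u * g ^ s := by positivity
    have h4 : (r : ℝ) * ((s + 1) * e (s + 1)) ≤ r * ((s + 1) * (3 / 2 * u * g ^ s)) := by
      calc (r : ℝ) * ((s + 1) * e (s + 1)) ≤ r * (((s : ℝ) + 1) * (u * g ^ s) +
            ∑ j ∈ Finset.range s, ((j : ℝ) + 1) * (α * g ^ j * (2 * r * e (s - j)))) := by gcongr
        _ ≤ r * (((s : ℝ) + 1) * (u * g ^ s)) + s * (s + 1) / 2 * (u * g ^ s) := by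
          rw [mul_add, ← h2]; gcongr
        _ ≤ r * (((s : ℝ) + 1) * (u * g ^ s)) + r * (s + 1) / 2 * (u * g ^ s) := by
          gcongr; linarith
        _ = _ := by ring
    exact le_of_mul_le_mul_left (le_of_mul_le_mul_left h4 hr0) (by positivity)

/-- The induction step for the right hand sides ψ of the homological equations. Divided by ακg^s, it
reduces to 4(s + 1) + 6r(s + 1)w ≤ 6r²w with w = (s + 2)/(s + 3) ≥ 2/3. This holds because r ≥ s + 2
gives r(r - (s + 1)) ≥ s + 1. -/
theorem homological_step {r s : ℕ} {κ α g : ℝ} {ψ : ℕ → ℝ} (hκ : 0 ≤ κ) (hα : 0 ≤ α)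
    (hg : g = 3 * α * r ^ 2) (hs : s + 2 ≤ r)
    (hψ : ∀ l, l ≤ s → ψ (l + 1) ≤ 2 * κ * g ^ l / (l + 2)) :
    ((s : ℝ) + 1) * (α * g ^ s * (4 * κ)) +
      ∑ l ∈ Finset.range (s + 1), ((l : ℝ) + 1) * (3 * r * α * g ^ (s - l) * ψ (l + 1)) ≤
    ((s : ℝ) + 2) * (2 * κ * g ^ (s + 1) / (s + 3)) := by
  have hr : (s : ℝ) + 2 ≤ r := by exact_mod_cast hs
  have hs0 : (0 : ℝ) ≤ s := Nat.cast_nonneg s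
  have hg0 : 0 ≤ g := by rw [hg]; positivity
  have h1 : ∑ l ∈ Finset.range (s + 1), ((l : ℝ) + 1) * (3 * r * α * g ^ (s - l) * ψ (l + 1)) ≤
      ∑ l ∈ Finset.range (s + 1), 6 * r * α * κ * g ^ s * ((s + 2) / (s + 3)) := by
    refine Finset.sum_le_sum fun l hl => ?_
    have hl' : l ≤ s := Nat.lt_succ_iff.1 (Finset.mem_range.1 hl)
    have hls : (l : ℝ) ≤ s := by exact_mod_cast hl'
    have hl0 : (0 : ℝ) ≤ l := Nat.cast_nonneg l
    calc ((l : ℝ) + 1) * (3 * r * α * g ^ (s - l) * ψ (l + 1))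
        ≤ ((l : ℝ) + 1) * (3 * r * α * g ^ (s - l) * (2 * κ * g ^ l / (l + 2))) := by
          gcongr; exact hψ l hl'
      _ = 6 * r * α * κ * (g ^ (s - l) * g ^ l) * ((l + 1) / (l + 2)) := by ring
      _ = 6 * r * α * κ * g ^ s * ((l + 1) / (l + 2)) := by
          rw [← pow_add, Nat.sub_add_cancel hl']
      _ ≤ 6 * r * α * κ * g ^ s * ((s + 2) / (s + 3)) := by
          gcongr ?_ * ?_
          rw [div_le_div_iff₀ (by positivity) (by positivity)]
          nlinarith
  rw [Finset.sum_const, Finset.card_range, nsmul_eq_mul] at h1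
  push_cast at h1
  have hP : 0 ≤ α * κ * g ^ s := by positivity
  have h2 : 4 * ((s : ℝ) + 1) + (s + 1) * (6 * r * ((s + 2) / (s + 3))) ≤
      6 * r ^ 2 * ((s + 2) / (s + 3)) := by
    have h3 : (2 : ℝ) / 3 ≤ (s + 2) / (s + 3) := by
      rw [div_le_div_iff₀ (by positivity) (by positivity)]; linarith
    have h4 : (s : ℝ) + 1 ≤ r * (r - (s + 1)) := by nlinarith
    nlinarith
  calc _ ≤ ((s : ℝ) + 1) * (α * g ^ s * (4 * κ)) +
        (s + 1) * (6 * r * α * κ * g ^ s * ((s + 2) / (s + 3))) := by linarith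
    _ = (α * κ * g ^ s) * (4 * ((s : ℝ) + 1) + (s + 1) * (6 * r * ((s + 2) / (s + 3)))) := by ring
    _ ≤ (α * κ * g ^ s) * (6 * r ^ 2 * ((s + 2) / (s + 3))) := by gcongr
    _ = ((s : ℝ) + 2) * (2 * κ * (g ^ s * (3 * α * r ^ 2)) / (s + 3)) := by ring
    _ = _ := by rw [← hg, pow_succ]

/-- The factor 2r bounds the degree 2(s - j + l) + 2 of the transformed polynomial. The degree of
the generator is absorbed in α. -/
theorem siteNorm_lieE_poisson_le {χ : ℕ → Poly N} {r s l : ℕ} {α g : ℝ} {f : Poly N}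
    (hχ : ∀ j, 1 ≤ j → j ≤ s + 1 → (χ j).IsHomogeneous (2 * j + 2))
    (cχ : ∀ j, 1 ≤ j → j ≤ s + 1 → IsCyclic (χ j))
    (bχ : ∀ j, j + 1 ≤ s + 1 → 2 * (2 * (j + 1) + 2 : ℝ) * siteNorm (χ (j + 1)) ≤ α * g ^ j)
    (hf : f.IsHomogeneous (2 * l + 2)) (cf : IsCyclic f) (hs : s + 1 + l ≤ r)
    (j : ℕ) (hj : j ≤ s) :
    siteNorm (poisson (χ (j + 1)) (lieE χ (s - j) f)) ≤
      α * g ^ j * (2 * r * siteNorm (lieE χ (s - j) f)) := by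
  have h1 := siteNorm_poisson_le (hχ (j + 1) (by omega) (by omega))
    (isHomogeneous_lieE (s := s - j) (fun i hi hi' => hχ i hi (by omega)) hf)
    (cχ (j + 1) (by omega) (by omega))
    (isCyclic_lieE (s := s - j) (fun i hi hi' => cχ i hi (by omega)) cf)
  refine h1.trans ?_
  have h2 : ((2 * (s - j + l) + 2 : ℕ) : ℝ) ≤ 2 * r := by
    have : 2 * (s - j + l) + 2 ≤ 2 * r := by omega
    exact_mod_cast this
  have h3 := bχ j (by omega)
  push_cast at h2 ⊢
  have h4 := siteNorm_nonneg (χ (j + 1))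
  have h5 := siteNorm_nonneg (lieE χ (s - j) f)
  have h6 : (0 : ℝ) ≤ 2 * (2 * (j + 1) + 2) * siteNorm (χ (j + 1)) := by positivity
  exact mul_le_mul h3 (mul_le_mul_of_nonneg_right h2 h5) (by positivity) (h6.trans h3)

/-- The term j = s is kept apart: it involves f itself, for which a separate bound is available, and
it drives the recursion. -/
theorem succ_mul_siteNorm_lieE_le (χ : ℕ → Poly N) (s : ℕ) (f : Poly N) :
    ((s : ℝ) + 1) * siteNorm (lieE χ (s + 1) f) ≤ ((s : ℝ) + 1) * siteNorm (poisson (χ (s + 1)) f) +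
      ∑ j ∈ Finset.range s, ((j : ℝ) + 1) * siteNorm (poisson (χ (j + 1)) (lieE χ (s - j) f)) := by
  have h := congrArg siteNorm (succ_smul_lieE χ s f)
  rw [siteNorm_smul, abs_of_nonneg (by positivity), Finset.sum_range_succ, Nat.sub_self,
    lieE_zero] at h
  rw [h, add_comm]
  refine (siteNorm_add_le _ _).trans (add_le_add ?_ ?_)
  · rw [siteNorm_smul, abs_of_nonneg (by positivity)]
  · refine (siteNorm_sum_le _ _).trans (Finset.sum_le_sum fun j _ => ?_)
    rw [siteNorm_smul, abs_of_nonneg (by positivity)]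

theorem siteNorm_lieE_le {χ : ℕ → Poly N} {r s l : ℕ} {α g : ℝ} {f : Poly N} (hα : 0 ≤ α)
    (hg : g = 3 * α * r ^ 2)
    (hχ : ∀ j, 1 ≤ j → j ≤ s + 1 → (χ j).IsHomogeneous (2 * j + 2))
    (cχ : ∀ j, 1 ≤ j → j ≤ s + 1 → IsCyclic (χ j))
    (bχ : ∀ j, j + 1 ≤ s + 1 → 2 * (2 * (j + 1) + 2 : ℝ) * siteNorm (χ (j + 1)) ≤ α * g ^ j)
    (hf : f.IsHomogeneous (2 * l + 2)) (cf : IsCyclic f) (hs : s + 1 + l ≤ r) :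
    siteNorm (lieE χ (s + 1) f) ≤ 3 * r * α * g ^ s * siteNorm f := by
  have hg0 : 0 ≤ g := by rw [hg]; positivity
  -- the recursion is applied to the sequence cut off beyond the order `s + 1`
  have h := le_of_recursion (r := r) (e := fun t => if t ≤ s + 1 then siteNorm (lieE χ t f) else 0)
    (u := 2 * r * α * siteNorm f) hα
    (mul_nonneg (by positivity) (siteNorm_nonneg f)) hg (fun t ht => ?_) (s := s) (by omega)
  · simp only [le_refl, if_true] at h
    refine h.trans (le_of_eq (by ring))
  · by_cases hts : t ≤ s
    · rw [if_pos (by omega)]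
      refine (succ_mul_siteNorm_lieE_le χ t f).trans (add_le_add ?_ (Finset.sum_le_sum ?_))
      · have := siteNorm_lieE_poisson_le (s := t) (r := r) (fun j h1 h2 => hχ j h1 (by omega))
          (fun j h1 h2 => cχ j h1 (by omega)) (fun j h1 => bχ j (by omega)) hf cf (by omega) t le_rfl
        rw [Nat.sub_self, lieE_zero] at this
        refine mul_le_mul_of_nonneg_left (this.trans (le_of_eq (by ring))) (by positivity)
      · intro j hj
        have hj' := Finset.mem_range.1 hj
        rw [if_pos (by omega)]
        have := siteNorm_lieE_poisson_le (s := t) (r := r) (fun j h1 h2 => hχ j h1 (by omega))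
          (fun j h1 h2 => cχ j h1 (by omega)) (fun j h1 => bχ j (by omega)) hf cf (by omega) j
          hj'.le
        exact mul_le_mul_of_nonneg_left this (by positivity)
    · rw [if_neg (by omega), mul_zero]
      have hn := siteNorm_nonneg f
      refine add_nonneg (by positivity) (Finset.sum_nonneg fun j _ => ?_)
      split_ifs
      · have := siteNorm_nonneg (lieE χ (t - j) f)
        positivity
      · simp

end LieTransform

end KleinGordon
end

noncomputable section

namespace KleinGordon

open MvPolynomial

set_option linter.unusedSectionVars false

/-! ### A priori bounds and existence of normal forms. -/

section NormalForm

variable {N : ℕ} [NeZero N] {a κ : ℝ} {r : ℕ}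

/-- The properties of the Hamiltonian in the coordinates `(q, p)` on which the perturbative
construction up to order `r` relies. -/
structure IsAdmissible (N : ℕ) [NeZero N] (a κ : ℝ) (r : ℕ) : Prop where
  one_le : 1 ≤ r
  om_pos : 0 < Om N a
  hom_quad : (toNormal a (quadPart N a)).IsHomogeneous 2
  hom_quart : (toNormal a (quartPart N)).IsHomogeneous 4
  cyclic_quad : IsCyclic (toNormal a (quadPart N a))
  cyclic_quart : IsCyclic (toNormal a (quartPart N))
  commute : poisson (HOm N a) (toNormal a (quadPart N a)) = 0
  quart_le : siteNorm (toNormal a (quartPart N)) ≤ κ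
  zero_le : 16 * r * siteNorm (Zzero N a) ≤ Om N a / 50

/-! ### The linear part -/

theorem poisson_quad_eq (f : Poly N) : poisson f (toNormal a (quadPart N a)) =
    poisson f (HOm N a) + poisson f (Zzero N a) := by
  rw [← poisson_add_right, Zzero, add_sub_cancel]

/-- The bracket estimate gives 8(s + 1)‖Z_0‖‖f‖, and s + 1 ≤ 2r turns the constant into the 16r of
`zero_le`. -/
theorem IsAdmissible.siteNorm_poisson_Zzero_le (h : IsAdmissible N a κ r) {s : ℕ} {f : Poly N}
    (hs : s ≤ r) (hf : f.IsHomogeneous (2 * s + 2)) (cf : IsCyclic f) :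
    siteNorm (poisson f (Zzero N a)) ≤ Om N a / 50 * siteNorm f := by
  have h1 := siteNorm_poisson_le hf (h.hom_quad.sub (isHomogeneous_HOm a)) cf
    (h.cyclic_quad.sub (isCyclic_HOm a))
  change siteNorm (poisson f (Zzero N a)) ≤ _ * _ * siteNorm f * (_ * siteNorm (Zzero N a)) at h1
  refine h1.trans ?_
  have h2 : (s : ℝ) + 1 ≤ 2 * r := by
    have := h.one_le
    have : s + 1 ≤ 2 * r := by omega
    exact_mod_cast this
  have hz := siteNorm_nonneg (Zzero N a)
  have hn := siteNorm_nonneg f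
  push_cast
  calc 2 * (2 * (s : ℝ) + 2) * siteNorm f * (2 * siteNorm (Zzero N a))
      = 8 * ((s : ℝ) + 1) * siteNorm (Zzero N a) * siteNorm f := by ring
    _ ≤ 8 * (2 * r) * siteNorm (Zzero N a) * siteNorm f := by gcongr
    _ = 16 * r * siteNorm (Zzero N a) * siteNorm f := by ring
    _ ≤ _ := mul_le_mul_of_nonneg_right h.zero_le hn

theorem siteNorm_poisson_comm (f g : Poly N) : siteNorm (poisson f g) = siteNorm (poisson g f) := by
  rw [poisson_comm, siteNorm_neg]

/-- The gap 2Ω of {H_Ω, ·} less the perturbation Ω/50 caused by Z_0. -/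
theorem IsAdmissible.mul_siteNorm_le (h : IsAdmissible N a κ r) {s : ℕ} {f : Poly N}
    (hs : s ≤ r) (hf : f.IsHomogeneous (2 * s + 2)) (cf : IsCyclic f) (nf : IsNonresonant f) :
    99 / 50 * Om N a * siteNorm f ≤ siteNorm (poisson f (toNormal a (quadPart N a))) := by
  have h1 := h.siteNorm_poisson_Zzero_le hs hf cf
  have h2 := two_mul_siteNorm_le (n := s + 1) h.om_pos.le hf nf
  rw [siteNorm_poisson_comm] at h2
  have h3 : poisson f (HOm N a) =
      poisson f (toNormal a (quadPart N a)) - poisson f (Zzero N a) := by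
    rw [poisson_quad_eq, add_sub_cancel_right]
  rw [h3] at h2
  have h4 := siteNorm_sub_le (poisson f (toNormal a (quadPart N a))) (poisson f (Zzero N a))
  linarith

/-- The bracket with Z_0 is at most 1/99 of the bracket with H_0, and 1 + 1/99 ≤ 51/50. -/
theorem IsAdmissible.siteNorm_poisson_HOm_le (h : IsAdmissible N a κ r) {s : ℕ} {f : Poly N}
    (hs : s ≤ r) (hf : f.IsHomogeneous (2 * s + 2)) (cf : IsCyclic f) (nf : IsNonresonant f) :
    siteNorm (poisson f (HOm N a)) ≤
      51 / 50 * siteNorm (poisson f (toNormal a (quadPart N a))) := by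
  have h1 := h.siteNorm_poisson_Zzero_le hs hf cf
  have h2 := h.mul_siteNorm_le hs hf cf nf
  have h3 : poisson f (HOm N a) =
      poisson f (toNormal a (quadPart N a)) - poisson f (Zzero N a) := by
    rw [poisson_quad_eq, add_sub_cancel_right]
  rw [h3]
  have h4 := siteNorm_sub_le (poisson f (toNormal a (quadPart N a))) (poisson f (Zzero N a))
  have := siteNorm_nonneg f
  have := siteNorm_nonneg (poisson f (toNormal a (quadPart N a)))
  linarith

theorem IsAdmissible.siteNorm_poisson_quart_le (h : IsAdmissible N a κ r) {s : ℕ} {f : Poly N}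
    {B : ℝ} (hf : f.IsHomogeneous (2 * s + 2)) (cf : IsCyclic f)
    (hB : 2 * (2 * s + 2 : ℝ) * siteNorm f ≤ B) :
    siteNorm (poisson f (toNormal a (quartPart N))) ≤ B * (4 * κ) := by
  have h1 := siteNorm_poisson_le hf h.hom_quart cf h.cyclic_quart
  have h2 := h.quart_le
  have h3 := siteNorm_nonneg (toNormal a (quartPart N))
  have h4 : 0 ≤ 2 * (2 * s + 2 : ℝ) * siteNorm f := mul_nonneg (by positivity) (siteNorm_nonneg f)
  generalize siteNorm (toNormal a (quartPart N)) = x at *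
  push_cast at h1
  exact h1.trans (mul_le_mul hB (mul_le_mul_of_nonneg_left h2 (by norm_num))
    (mul_nonneg (by norm_num) h3) (h4.trans hB))

/-- As {H_Ω, H_0} = 0, the Jacobi identity writes the polynomial as {H_Ω, {g, H_0}}, an element of
the range of {H_Ω, ·}. -/
theorem IsAdmissible.isNonresonant_poisson_quad (h : IsAdmissible N a κ r) (g : Poly N) :
    IsNonresonant (poisson (poisson (HOm N a) g) (toNormal a (quadPart N a))) := by
  have := poisson_HOm_poisson a g (toNormal a (quadPart N a))
  rw [h.commute, poisson_zero_right, add_zero] at this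
  rw [← this]
  exact isNonresonant_poisson a _

/-! ### Estimates of a normal form -/

namespace IsNormalForm

variable {χ Z : ℕ → Poly N}

theorem gen_homogeneous (hn : IsNormalForm N a r χ Z) {s : ℕ} (h1 : 1 ≤ s) (h2 : s ≤ r) :
    (χ s).IsHomogeneous (2 * s + 2) := by
  obtain ⟨g, hg, e⟩ := hn.gen_range s h1 h2
  have := isHomogeneous_poisson (m := 0) (isHomogeneous_HOm a) hg
  rwa [zero_add, ← e] at this

theorem gen_nonresonant (hn : IsNormalForm N a r χ Z) {s : ℕ} (h1 : 1 ≤ s) (h2 : s ≤ r) :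
    IsNonresonant (χ s) := by
  obtain ⟨g, hg, e⟩ := hn.gen_range s h1 h2
  rw [e]
  exact isNonresonant_poisson a g

theorem normal_zero (hn : IsNormalForm N a r χ Z) : Z 0 = toNormal a (quadPart N a) := by
  have := hn.transform 0 (Nat.zero_le _)
  rwa [Finset.sum_range_one, lieE_zero, if_pos rfl] at this

/-- The right hand side `Ψ_s = Z_s + {χ_s, H_0}` of the homological equation. -/
theorem siteNorm_le (h : IsAdmissible N a κ r) (hn : IsNormalForm N a r χ Z) {s : ℕ}
    (h1 : 1 ≤ s) (h2 : s ≤ r) :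
    siteNorm (Z s) ≤ siteNorm (Z s + poisson (χ s) (toNormal a (quadPart N a))) ∧
    99 / 50 * Om N a * siteNorm (χ s) ≤
      siteNorm (Z s + poisson (χ s) (toNormal a (quadPart N a))) ∧
    siteNorm (poisson (χ s) (HOm N a)) ≤
      51 / 50 * siteNorm (Z s + poisson (χ s) (toNormal a (quadPart N a))) := by
  have hZ : IsResonant (Z s) := isResonant_of_poisson_eq_zero h.om_pos.ne' (hn.normal_commute s h2)
  have hR : IsNonresonant (poisson (χ s) (toNormal a (quadPart N a))) := by
    obtain ⟨g, hg, e⟩ := hn.gen_range s h1 h2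
    rw [e]
    exact h.isNonresonant_poisson_quad g
  have h3 := IsNonresonant.siteNorm_le_add hZ hR
  have hh := hn.gen_homogeneous h1 h2
  have hc := hn.gen_cyclic s h1 h2
  have hr := hn.gen_nonresonant h1 h2
  exact ⟨hZ.siteNorm_le_add hR, (h.mul_siteNorm_le h2 hh hc hr).trans h3,
    (h.siteNorm_poisson_HOm_le h2 hh hc hr).trans (by linarith)⟩

/-- The denominator j + 2 in the bound of the right hand side cancels the degree 2(j + 2) of the
generator. This is why that denominator is carried through the induction, and it fixes α. -/
theorem gen_le (h : IsAdmissible N a κ r) (hn : IsNormalForm N a r χ Z) {j : ℕ} {g α : ℝ}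
    (hα : α = 8 * κ / (99 / 50 * Om N a)) (hj : j + 1 ≤ r)
    (hψ : siteNorm (Z (j + 1) + poisson (χ (j + 1)) (toNormal a (quadPart N a))) ≤
      2 * κ * g ^ j / (j + 2)) :
    2 * (2 * (j + 1) + 2 : ℝ) * siteNorm (χ (j + 1)) ≤ α * g ^ j := by
  have h1 := (hn.siteNorm_le h (Nat.le_add_left 1 j) hj).2.1.trans hψ
  have hγ : 0 < 99 / 50 * Om N a := mul_pos (by norm_num) h.om_pos
  have h2 : siteNorm (χ (j + 1)) ≤ 2 * κ * g ^ j / (j + 2) / (99 / 50 * Om N a) := by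
    rw [le_div_iff₀ hγ, mul_comm]; exact h1
  have hj0 : (0 : ℝ) < (j : ℝ) + 2 := by positivity
  calc 2 * (2 * (j + 1) + 2 : ℝ) * siteNorm (χ (j + 1))
      ≤ 2 * (2 * (j + 1) + 2 : ℝ) * (2 * κ * g ^ j / (j + 2) / (99 / 50 * Om N a)) := by gcongr
    _ = α * g ^ j := by
      rw [hα]
      field_simp
      ring

/-- Among the H_t only H_0 and H_1 survive in `succ_smul_transform`. The H_0 term joins Z_{s+2} to
form the left hand side. No Lie transform of Z_0, which is not small, appears on the right. -/
theorem homological_equation (hn : IsNormalForm N a r χ Z) {s : ℕ} (hs : s + 2 ≤ r) :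
    ((s : ℝ) + 2) • (Z (s + 2) + poisson (χ (s + 2)) (toNormal a (quadPart N a))) =
      -(((s : ℝ) + 1) • poisson (χ (s + 1)) (toNormal a (quartPart N)) +
        ∑ l ∈ Finset.range (s + 1), ((l : ℝ) + 1) • lieE χ (s + 1 - l) (Z (l + 1))) := by
  have h := succ_smul_transform (s := s + 1) (χ := χ) (Z := Z)
    (H := fun s => if s = 0 then toNormal a (quadPart N a)
      else if s = 1 then toNormal a (quartPart N) else 0)
    fun t ht => hn.transform t (by omega)
  have h1 : ∑ j ∈ Finset.range s, ((j : ℝ) + 1) • poisson (χ (j + 1))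
      (if s + 1 - j = 0 then toNormal a (quadPart N a)
        else if s + 1 - j = 1 then toNormal a (quartPart N) else 0) = 0 := by
    refine Finset.sum_eq_zero fun j hj => ?_
    have := Finset.mem_range.1 hj
    rw [if_neg (by omega), if_neg (by omega), poisson_zero_right, smul_zero]
  rw [if_neg (by omega), if_neg (by omega), smul_zero, Finset.sum_range_succ, Finset.sum_range_succ,
    h1, zero_add, if_neg (by omega), if_pos (by omega), if_pos (by omega), Finset.sum_range_succ',
    Finset.sum_range_succ, Nat.cast_zero, zero_smul, add_zero, show s + 1 + 1 - (s + 1 + 1) = 0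
    by omega, lieE_zero] at h
  push_cast at h
  rw [eq_neg_iff_add_eq_zero, smul_add, h, show (s : ℝ) + 1 + 1 = s + 2 by ring]
  abel

/-- A simultaneous induction: the bounds at lower orders give those of the generators (`gen_le`),
hence of the Lie transforms (`siteNorm_lieE_le`), and the homological equation with
`homological_step` closes the circle. -/
theorem rhs_le (h : IsAdmissible N a κ r) (hn : IsNormalForm N a r χ Z) {g α : ℝ}
    (hα : α = 8 * κ / (99 / 50 * Om N a)) (hg : g = 3 * α * r ^ 2) {s : ℕ} (hs : s + 1 ≤ r) :
    siteNorm (Z (s + 1) + poisson (χ (s + 1)) (toNormal a (quadPart N a))) ≤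
      2 * κ * g ^ s / (s + 2) := by
  have hκ : 0 ≤ κ := (siteNorm_nonneg _).trans h.quart_le
  have hα0 : 0 ≤ α := by
    rw [hα]; exact div_nonneg (by positivity) (mul_pos (by norm_num) h.om_pos).le
  induction s using Nat.strong_induction_on with
  | _ s ih =>
  rcases s with _ | s
  · have h1 := hn.transform 1 hs
    rw [Finset.sum_range_succ, Finset.sum_range_one, Nat.sub_zero, Nat.sub_self, lieE_zero,
      if_neg one_ne_zero, if_pos rfl, lieE_succ, hn.normal_zero] at h1
    simp only [zero_add, Finset.range_one, Finset.sum_singleton, Nat.cast_zero, div_one, one_smul,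
      Nat.sub_self, lieE_zero] at h1
    -- At first order the right hand side is H_1 itself, and 2κ/2 = κ.
    rw [zero_add, add_comm, h1]
    refine h.quart_le.trans (le_of_eq ?_)
    norm_num
  · have hχ : ∀ j, 1 ≤ j → j ≤ s + 1 → (χ j).IsHomogeneous (2 * j + 2) :=
      fun j h1 h2 => hn.gen_homogeneous h1 (by omega)
    have cχ : ∀ j, 1 ≤ j → j ≤ s + 1 → IsCyclic (χ j) :=
      fun j h1 h2 => hn.gen_cyclic j h1 (by omega)
    have bχ : ∀ j, j + 1 ≤ s + 1 →
        2 * (2 * (j + 1) + 2 : ℝ) * siteNorm (χ (j + 1)) ≤ α * g ^ j :=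
      fun j hj => hn.gen_le h hα (by omega) (ih j (by omega) (by omega))
    have h1 := congrArg siteNorm (hn.homological_equation hs)
    rw [siteNorm_smul, siteNorm_neg, abs_of_nonneg (by positivity)] at h1
    have h2 : siteNorm (((s : ℝ) + 1) • poisson (χ (s + 1)) (toNormal a (quartPart N))) ≤
        ((s : ℝ) + 1) * (α * g ^ s * (4 * κ)) := by
      rw [siteNorm_smul, abs_of_nonneg (by positivity)]
      refine mul_le_mul_of_nonneg_left ?_ (by positivity)
      exact h.siteNorm_poisson_quart_le (hχ (s + 1) (by omega) le_rfl)
        (cχ (s + 1) (by omega) le_rfl) (by exact_mod_cast bχ s le_rfl)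
    have h5 : siteNorm (∑ l ∈ Finset.range (s + 1),
        ((l : ℝ) + 1) • lieE χ (s + 1 - l) (Z (l + 1))) ≤
        ∑ l ∈ Finset.range (s + 1), ((l : ℝ) + 1) * (3 * r * α * g ^ (s - l) *
          siteNorm (Z (l + 1) + poisson (χ (l + 1)) (toNormal a (quadPart N a)))) := by
      refine (siteNorm_sum_le _ _).trans (Finset.sum_le_sum fun l hl => ?_)
      have hl' := Finset.mem_range.1 hl
      rw [siteNorm_smul, abs_of_nonneg (by positivity)]
      have hg0 : 0 ≤ g := by rw [hg]; positivity
      refine mul_le_mul_of_nonneg_left ?_ (by positivity)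
      rw [show s + 1 - l = (s - l) + 1 by omega]
      refine (siteNorm_lieE_le (r := r) (s := s - l) (l := l + 1) hα0 hg
        (fun j h1 h2 => hχ j h1 (by omega)) (fun j h1 h2 => cχ j h1 (by omega))
        (fun j h1 => bχ j (by omega)) (hn.normal_homogeneous (l + 1) (by omega))
        (hn.normal_cyclic (l + 1) (by omega)) (by omega)).trans ?_
      exact mul_le_mul_of_nonneg_left (hn.siteNorm_le h (by omega) (by omega)).1 (by positivity)
    have h6 := homological_step (ψ := fun l => siteNorm (Z l + poisson (χ l)
      (toNormal a (quadPart N a)))) hκ hα0 hg hs (fun l hl => ih l (by omega) (by omega))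
    have h7 := (h1.le.trans (siteNorm_add_le _ _)).trans ((add_le_add h2 h5).trans h6)
    have h8 := le_of_mul_le_mul_left h7 (by positivity)
    refine h8.trans (le_of_eq ?_)
    push_cast
    ring

/-- The components of the adiabatic invariant decay geometrically. -/
theorem siteNorm_lieE_HOm_le (h : IsAdmissible N a κ r) (hn : IsNormalForm N a r χ Z) {g α : ℝ}
    (hα : α = 8 * κ / (99 / 50 * Om N a)) (hg : g = 3 * α * r ^ 2) {s : ℕ} (hs : s + 1 ≤ r) :
    siteNorm (lieE χ (s + 1) (HOm N a)) ≤ 3 / 2 * (51 / 50 * κ) * g ^ s := by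
  have hκ : 0 ≤ κ := (siteNorm_nonneg _).trans h.quart_le
  have hα0 : 0 ≤ α := by
    rw [hα]; exact div_nonneg (by positivity) (mul_pos (by norm_num) h.om_pos).le
  have hg0 : 0 ≤ g := by rw [hg]; positivity
  refine le_of_recursion (e := fun t => siteNorm (lieE χ t (HOm N a))) hα0
    (u := 51 / 50 * κ) (by positivity) hg (fun t ht => ?_) hs
  refine (succ_mul_siteNorm_lieE_le χ t _).trans (add_le_add ?_ (Finset.sum_le_sum fun j hj => ?_))
  -- {χ_{t+1}, H_Ω} is controlled through the homological equation; the general bracket estimate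
  -- would lose a constant factor.
  · refine mul_le_mul_of_nonneg_left ?_ (by positivity)
    refine (hn.siteNorm_le h (by omega) ht).2.2.trans ?_
    have h1 := hn.rhs_le h hα hg ht
    have h2 : 2 * κ * g ^ t / ((t : ℝ) + 2) ≤ κ * g ^ t := by
      rw [div_le_iff₀ (by positivity)]
      have : 0 ≤ κ * g ^ t * t := by positivity
      linarith
    linarith
  · have hj' := Finset.mem_range.1 hj
    refine mul_le_mul_of_nonneg_left ?_ (by positivity)
    exact siteNorm_lieE_poisson_le (l := 0) (fun j h1 h2 => hn.gen_homogeneous h1 (by omega))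
      (fun j h1 h2 => hn.gen_cyclic j h1 (by omega))
      (fun j h1 => hn.gen_le h hα (by omega) (hn.rhs_le h hα hg (by omega)))
      (isHomogeneous_HOm a) (isCyclic_HOm a) (by omega) j hj'.le

end IsNormalForm

/-! ### Existence of the normal form -/

/-- The cyclically symmetric homogeneous polynomials of degree `n`. -/
def cyclicHomogeneous (N : ℕ) [NeZero N] (n : ℕ) : Submodule ℝ (Poly N) where
  carrier := {f | f.IsHomogeneous n ∧ IsCyclic f}
  add_mem' h h' := ⟨h.1.add h'.1, h.2.add h'.2⟩
  zero_mem' := ⟨isHomogeneous_zero _ _ _, isCyclic_zero⟩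
  smul_mem' c _ h := ⟨isHomogeneous_smul h.1 c, h.2.smul c⟩

instance (n : ℕ) : FiniteDimensional ℝ (cyclicHomogeneous N n) := by
  have : FiniteDimensional ℝ (homogeneousSubmodule (ZMod N ⊕ ZMod N) ℝ n) :=
    Module.Finite.iff_fg.2 (homogeneousSubmodule_fg _ _ n)
  exact Submodule.finiteDimensional_of_le (S₂ := homogeneousSubmodule (ZMod N ⊕ ZMod N) ℝ n)
    fun f hf => hf.1

/-- On the finite-dimensional space of cyclic homogeneous polynomials let T g = {{H_Ω, g}, H_0}. By
the lower bound `mul_siteNorm_le`, T g = 0 forces {H_Ω, g} = 0, so the kernel is resonant, while the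
range is nonresonant. They meet only in zero, and by rank–nullity they span the space; the kernel
component is the normal form term. -/
theorem IsAdmissible.exists_homological (h : IsAdmissible N a κ r) {s : ℕ} (hs : s ≤ r)
    {Ψ : Poly N} (hΨ : Ψ.IsHomogeneous (2 * s + 2)) (cΨ : IsCyclic Ψ) :
    ∃ g Z : Poly N, g.IsHomogeneous (2 * s + 2) ∧ IsCyclic g ∧ Z.IsHomogeneous (2 * s + 2) ∧
      IsCyclic Z ∧ poisson (HOm N a) Z = 0 ∧
      Z + poisson (poisson (HOm N a) g) (toNormal a (quadPart N a)) = Ψ := by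
  have hL : ∀ f ∈ cyclicHomogeneous N (2 * s + 2),
      poisson (HOm N a) f ∈ cyclicHomogeneous N (2 * s + 2) := fun f hf => by
    have h1 := isHomogeneous_poisson (m := 0) (isHomogeneous_HOm a) hf.1
    rw [zero_add] at h1
    exact ⟨h1, (isCyclic_HOm a).poisson hf.2⟩
  have hM : ∀ f ∈ cyclicHomogeneous N (2 * s + 2),
      poisson f (toNormal a (quadPart N a)) ∈ cyclicHomogeneous N (2 * s + 2) := fun f hf =>
    ⟨isHomogeneous_poisson (n := 0) hf.1 h.hom_quad, hf.2.poisson h.cyclic_quad⟩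
  let T : cyclicHomogeneous N (2 * s + 2) →ₗ[ℝ] cyclicHomogeneous N (2 * s + 2) :=
    { toFun := fun f => ⟨_, hM _ (hL f.1 f.2)⟩
      map_add' := fun f g => Subtype.ext (by
        change poisson (poisson _ (f.1 + g.1)) _ = _ + _
        rw [poisson_add_right, poisson_add_left])
      map_smul' := fun c f => Subtype.ext (by
        change poisson (poisson _ (c • f.1)) _ = c • _
        rw [poisson_smul_right, poisson_smul_left]) }
  have hT : ∀ f, (T f : Poly N) =
      poisson (poisson (HOm N a) f) (toNormal a (quadPart N a)) := fun f => rfl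
  have hker : ∀ f ∈ LinearMap.ker T, poisson (HOm N a) (f : Poly N) = 0 := by
    intro f hf
    have h0 : poisson (poisson (HOm N a) f) (toNormal a (quadPart N a)) = 0 := by
      rw [← hT, LinearMap.mem_ker.1 hf]; rfl
    have h1 := h.mul_siteNorm_le hs (hL f.1 f.2).1 (hL f.1 f.2).2 (isNonresonant_poisson a f.1)
    rw [h0, siteNorm_zero] at h1
    have h2 : siteNorm (poisson (HOm N a) (f : Poly N)) = 0 :=
      le_antisymm (nonpos_of_mul_nonpos_right h1 (mul_pos (by norm_num) h.om_pos))
        (siteNorm_nonneg _)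
    have h3 : coeffNorm (cplx (poisson (HOm N a) (f : Poly N))) = 0 :=
      (div_eq_zero_iff.1 h2).resolve_right (Nat.cast_ne_zero.2 (NeZero.ne N))
    exact cplx_injective ((coeffNorm_eq_zero h3).trans (map_zero _).symm)
  have hd : Disjoint (LinearMap.range T) (LinearMap.ker T) := by
    rw [Submodule.disjoint_def]
    rintro f ⟨g, rfl⟩ hf
    have h1 := isResonant_of_poisson_eq_zero h.om_pos.ne' (hker _ hf)
    have h2 : IsNonresonant (T g : Poly N) := h.isNonresonant_poisson_quad g.1
    exact Subtype.ext (h1.eq_zero h2)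
  have htop := Submodule.eq_top_of_disjoint _ _ T.finrank_range_add_finrank_ker.ge hd
  have hmem : (⟨Ψ, hΨ, cΨ⟩ : cyclicHomogeneous N (2 * s + 2)) ∈
      LinearMap.range T ⊔ LinearMap.ker T := htop ▸ Submodule.mem_top
  obtain ⟨_, ⟨g, rfl⟩, z, hz, e⟩ := Submodule.mem_sup.1 hmem
  refine ⟨g.1, z.1, g.2.1, g.2.2, z.2.1, z.2.2, hker z hz, ?_⟩
  rw [← hT, add_comm]
  exact congrArg Subtype.val e

theorem IsAdmissible.exists_isNormalForm (h : IsAdmissible N a κ r) :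
    ∃ χ Z : ℕ → Poly N, IsNormalForm N a r χ Z := by
  suffices ∀ s ≤ r, ∃ χ Z : ℕ → Poly N, IsNormalForm N a s χ Z from this r le_rfl
  intro s
  induction s with
  | zero =>
    intro _
    refine ⟨fun _ => 0, fun _ => toNormal a (quadPart N a), ⟨?_, ?_, ?_, ?_, ?_, ?_⟩⟩
    · intro s h1 h2; omega
    · intro s h1 h2; omega
    · intro s hs; rw [Nat.le_zero.1 hs]; exact h.hom_quad
    · intro s hs; exact h.cyclic_quad
    · intro s hs; exact h.commute
    · intro s hs
      rw [Nat.le_zero.1 hs, Finset.sum_range_one, lieE_zero, if_pos rfl]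
  | succ s ih =>
    intro hs
    obtain ⟨χ, Z, hn⟩ := ih (by omega)
    set H : Poly N := if s + 1 = 1 then toNormal a (quartPart N) else 0 with hH
    -- All contributions to the order s + 1 which do not contain the unknown χ_{s+1} and Z_{s+1}.
    set Ψ : Poly N := H - ((∑ j ∈ Finset.range s, (((j : ℝ) + 1) / ((s : ℝ) + 1)) •
        poisson (χ (j + 1)) (lieE χ (s - j) (Z 0))) +
      ∑ l ∈ Finset.range s, lieE χ (s - l) (Z (l + 1))) with hΨ
    have hχ : ∀ j, 1 ≤ j → j ≤ s → (χ j).IsHomogeneous (2 * j + 2) :=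
      fun j h1 h2 => hn.gen_homogeneous h1 h2
    have hom : Ψ.IsHomogeneous (2 * (s + 1) + 2) := by
      refine IsHomogeneous.sub ?_ (IsHomogeneous.add ?_ ?_)
      · rw [hH]
        split_ifs with h1
        · rw [h1]; exact h.hom_quart
        · exact isHomogeneous_zero _ _ _
      · refine IsHomogeneous.sum _ _ _ fun j hj => isHomogeneous_smul ?_ _
        have hj' := Finset.mem_range.1 hj
        have h1 := isHomogeneous_poisson (hχ (j + 1) (by omega) (by omega))
          (isHomogeneous_lieE (s := s - j) (l := 0) (fun i h1 h2 => hχ i h1 (by omega))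
            (hn.normal_homogeneous 0 (by omega)))
        rwa [show j + 1 + (s - j + 0) = s + 1 by omega] at h1
      · refine IsHomogeneous.sum _ _ _ fun l hl => ?_
        have hl' := Finset.mem_range.1 hl
        have h1 := isHomogeneous_lieE (s := s - l) (l := l + 1)
          (fun i h1 h2 => hχ i h1 (by omega)) (hn.normal_homogeneous (l + 1) (by omega))
        rwa [show s - l + (l + 1) = s + 1 by omega] at h1
    have cyc : IsCyclic Ψ := by
      refine IsCyclic.sub ?_ (IsCyclic.add ?_ ?_)
      · rw [hH]
        split_ifs
        · exact h.cyclic_quart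
        · exact isCyclic_zero
      · refine IsCyclic.sum fun j hj => IsCyclic.smul ?_ _
        have hj' := Finset.mem_range.1 hj
        exact (hn.gen_cyclic (j + 1) (by omega) (by omega)).poisson
          (isCyclic_lieE (fun i h1 h2 => hn.gen_cyclic i h1 (by omega))
            (hn.normal_cyclic 0 (by omega)))
      · refine IsCyclic.sum fun l hl => ?_
        have hl' := Finset.mem_range.1 hl
        exact isCyclic_lieE (fun i h1 h2 => hn.gen_cyclic i h1 (by omega))
          (hn.normal_cyclic (l + 1) (by omega))
    obtain ⟨g, z, hg, cg, hz, cz, hc, e⟩ := h.exists_homological hs hom cyc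
    have uχ : ∀ j, j ≤ s → Function.update χ (s + 1) (poisson (HOm N a) g) j = χ j :=
      fun j hj => Function.update_of_ne (by omega) _ _
    have uZ : ∀ j, j ≤ s → Function.update Z (s + 1) z j = Z j :=
      fun j hj => Function.update_of_ne (by omega) _ _
    have uE : ∀ t ≤ s, ∀ f, lieE (Function.update χ (s + 1) (poisson (HOm N a) g)) t f =
        lieE χ t f := fun t ht f => lieE_congr (fun j _ hj => uχ j (hj.trans ht)) f
    refine ⟨Function.update χ (s + 1) (poisson (HOm N a) g), Function.update Z (s + 1) z,
      ⟨?_, ?_, ?_, ?_, ?_, ?_⟩⟩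
    · intro t h1 h2
      rcases Nat.lt_or_eq_of_le h2 with h3 | rfl
      · rw [uχ t (by omega)]; exact hn.gen_range t h1 (by omega)
      · rw [Function.update_self]; exact ⟨g, hg, rfl⟩
    · intro t h1 h2
      rcases Nat.lt_or_eq_of_le h2 with h3 | rfl
      · rw [uχ t (by omega)]; exact hn.gen_cyclic t h1 (by omega)
      · rw [Function.update_self]; exact (isCyclic_HOm a).poisson cg
    · intro t h2
      rcases Nat.lt_or_eq_of_le h2 with h3 | rfl
      · rw [uZ t (by omega)]; exact hn.normal_homogeneous t (by omega)
      · rw [Function.update_self]; exact hz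
    · intro t h2
      rcases Nat.lt_or_eq_of_le h2 with h3 | rfl
      · rw [uZ t (by omega)]; exact hn.normal_cyclic t (by omega)
      · rw [Function.update_self]; exact cz
    · intro t h2
      rcases Nat.lt_or_eq_of_le h2 with h3 | rfl
      · rw [uZ t (by omega)]; exact hn.normal_commute t (by omega)
      · rw [Function.update_self]; exact hc
    · intro t h2
      rcases Nat.lt_or_eq_of_le h2 with h3 | rfl
      · rw [← hn.transform t (by omega)]
        refine Finset.sum_congr rfl fun l hl => ?_
        have hl' := Finset.mem_range.1 hl
        rw [uZ l (by omega), uE _ (by omega)]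
      · rw [if_neg (by omega), ← hH, Finset.sum_range_succ, Nat.sub_self, lieE_zero,
          Function.update_self, Finset.sum_range_succ', Nat.sub_zero, lieE_succ,
          Finset.sum_range_succ, Nat.sub_self, lieE_zero, Function.update_self,
          div_self (by positivity), one_smul, uZ 0 (Nat.zero_le _)]
        have h1 : ∀ j ∈ Finset.range s, (((j : ℝ) + 1) / ((s : ℝ) + 1)) •
            poisson (Function.update χ (s + 1) (poisson (HOm N a) g) (j + 1))
              (lieE (Function.update χ (s + 1) (poisson (HOm N a) g)) (s - j) (Z 0)) =
            (((j : ℝ) + 1) / ((s : ℝ) + 1)) • poisson (χ (j + 1)) (lieE χ (s - j) (Z 0)) := by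
          intro j hj
          have hj' := Finset.mem_range.1 hj
          rw [uχ _ (by omega), uE _ (by omega)]
        have h2 : ∀ l ∈ Finset.range s, lieE (Function.update χ (s + 1) (poisson (HOm N a) g))
            (s + 1 - (l + 1)) (Function.update Z (s + 1) z (l + 1)) =
            lieE χ (s - l) (Z (l + 1)) := by
          intro l hl
          have hl' := Finset.mem_range.1 hl
          rw [uZ _ (by omega), uE _ (by omega), Nat.add_sub_add_right]
        rw [Finset.sum_congr rfl h1, Finset.sum_congr rfl h2, hn.normal_zero]
        rw [hn.normal_zero] at hΨ
        rw [hΨ, eq_sub_iff_add_eq] at e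
        rw [← e]
        abel

end NormalForm

end KleinGordon
end

noncomputable section

namespace KleinGordon

open MvPolynomial

set_option linter.unusedSectionVars false

/-! ### The matrix A, its powers and their row sums. -/

section CircularMatrix

variable {N : ℕ} [NeZero N] {a : ℝ}

/-! ### The matrix `A` -/

theorem matA_apply (ha : 0 < a) (i j : ZMod N) : matA N a i j = (1 + 2 * a) *
    (if i = j then 1 else 0) - a * ((if i = j + 1 then 1 else 0) + if j = i + 1 then 1 else 0) := by
  have h : (1 + 2 * a) * mu a = a := by
    rw [mu, mul_div_cancel₀ _ (by positivity)]
  simp only [matA, Matrix.smul_apply, Matrix.sub_apply, Matrix.add_apply, Matrix.transpose_apply,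
    Matrix.of_apply, Matrix.one_apply, smul_eq_mul]
  rw [mul_sub, ← mul_assoc, h]

/-- The coefficients lie in an arbitrary real algebra so that the formula serves both for real
vectors and for vectors of polynomial variables. -/
theorem map_matA_mulVec {R : Type*} [CommRing R] [Algebra ℝ R] (ha : 0 < a) (x : ZMod N → R)
    (i : ZMod N) : ((matA N a).map (algebraMap ℝ R)).mulVec x i =
      algebraMap ℝ R (1 + 2 * a) * x i - algebraMap ℝ R a * (x (i - 1) + x (i + 1)) := by
  have h : ∀ j, algebraMap ℝ R (matA N a i j) * x j = algebraMap ℝ R (1 + 2 * a) *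
      (if i = j then x j else 0) -
      algebraMap ℝ R a * ((if i - 1 = j then x j else 0) + if i + 1 = j then x j else 0) := by
    intro j
    have e1 : i = j + 1 ↔ i - 1 = j := sub_eq_iff_eq_add.symm
    rw [matA_apply ha, map_sub, map_mul, map_mul, map_add]
    simp only [e1, eq_comm (a := j)]
    split_ifs <;> simp <;> ring
  simp only [Matrix.mulVec, dotProduct, Matrix.map_apply, h, Finset.sum_sub_distrib,
    ← Finset.mul_sum, Finset.sum_add_distrib, Finset.sum_ite_eq, Finset.mem_univ, if_true]

theorem dotProduct_map_matA_mulVec {R : Type*} [CommRing R] [Algebra ℝ R] (ha : 0 < a)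
    (x : ZMod N → R) : x ⬝ᵥ ((matA N a).map (algebraMap ℝ R)).mulVec x =
      ∑ j, (x j ^ 2 + algebraMap ℝ R a * (x j - x (j - 1)) ^ 2) := by
  have h1 : ∑ j, x (j - 1) ^ 2 = ∑ j, x j ^ 2 :=
    (Equiv.subRight (1 : ZMod N)).sum_comp fun j => x j ^ 2
  have h2 : ∑ j, x j * x (j + 1) = ∑ j, x j * x (j - 1) := by
    rw [← (Equiv.subRight (1 : ZMod N)).sum_comp fun j => x j * x (j + 1)]
    refine Finset.sum_congr rfl fun j _ => ?_
    simp [mul_comm]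
  have h3 : ∀ j, x j * (algebraMap ℝ R (1 + 2 * a) * x j -
      algebraMap ℝ R a * (x (j - 1) + x (j + 1))) = x j ^ 2 + algebraMap ℝ R a * (x j ^ 2 + x j ^ 2)
        - algebraMap ℝ R a * (x j * x (j - 1)) - algebraMap ℝ R a * (x j * x (j + 1)) := by
    intro j
    rw [map_add, map_mul, map_one, map_ofNat]
    ring
  have h4 : ∀ j, x j ^ 2 + algebraMap ℝ R a * (x j - x (j - 1)) ^ 2 =
      x j ^ 2 + algebraMap ℝ R a * (x j ^ 2 + x (j - 1) ^ 2) - algebraMap ℝ R a * (x j * x (j - 1))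
        - algebraMap ℝ R a * (x j * x (j - 1)) := by
    intro j; ring
  simp only [dotProduct, map_matA_mulVec ha, h3, h4, Finset.sum_sub_distrib,
    Finset.sum_add_distrib, ← Finset.mul_sum, h1, h2]

theorem posDef_matA (ha : 0 < a) : (matA N a).PosDef := by
  refine Matrix.PosDef.of_dotProduct_mulVec_pos (matA_isHermitian N a) fun x hx => ?_
  have h := dotProduct_map_matA_mulVec ha x
  rw [show (matA N a).map (algebraMap ℝ ℝ) = matA N a from rfl] at h
  rw [show star x = x from funext fun _ => star_trivial _, h]
  obtain ⟨i, hi⟩ := Function.ne_iff.1 hx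
  refine Finset.sum_pos' (fun j _ => ?_) ⟨i, Finset.mem_univ _, ?_⟩
  · simp only [Algebra.algebraMap_self, RingHom.id_apply]; positivity
  · have : 0 < x i ^ 2 := by have := hi; simp only [Pi.zero_apply] at this; positivity
    simp only [Algebra.algebraMap_self, RingHom.id_apply]; positivity

theorem pos_of_mem_spectrum_matA (ha : 0 < a) {t : ℝ} (ht : t ∈ spectrum ℝ (matA N a)) :
    0 < t := by
  rw [(matA_isHermitian N a).spectrum_real_eq_range_eigenvalues] at ht
  obtain ⟨i, rfl⟩ := ht
  exact (posDef_matA ha).eigenvalues_pos i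

theorem continuousOn_spectrum_matA (f : ℝ → ℝ) : ContinuousOn f (spectrum ℝ (matA N a)) :=
  (Matrix.finite_real_spectrum).continuousOn f

/-! ### Powers of `A` -/

theorem powA_mul_powA (ha : 0 < a) (s t : ℝ) : powA N a s * powA N a t = powA N a (s + t) := by
  rw [powA, powA, powA, ← cfc_mul _ _ _ (continuousOn_spectrum_matA _)
    (continuousOn_spectrum_matA _)]
  exact cfc_congr fun x hx => (Real.rpow_add (pos_of_mem_spectrum_matA ha hx) s t).symm

theorem powA_one : powA N a 1 = matA N a := by
  simp only [powA, Real.rpow_one]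
  exact cfc_id' ℝ (matA N a) (matA_isHermitian N a)

theorem powA_zero : powA N a 0 = 1 := by
  simp only [powA, Real.rpow_zero]
  exact cfc_const_one ℝ (matA N a) (matA_isHermitian N a)

theorem powA_transpose (s : ℝ) : (powA N a s).transpose = powA N a s := by
  have h : IsSelfAdjoint (powA N a s) := cfc_predicate _ _
  rw [← Matrix.conjTranspose_eq_transpose_of_trivial]
  exact h

theorem powA_symm (s : ℝ) (i j : ZMod N) : powA N a s i j = powA N a s j i := by
  conv_lhs => rw [← powA_transpose, Matrix.transpose_apply]

theorem trace_cfc_matA (f : ℝ → ℝ) :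
    (cfc f (matA N a)).trace = ∑ i, f ((matA_isHermitian N a).eigenvalues i) := by
  rw [(matA_isHermitian N a).cfc_eq, Matrix.IsHermitian.cfc, Unitary.conjStarAlgAut_apply,
    Matrix.trace_mul_comm, ← mul_assoc, Unitary.coe_star_mul_self, one_mul, Matrix.trace_diagonal]
  rfl

theorem card_pos_real : (0 : ℝ) < N := Nat.cast_pos.2 (NeZero.pos N)

theorem trace_powA_half : (powA N a (1 / 2)).trace = N * Om N a := by
  rw [powA, trace_cfc_matA, Om, mul_div_cancel₀ _ (card_pos_real (N := N)).ne']
  exact Finset.sum_congr rfl fun i _ => (Real.sqrt_eq_rpow _).symm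

/-- The square of the mean of the √λ_i is at most the mean of the λ_i, which is tr(A)/N. -/
theorem Om_sq_le (ha : 0 < a) : Om N a ^ 2 ≤ 1 + 2 * a := by
  have h1 : (∑ i : ZMod N, Real.sqrt ((matA_isHermitian N a).eigenvalues i)) ^ 2 ≤
      N * ∑ i : ZMod N, (matA_isHermitian N a).eigenvalues i := by
    have h := sq_sum_le_card_mul_sum_sq (s := Finset.univ)
      (f := fun i : ZMod N => Real.sqrt ((matA_isHermitian N a).eigenvalues i))
    rw [Finset.card_univ, ZMod.card] at h
    refine h.trans_eq ?_
    congr 1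
    exact Finset.sum_congr rfl fun i _ => Real.sq_sqrt ((posDef_matA ha).eigenvalues_pos i).le
  have h2 : ∑ i : ZMod N, (matA_isHermitian N a).eigenvalues i ≤ N * (1 + 2 * a) := by
    have h3 := (matA_isHermitian N a).trace_eq_sum_eigenvalues
    have h4 : (matA N a).trace ≤ ∑ _i : ZMod N, (1 + 2 * a) := by
      refine Finset.sum_le_sum fun i _ => ?_
      -- Only an inequality: for N = 1 the shift terms also lie on the diagonal.
      rw [Matrix.diag_apply, matA_apply ha, if_pos rfl]
      split_ifs <;> linarith
    rw [Finset.sum_const, Finset.card_univ, ZMod.card, nsmul_eq_mul] at h4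
    simp only [RCLike.ofReal_real_eq_id, id_eq] at h3
    rw [← h3]; exact h4
  have hN := card_pos_real (N := N)
  rw [Om, div_pow, div_le_iff₀ (by positivity)]
  calc _ ≤ _ := h1
    _ ≤ N * (N * (1 + 2 * a)) := by gcongr
    _ = _ := by ring

/-- Cauchy–Schwarz for the Frobenius product of A^{1/4} and A^{-1/4}, whose value is N; the two
squared norms are tr A^{1/2} = NΩ and tr A^{-1/2}. -/
theorem card_le_trace_powA (ha : 0 < a) : N ≤ Om N a * (powA N a (-(1 / 2))).trace := by
  have h0 : (N : ℝ) = ∑ p : ZMod N × ZMod N, powA N a (1 / 4) p.1 p.2 * powA N a (-(1 / 4)) p.1 p.2 := by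
    have h1 : (powA N a (1 / 4) * powA N a (-(1 / 4))).trace = N := by
      rw [powA_mul_powA ha, add_neg_cancel, powA_zero, Matrix.trace_one, ZMod.card]
    rw [← h1, Fintype.sum_prod_type]
    simp only [Matrix.trace, Matrix.diag_apply, Matrix.mul_apply]
    exact Finset.sum_congr rfl fun i _ => Finset.sum_congr rfl fun j _ => by
      rw [powA_symm (-(1 / 4)) j i]
  have hsq : ∀ s : ℝ, ∑ p : ZMod N × ZMod N, powA N a s p.1 p.2 ^ 2 =
      (powA N a (s + s)).trace := by
    intro s
    rw [← powA_mul_powA ha, Fintype.sum_prod_type]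
    simp only [Matrix.trace, Matrix.diag_apply, Matrix.mul_apply]
    exact Finset.sum_congr rfl fun i _ => Finset.sum_congr rfl fun j _ => by
      rw [powA_symm s j i, sq]
  have h2 := Finset.sum_mul_sq_le_sq_mul_sq Finset.univ
    (fun p : ZMod N × ZMod N => powA N a (1 / 4) p.1 p.2)
    (fun p : ZMod N × ZMod N => powA N a (-(1 / 4)) p.1 p.2)
  rw [← h0, hsq, hsq, show (1 / 4 : ℝ) + 1 / 4 = 1 / 2 by norm_num,
    show (-(1 / 4) : ℝ) + -(1 / 4) = -(1 / 2) by norm_num, trace_powA_half] at h2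
  have hN := card_pos_real (N := N)
  refine le_of_mul_le_mul_left ?_ hN
  calc (N : ℝ) * N = N ^ 2 := (sq _).symm
    _ ≤ _ := h2
    _ = _ := by ring

/-! ### Bounds of the rows of the powers of `A` -/

theorem powA_eq_exp (ha : 0 < a) (s : ℝ) : powA N a s =
    NormedSpace.exp ((4 * s) • cfc (fun t : ℝ => Real.log t / 4) (matA N a)) := by
  set U := (matA_isHermitian N a).eigenvectorUnitary with hU
  have hcfc : ∀ f : ℝ → ℝ, cfc f (matA N a) = (U : Matrix (ZMod N) (ZMod N) ℝ) *
      Matrix.diagonal (f ∘ (matA_isHermitian N a).eigenvalues) *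
      (U : Matrix (ZMod N) (ZMod N) ℝ)⁻¹ := by
    intro f
    have hinv : (U : Matrix (ZMod N) (ZMod N) ℝ)⁻¹ =
        ((star U : Matrix.unitaryGroup (ZMod N) ℝ) : Matrix (ZMod N) (ZMod N) ℝ) :=
      Matrix.inv_eq_left_inv (Unitary.coe_star_mul_self U)
    rw [(matA_isHermitian N a).cfc_eq, Matrix.IsHermitian.cfc, Unitary.conjStarAlgAut_apply, hinv]
    rfl
  have hunit : IsUnit (U : Matrix (ZMod N) (ZMod N) ℝ) := (Unitary.toUnits U).isUnit
  rw [powA, hcfc, hcfc, ← Matrix.smul_mul, ← Matrix.mul_smul, Matrix.exp_conj _ _ hunit,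
    ← Matrix.diagonal_smul, Matrix.exp_diagonal]
  congr 3
  funext i
  have hpos := (posDef_matA (N := N) ha).eigenvalues_pos i
  rw [Pi.coe_exp]
  simp only [Function.comp_apply, Pi.smul_apply, smul_eq_mul]
  rw [← Real.exp_eq_exp_ℝ, Real.rpow_def_of_pos hpos]
  congr 1
  ring

-- The largest absolute row sum is the operator norm for the supremum norm; being submultiplicative,
-- it can be estimated termwise in the exponential series.
open scoped Matrix.Norms.Operator in
theorem sum_abs_exp_le (B : Matrix (ZMod N) (ZMod N) ℝ) {b : ℝ} (hB : ∀ i, ∑ j, |B i j| ≤ b)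
    (i : ZMod N) : ∑ j, |NormedSpace.exp B i j| ≤ Real.exp b := by
  have hrow : ∀ (M : Matrix (ZMod N) (ZMod N) ℝ) (i : ZMod N), ∑ j, |M i j| ≤ ‖M‖ := by
    intro M i
    rw [Matrix.linfty_opNorm_def]
    have := Finset.le_sup (f := fun i => ∑ j, ‖M i j‖₊) (Finset.mem_univ i)
    have h2 := NNReal.coe_le_coe.2 this
    simpa using h2
  have hb : ‖B‖ ≤ b := by
    have hb0 : 0 ≤ b := (Finset.sum_nonneg fun _ _ => abs_nonneg _).trans (hB i)
    rw [Matrix.linfty_opNorm_def]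
    lift b to NNReal using hb0
    rw [NNReal.coe_le_coe]
    refine Finset.sup_le fun i _ => ?_
    rw [← NNReal.coe_le_coe]
    simpa using hB i
  have hexp : ‖NormedSpace.exp B‖ ≤ Real.exp ‖B‖ := by
    rw [NormedSpace.exp_eq_tsum ℝ, Real.exp_eq_exp_ℝ, NormedSpace.exp_eq_tsum ℝ]
    refine tsum_of_norm_bounded (NormedSpace.expSeries_summable' (𝕂 := ℝ) ‖B‖).hasSum fun n => ?_
    rw [norm_smul, smul_eq_mul, norm_inv, Real.norm_natCast]
    gcongr
    exact norm_pow_le B n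
  exact (hrow _ i).trans (hexp.trans (Real.exp_le_exp.2 hb))

theorem sum_abs_powA_le (ha : 0 < a) {b : ℝ}
    (hb : ∀ i, ∑ j, |cfc (fun t : ℝ => Real.log t / 4) (matA N a) i j| ≤ b) {s : ℝ}
    (hs : |4 * s| = 1) (i : ZMod N) : ∑ j, |powA N a s i j| ≤ Real.exp b := by
  rw [powA_eq_exp ha]
  refine sum_abs_exp_le _ (fun i => ?_) i
  simp only [Matrix.smul_apply, smul_eq_mul, abs_mul, hs, one_mul]
  exact hb i

end CircularMatrix

end KleinGordon
end

noncomputable section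

namespace KleinGordon

open MvPolynomial

set_option linter.unusedSectionVars false

/-! ### The Hamiltonian in the coordinates (q, p), and the use of the seeds. -/

section NormalCoordinates

variable {N : ℕ} [NeZero N] {a : ℝ}

/-- The vector of the variables `X (e j)`. -/
def varVec (e : ZMod N → ZMod N ⊕ ZMod N) : ZMod N → Poly N := fun j => X (e j)

/-- The quadratic form of the matrix `S` in the variables `X (e j)`. -/
def quadForm (e : ZMod N → ZMod N ⊕ ZMod N) (S : Matrix (ZMod N) (ZMod N) ℝ) : Poly N :=
  varVec e ⬝ᵥ (S.map C).mulVec (varVec e)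

theorem quadForm_eq (e : ZMod N → ZMod N ⊕ ZMod N) (S : Matrix (ZMod N) (ZMod N) ℝ) :
    quadForm e S = ∑ i, X (e i) * ∑ j, C (S i j) * X (e j) := rfl

theorem isHomogeneous_quadForm (e : ZMod N → ZMod N ⊕ ZMod N) (S : Matrix (ZMod N) (ZMod N) ℝ) :
    (quadForm e S).IsHomogeneous 2 :=
  IsHomogeneous.sum _ _ _ fun _ _ => (isHomogeneous_X ℝ _).mul
    (IsHomogeneous.sum _ _ _ fun _ _ => isHomogeneous_C_mul_X _ _)

theorem pderiv_quadForm {e : ZMod N → ZMod N ⊕ ZMod N} (he : Function.Injective e)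
    {S : Matrix (ZMod N) (ZMod N) ℝ} (hS : ∀ i j, S i j = S j i) (i : ZMod N) :
    pderiv (e i) (quadForm e S) = 2 * ∑ j, C (S i j) * X (e j) := by
  classical
  have h1 : ∀ j, pderiv (e i) (X (e j) : Poly N) = if j = i then 1 else 0 := by
    intro j
    rw [pderiv_X, Pi.single_apply]
    simp only [he.eq_iff]
  simp only [quadForm_eq, map_sum, pderiv_mul, pderiv_C, h1, Finset.sum_add_distrib, ite_mul,
    mul_ite, one_mul, zero_mul, mul_one, mul_zero, zero_add, Finset.sum_ite_eq', Finset.mem_univ, if_true]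
  rw [two_mul]
  congr 1
  exact Finset.sum_congr rfl fun j _ => by rw [hS j i, mul_comm]

theorem pderiv_quadForm_of_forall_ne {e : ZMod N → ZMod N ⊕ ZMod N} {v : ZMod N ⊕ ZMod N}
    (h : ∀ j, e j ≠ v) (S : Matrix (ZMod N) (ZMod N) ℝ) : pderiv v (quadForm e S) = 0 := by
  simp only [quadForm_eq, map_sum, pderiv_mul, pderiv_X_of_ne (h _)]
  simp

theorem quadPart_eq (ha : 0 < a) : quadPart N a =
    C (1 / 2) * (∑ j, X (Sum.inr j) ^ 2 + quadForm Sum.inl (matA N a)) := by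
  have h := dotProduct_map_matA_mulVec ha (varVec (N := N) Sum.inl)
  rw [quadPart, quadForm]
  congr 1
  refine Eq.trans ?_ (congrArg _ h.symm)
  rw [← Finset.sum_add_distrib]
  exact Finset.sum_congr rfl fun j _ => by
    simp only [varVec, algebraMap_eq]; ring

theorem mulVec_dotProduct_mulVec {R ι : Type*} [CommRing R] [Fintype ι] (M A : Matrix ι ι R)
    (v : ι → R) : M.mulVec v ⬝ᵥ A.mulVec (M.mulVec v) =
      v ⬝ᵥ (M.transpose * A * M).mulVec v := by
  rw [← Matrix.mulVec_mulVec, ← Matrix.mulVec_mulVec, Matrix.dotProduct_mulVec v,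
    Matrix.vecMul_transpose]

theorem toNormal_X_inl (j : ZMod N) :
    toNormal a (X (Sum.inl j)) = ((powA N a (-(1 / 4))).map C).mulVec (varVec Sum.inl) j := by
  rw [toNormal, bind₁_X_right]; rfl

theorem toNormal_X_inr (j : ZMod N) :
    toNormal a (X (Sum.inr j)) = ((powA N a (1 / 4)).map C).mulVec (varVec Sum.inr) j := by
  rw [toNormal, bind₁_X_right]; rfl

theorem algHom_dotProduct_mulVec (φ : Poly N →ₐ[ℝ] Poly N) (S : Matrix (ZMod N) (ZMod N) ℝ)
    {v w : ZMod N → Poly N} (hw : ∀ j, φ (v j) = w j) :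
    φ (v ⬝ᵥ (S.map C).mulVec v) = w ⬝ᵥ (S.map C).mulVec w := by
  have h : ∀ c : ℝ, φ (C c) = C c := fun c => φ.commutes c
  simp only [dotProduct, Matrix.mulVec, Matrix.map_apply, map_sum, map_mul, h, hw]

theorem toNormal_quadForm_inl (S : Matrix (ZMod N) (ZMod N) ℝ) :
    toNormal a (quadForm Sum.inl S) =
      quadForm Sum.inl (powA N a (-(1 / 4)) * S * powA N a (-(1 / 4))) := by
  have h := mulVec_dotProduct_mulVec ((powA N a (-(1 / 4))).map (C : ℝ →+* Poly N))
    (S.map C) (varVec Sum.inl)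
  rw [← Matrix.transpose_map, powA_transpose, ← Matrix.map_mul, ← Matrix.map_mul] at h
  rw [quadForm, quadForm, ← h]
  exact algHom_dotProduct_mulVec _ S toNormal_X_inl

theorem toNormal_quadForm_inr (S : Matrix (ZMod N) (ZMod N) ℝ) :
    toNormal a (quadForm Sum.inr S) =
      quadForm Sum.inr (powA N a (1 / 4) * S * powA N a (1 / 4)) := by
  have h := mulVec_dotProduct_mulVec ((powA N a (1 / 4)).map (C : ℝ →+* Poly N))
    (S.map C) (varVec Sum.inr)
  rw [← Matrix.transpose_map, powA_transpose, ← Matrix.map_mul, ← Matrix.map_mul] at h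
  rw [quadForm, quadForm, ← h]
  exact algHom_dotProduct_mulVec _ S toNormal_X_inr

theorem quadForm_one (e : ZMod N → ZMod N ⊕ ZMod N) : quadForm e 1 = ∑ j, X (e j) ^ 2 := by
  rw [quadForm, Matrix.map_one _ C_0 C_1, Matrix.one_mulVec]
  exact Finset.sum_congr rfl fun j _ => (sq _).symm

/-- A^{1/4} A^{1/4} and A^{-1/4} A A^{-1/4} are the same matrix A^{1/2}: this is what the
coordinates are made for. -/
theorem toNormal_quadPart (ha : 0 < a) : toNormal a (quadPart N a) =
    C (1 / 2) * (quadForm Sum.inr (powA N a (1 / 2)) + quadForm Sum.inl (powA N a (1 / 2))) := by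
  have h1 := toNormal_quadForm_inr (N := N) (a := a) 1
  have h2 := toNormal_quadForm_inl (N := N) (a := a) (matA N a)
  rw [Matrix.mul_one, powA_mul_powA ha, show (1 / 4 : ℝ) + 1 / 4 = 1 / 2 by norm_num] at h1
  rw [← powA_one, powA_mul_powA ha, powA_mul_powA ha,
    show (-(1 / 4) : ℝ) + 1 + -(1 / 4) = 1 / 2 by norm_num] at h2
  rw [quadPart_eq ha, ← quadForm_one, ← powA_one, ← h1, ← h2]
  simp only [toNormal, map_mul, map_add, bind₁_C_right]

theorem isHomogeneous_toNormal_quadPart (ha : 0 < a) :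
    (toNormal a (quadPart N a)).IsHomogeneous 2 := by
  rw [toNormal_quadPart ha]
  exact ((isHomogeneous_quadForm _ _).add (isHomogeneous_quadForm _ _)).C_mul _

theorem isHomogeneous_toNormal_quartPart : (toNormal a (quartPart N)).IsHomogeneous 4 := by
  have h : (quartPart N).IsHomogeneous 4 :=
    (IsHomogeneous.sum _ _ _ fun j _ => (isHomogeneous_X ℝ _).pow 4).C_mul _
  have h2 := h.aeval (Sum.elim
    (fun j => ∑ k : ZMod N, C (powA N a (-(1 / 4)) j k) * X (Sum.inl k))
    (fun j => ∑ k : ZMod N, C (powA N a (1 / 4) j k) * X (Sum.inr k)) :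
      ZMod N ⊕ ZMod N → Poly N) (n := 1) (by
    rintro (j | j) <;> exact IsHomogeneous.sum _ _ _ fun _ _ => isHomogeneous_C_mul_X _ _)
  rwa [one_mul] at h2

theorem pderiv_inl_HOm (j : ZMod N) : pderiv (Sum.inl j) (HOm N a) =
    C (Om N a) * X (Sum.inl j) := by
  classical
  rw [HOm_eq, pderiv_C_mul, map_sum, Finset.sum_eq_single j]
  · rw [map_add, pderiv_pow, pderiv_pow, pderiv_X_self, pderiv_X_of_ne Sum.inr_ne_inl]
    rw [show Om N a = Om N a / 2 * 2 by ring, C_mul, map_ofNat]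
    simp [mul_assoc]
  · intro i _ hi
    simp [pderiv_X_of_ne (Sum.inl_injective.ne hi), pderiv_X_of_ne Sum.inr_ne_inl]
  · simp

theorem pderiv_inr_HOm (j : ZMod N) : pderiv (Sum.inr j) (HOm N a) =
    C (Om N a) * X (Sum.inr j) := by
  classical
  rw [HOm_eq, pderiv_C_mul, map_sum, Finset.sum_eq_single j]
  · rw [map_add, pderiv_pow, pderiv_pow, pderiv_X_self, pderiv_X_of_ne Sum.inl_ne_inr]
    rw [show Om N a = Om N a / 2 * 2 by ring, C_mul, map_ofNat]
    simp [mul_assoc]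
  · intro i _ hi
    simp [pderiv_X_of_ne (Sum.inr_injective.ne hi), pderiv_X_of_ne Sum.inl_ne_inr]
  · simp

/-- Both quadratic forms have the symmetric matrix A^{1/2}, so the bracket is Ω times q·A^{1/2}p -
p·A^{1/2}q = 0. -/
theorem poisson_HOm_toNormal_quadPart (ha : 0 < a) :
    poisson (HOm N a) (toNormal a (quadPart N a)) = 0 := by
  have h1 : ∀ j : ZMod N, pderiv (Sum.inl j) (toNormal a (quadPart N a)) =
      ∑ k, C (powA N a (1 / 2) j k) * X (Sum.inl k) := by
    intro j
    rw [toNormal_quadPart ha, pderiv_C_mul, map_add,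
      pderiv_quadForm_of_forall_ne (fun _ => Sum.inr_ne_inl), zero_add,
      pderiv_quadForm Sum.inl_injective (powA_symm _), ← mul_assoc, ← map_ofNat (C : ℝ →+* Poly N) 2,
      ← C_mul]
    norm_num
  have h2 : ∀ j : ZMod N, pderiv (Sum.inr j) (toNormal a (quadPart N a)) =
      ∑ k, C (powA N a (1 / 2) j k) * X (Sum.inr k) := by
    intro j
    rw [toNormal_quadPart ha, pderiv_C_mul, map_add,
      pderiv_quadForm_of_forall_ne (e := Sum.inl) (fun _ => Sum.inl_ne_inr), add_zero,
      pderiv_quadForm Sum.inr_injective (powA_symm _), ← mul_assoc, ← map_ofNat (C : ℝ →+* Poly N) 2,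
      ← C_mul]
    norm_num
  simp only [poisson, pderiv_inl_HOm, pderiv_inr_HOm, h1, h2, Finset.mul_sum,
    Finset.sum_sub_distrib]
  rw [sub_eq_zero]
  conv_rhs => rw [Finset.sum_comm]
  exact Finset.sum_congr rfl fun j _ => Finset.sum_congr rfl fun k _ => by
    rw [powA_symm _ k j]; ring

/-! ### Norms of polynomials with a seed -/

theorem coeffNorm_oplus_le (f : Poly N) : coeffNorm (oplus f) ≤ N * coeffNorm f := by
  refine (coeffNorm_sum_le _ _).trans (le_of_eq ?_)
  have h : ∀ l : ZMod N, coeffNorm (shift l f) = coeffNorm f :=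
    fun l => coeffNorm_rename (siteShift_injective l) f
  simp only [h, Finset.sum_const, Finset.card_univ, ZMod.card, nsmul_eq_mul]

theorem HasSeed.isCyclic {F : Poly N} {f : ℕ → Poly N} (h : HasSeed F f) : IsCyclic F := by
  rw [h]; exact isCyclic_oplus _

theorem HasSeed.coeffNorm_le {F : Poly N} {f : ℕ → Poly N} (h : HasSeed F f) :
    coeffNorm F ≤ N * ∑ m ∈ Finset.range (N + 1), coeffNorm (f m) := by
  rw [h]
  exact (coeffNorm_oplus_le _).trans
    (mul_le_mul_of_nonneg_left (coeffNorm_sum_le _ _) (Nat.cast_nonneg N))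

theorem siteNorm_le_div (F : Poly N) : siteNorm F ≤ coeffNorm F / N :=
  div_le_div_of_nonneg_right (coeffNorm_cplx_le F) (Nat.cast_nonneg N)

theorem geom_sum_le {x : ℝ} (h0 : 0 ≤ x) (h1 : x < 1) (n : ℕ) :
    ∑ i ∈ Finset.range n, x ^ i ≤ 1 / (1 - x) := by
  rw [le_div_iff₀ (sub_pos.2 h1), geom_sum_mul_neg]
  linarith [pow_nonneg h0 n]

theorem exp_neg_mul_nat (σ : ℝ) (m : ℕ) : Real.exp (-σ * m) = Real.exp (-σ) ^ m := by
  rw [← Real.exp_nat_mul]; congr 1; ring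

theorem sum_coeffNorm_le {f : ℕ → Poly N} {C σ : ℝ} (h : ClassD f C σ) (hC : 0 ≤ C) (hσ : 0 < σ) :
    ∑ m ∈ Finset.range (N + 1), coeffNorm (f m) ≤ C / (1 - Real.exp (-σ)) := by
  have hx : Real.exp (-σ) < 1 := Real.exp_lt_one_iff.2 (by linarith)
  calc ∑ m ∈ Finset.range (N + 1), coeffNorm (f m)
      ≤ ∑ m ∈ Finset.range (N + 1), C * Real.exp (-σ) ^ m := Finset.sum_le_sum fun m hm => by
        rw [← exp_neg_mul_nat]; exact (h m (Nat.lt_succ_iff.1 (Finset.mem_range.1 hm))).2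
    _ ≤ C * (1 / (1 - Real.exp (-σ))) := by
        rw [← Finset.mul_sum]
        exact mul_le_mul_of_nonneg_left (geom_sum_le (Real.exp_pos _).le hx _) hC
    _ = _ := by ring

/-- Without an on-site part the geometric series starts at m = 1. For Z_0 the factor e^{-σ_0} = 2μ
gained in this way makes it small. -/
theorem sum_coeffNorm_le_of_zero {f : ℕ → Poly N} {C σ : ℝ} (h : ClassD f C σ) (hC : 0 ≤ C)
    (hσ : 0 < σ) (h0 : f 0 = 0) :
    ∑ m ∈ Finset.range (N + 1), coeffNorm (f m) ≤
      C * Real.exp (-σ) / (1 - Real.exp (-σ)) := by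
  have hx : Real.exp (-σ) < 1 := Real.exp_lt_one_iff.2 (by linarith)
  rw [Finset.sum_range_succ', h0, coeffNorm_zero, add_zero]
  calc ∑ m ∈ Finset.range N, coeffNorm (f (m + 1))
      ≤ ∑ m ∈ Finset.range N, C * Real.exp (-σ) * Real.exp (-σ) ^ m :=
        Finset.sum_le_sum fun m hm => by
          have := (h (m + 1) (Finset.mem_range.1 hm)).2
          rw [exp_neg_mul_nat, pow_succ] at this
          exact this.trans (le_of_eq (by ring))
    _ ≤ C * Real.exp (-σ) * (1 / (1 - Real.exp (-σ))) := by
        rw [← Finset.mul_sum]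
        exact mul_le_mul_of_nonneg_left (geom_sum_le (Real.exp_pos _).le hx _) (by positivity)
    _ = _ := by ring

/-! ### Rows of `¼ ln A` -/

theorem sum_norm_coeff_le {σ ι 𝕜 : Type*} [Fintype ι] [NormedField 𝕜] {φ : ι → σ →₀ ℕ}
    (hφ : Function.Injective φ) (f : MvPolynomial σ 𝕜) :
    ∑ i, ‖coeff (φ i) f‖ ≤ coeffNorm f := by
  classical
  rw [coeffNorm_eq_sum_of_subset
    (Finset.subset_union_left (s₁ := f.support) (s₂ := Finset.univ.image φ)),
    ← Finset.sum_image (f := fun k => ‖coeff k f‖) hφ.injOn]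
  exact Finset.sum_le_sum_of_subset_of_nonneg Finset.subset_union_right
    fun _ _ _ => norm_nonneg _

/-- The exponent of the monomial `x_i y_j`. -/
def pairExp (p : ZMod N × ZMod N) : (ZMod N ⊕ ZMod N) →₀ ℕ :=
  Finsupp.single (Sum.inl p.1) 1 + Finsupp.single (Sum.inr p.2) 1

theorem pairExp_injective : Function.Injective (pairExp : ZMod N × ZMod N → _) := by
  classical
  intro p q h
  have h1 := DFunLike.congr_fun h (Sum.inl p.1)
  have h2 := DFunLike.congr_fun h (Sum.inr p.2)
  simp only [pairExp, Finsupp.add_apply, Finsupp.single_apply, Sum.inl.injEq, Sum.inr.injEq,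
    reduceCtorEq, if_false, if_true, add_zero, zero_add] at h1 h2
  refine Prod.ext ?_ ?_
  · by_contra hne
    rw [if_neg (Ne.symm hne)] at h1
    exact one_ne_zero h1
  · by_contra hne
    rw [if_neg (Ne.symm hne)] at h2
    exact one_ne_zero h2

theorem coeff_pairExp_chiZero (p : ZMod N × ZMod N) : coeff (pairExp p) (chiZero N a) =
    cfc (fun t : ℝ => Real.log t / 4) (matA N a) p.1 p.2 := by
  classical
  have h : chiZero N a = ∑ q : ZMod N × ZMod N,
      monomial (pairExp q) (cfc (fun t : ℝ => Real.log t / 4) (matA N a) q.1 q.2) := by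
    rw [chiZero, Fintype.sum_prod_type]
    refine Finset.sum_congr rfl fun i _ => Finset.sum_congr rfl fun j _ => ?_
    rw [pairExp, X, X, monomial_mul, C_mul_monomial, one_mul, mul_one]
  rw [h, coeff_sum, Finset.sum_eq_single p]
  · rw [coeff_monomial, if_pos rfl]
  · intro q _ hq
    rw [coeff_monomial, if_neg (pairExp_injective.ne hq)]
  · simp

/-- The monomials x_i y_j are distinct, so the sum of all |B_{ij}| is at most the coefficient norm.
Cyclic symmetry of the polynomial makes the matrix circulant, so each row carries a fraction 1/N of
that sum. -/
theorem sum_abs_log_le {b : ℝ} (hc : IsCyclic (chiZero N a))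
    (hb : coeffNorm (chiZero N a) ≤ N * b) (i : ZMod N) :
    ∑ j, |cfc (fun t : ℝ => Real.log t / 4) (matA N a) i j| ≤ b := by
  set B := cfc (fun t : ℝ => Real.log t / 4) (matA N a) with hB
  have hsh : ∀ i j, B (i + 1) (j + 1) = B i j := by
    intro i j
    have h1 := coeff_rename_mapDomain (siteShift (1 : ZMod N)) (siteShift_injective 1)
      (chiZero N a) (pairExp (i, j))
    have h2 : Finsupp.mapDomain (siteShift (1 : ZMod N)) (pairExp (i, j)) =
        pairExp (i + 1, j + 1) := by
      simp [pairExp, Finsupp.mapDomain_add, Finsupp.mapDomain_single, siteShift]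
    have h3 : rename (siteShift (1 : ZMod N)) (chiZero N a) = chiZero N a := hc
    rw [h2, h3, coeff_pairExp_chiZero, coeff_pairExp_chiZero] at h1
    exact h1
  have hrow : ∀ i, ∑ j, |B i j| = ∑ j, |B 0 j| := by
    refine apply_eq_of_add_one fun i => ?_
    rw [← Equiv.sum_comp (Equiv.addRight (1 : ZMod N)) fun j => |B (i + 1) j|]
    exact Finset.sum_congr rfl fun j _ => by rw [Equiv.coe_addRight, hsh]
  have htot : ∑ i, ∑ j, |B i j| ≤ N * b := by
    have h := (sum_norm_coeff_le pairExp_injective (chiZero N a)).trans hb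
    rw [Fintype.sum_prod_type] at h
    simpa only [coeff_pairExp_chiZero, Real.norm_eq_abs] using h
  simp only [hrow, Finset.sum_const, Finset.card_univ, ZMod.card, nsmul_eq_mul] at htot
  rw [hrow i]
  exact le_of_mul_le_mul_left htot card_pos_real

/-! ### The constants -/

theorem exp_neg_sigma0 (ha : 0 < a) : Real.exp (-sigma0 a) = 2 * mu a := by
  have : 0 < 2 * mu a := by unfold mu; positivity
  rw [sigma0, neg_neg, Real.exp_log this]

theorem two_mul_mu_lt_one (ha : 0 < a) : 2 * mu a < 1 := by
  rw [mu, ← mul_div_assoc, div_lt_one (by positivity)]; linarith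

theorem sigma0_pos (ha : 0 < a) : 0 < sigma0 a := by
  have h := exp_neg_sigma0 ha
  have h2 := two_mul_mu_lt_one ha
  rw [← h, Real.exp_lt_one_iff] at h2
  linarith

theorem isAdmissible {C0 κ : ℝ} {r : ℕ} (ha : 0 < a) (hmu : mu a < 1 / 20000) (hC0 : 0 < C0)
    (hζ : ∃ ζ : ℕ → Poly N, HasSeed (Zzero N a) ζ ∧ ClassD ζ C0 (sigma0 a) ∧ ζ 0 = 0)
    (cq : IsCyclic (toNormal a (quartPart N))) (hκ : siteNorm (toNormal a (quartPart N)) ≤ κ)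
    (hr : 1 ≤ r) (hrm : 2 * r * mu a < muStar N a C0) : IsAdmissible N a κ r := by
  obtain ⟨ζ, hs, hd, h0⟩ := hζ
  have hmu0 : 0 < mu a := by unfold mu; positivity
  have hr0 : (1 : ℝ) ≤ r := by exact_mod_cast hr
  have hx1 : 2 * mu a < 1 := two_mul_mu_lt_one ha
  set y := Real.exp (-(sigma0 a - sigmaStar a)) with hy
  have hσ := sigma0_pos ha
  have hy1 : y < 1 := Real.exp_lt_one_iff.2 (by unfold sigmaStar; linarith)
  have hy0 : 0 < y := Real.exp_pos _
  have hE : 0 < Real.exp (sigma1 a) := Real.exp_pos _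
  have hE2 : Real.exp (sigma1 a) ^ 2 * (2 * mu a) = 1 := by
    rw [← exp_neg_sigma0 ha, ← Real.exp_nat_mul, ← Real.exp_add, sigma1, ← Real.exp_zero]
    congr 1; push_cast; ring
  -- Here e^{σ_1} = (2μ)^{-1/2}, and μ < 1/20000.
  have hE3 : 100 ≤ Real.exp (sigma1 a) := by
    by_contra hlt
    push Not at hlt
    nlinarith
  rw [muStar, exp_neg_sigma0 ha, ← hy, lt_div_iff₀ (by positivity)] at hrm
  -- The condition 2rμ < μ_* already forces Ω > 0, since its left side is positive.
  have hom : 0 < Om N a := by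
    have h1 : 0 < Om N a * (1 - 2 * mu a) * (1 - y) := lt_trans (by positivity) hrm
    exact pos_of_mul_pos_left (pos_of_mul_pos_left h1 (by linarith)) (by linarith)
  refine ⟨hr, hom, isHomogeneous_toNormal_quadPart ha, isHomogeneous_toNormal_quartPart, ?_, cq,
    poisson_HOm_toNormal_quadPart ha, hκ, ?_⟩
  · have h := hs.isCyclic.add (isCyclic_HOm a)
    rwa [Zzero, sub_add_cancel] at h
  · have h1 : siteNorm (Zzero N a) ≤ C0 * (2 * mu a) / (1 - 2 * mu a) := by
      refine (siteNorm_le_div _).trans ?_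
      rw [div_le_iff₀ card_pos_real, mul_comm, ← exp_neg_sigma0 ha]
      exact hs.coeffNorm_le.trans (mul_le_mul_of_nonneg_left
        (sum_coeffNorm_le_of_zero hd hC0.le hσ h0) (Nat.cast_nonneg N))
    -- The same condition reads 16rμC_0 e^{σ_1} < Ω(1 - 2μ)(1 - y); with e^{σ_1} ≥ 100 it gives
    -- 2Ω/100 = Ω/50.
    have h2 : 16 * r * (C0 * (2 * mu a) / (1 - 2 * mu a)) ≤ Om N a / 50 := by
      rw [← mul_div_assoc, div_le_iff₀ (by linarith)]
      have h3 : Om N a * (1 - 2 * mu a) * (1 - y) ≤ Om N a * (1 - 2 * mu a) :=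
        mul_le_of_le_one_right (mul_nonneg hom.le (by linarith)) (by linarith)
      have h4 : 0 ≤ r * (C0 * (2 * mu a)) := by positivity
      nlinarith [mul_le_mul_of_nonneg_left hE3 h4]
    exact (mul_le_mul_of_nonneg_left h1 (by positivity)).trans h2

end NormalCoordinates

end KleinGordon
end

noncomputable section

namespace KleinGordon

open MvPolynomial

set_option linter.unusedSectionVars false

open MeasureTheory

/-! ### Integration by parts and moments in the Gibbs measure. -/

section Gibbs

variable {N : ℕ} [NeZero N] {a β : ℝ}

/-! ### Integrability -/

/-- Gaussian domination: every polynomial becomes integrable against a product of one-dimensional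
Gaussians. -/
theorem half_sum_sq_le_hamiltonian (ha : 0 < a) (z : ZMod N ⊕ ZMod N → ℝ) :
    1 / 2 * ∑ v, z v ^ 2 ≤ hamiltonian N a z := by
  simp only [hamiltonian, quadPart, quartPart, map_add, map_mul, map_sum, eval_C, map_pow, eval_X,
    map_sub, Fintype.sum_sum_type, ← Finset.sum_add_distrib]
  have h1 : 0 ≤ 1 / 4 * ∑ j : ZMod N, z (Sum.inl j) ^ 4 := by positivity
  have h2 : ∑ j : ZMod N, (z (Sum.inl j) ^ 2 + z (Sum.inr j) ^ 2) ≤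
      ∑ j : ZMod N, (z (Sum.inr j) ^ 2 + z (Sum.inl j) ^ 2 +
        a * (z (Sum.inl j) - z (Sum.inl (j - 1))) ^ 2) := by
    refine Finset.sum_le_sum fun j _ => ?_
    have : 0 ≤ a * (z (Sum.inl j) - z (Sum.inl (j - 1))) ^ 2 := by positivity
    linarith
  linarith

theorem integrable_abs_pow_mul_exp {b : ℝ} (hb : 0 < b) (n : ℕ) :
    Integrable fun x : ℝ => |x| ^ n * Real.exp (-b * x ^ 2) := by
  have h := (integrable_rpow_mul_exp_neg_mul_sq hb (s := (n : ℝ))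
    (by linarith [Nat.cast_nonneg (α := ℝ) n])).abs
  refine h.congr (Filter.Eventually.of_forall fun x => ?_)
  simp only [Real.rpow_natCast, abs_mul, abs_pow, Real.abs_exp]

theorem integrable_eval_mul_exp (ha : 0 < a) (hβ : 0 < β) (f : Poly N) :
    Integrable fun z : ZMod N ⊕ ZMod N → ℝ =>
      eval z f * Real.exp (-β * hamiltonian N a z) := by
  have hcont : ∀ g : Poly N, Continuous fun z : ZMod N ⊕ ZMod N → ℝ =>
      eval z g * Real.exp (-β * hamiltonian N a z) := fun g =>
    (continuous_eval g).mul (Real.continuous_exp.comp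
      (continuous_const.mul (continuous_eval (quadPart N a + quartPart N))))
  induction f using MvPolynomial.induction_on' with
  | monomial k c =>
    have hdom : Integrable fun z : ZMod N ⊕ ZMod N → ℝ =>
        |c| * ∏ v, (|z v| ^ k v * Real.exp (-(β / 2) * z v ^ 2)) :=
      (Integrable.fintype_prod (f := fun v x => |x| ^ k v * Real.exp (-(β / 2) * x ^ 2))
        fun v => integrable_abs_pow_mul_exp (by positivity) (k v)).const_mul _
    refine hdom.mono' (hcont _).aestronglyMeasurable (Filter.Eventually.of_forall fun z => ?_)
    rw [eval_monomial, Finsupp.prod_fintype _ _ (by simp), Finset.prod_mul_distrib,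
      Real.norm_eq_abs, abs_mul, abs_mul, Finset.abs_prod, Real.abs_exp, ← mul_assoc]
    simp only [abs_pow]
    refine mul_le_mul_of_nonneg_left ?_ (by positivity)
    rw [← Real.exp_sum, Real.exp_le_exp, ← Finset.mul_sum]
    have := half_sum_sq_le_hamiltonian ha z
    nlinarith
  | add f g hf hg =>
    refine (hf.add hg).congr (Filter.Eventually.of_forall fun z => ?_)
    simp [add_mul]

theorem integrable_exp_hamiltonian (ha : 0 < a) (hβ : 0 < β) :
    Integrable fun z : ZMod N ⊕ ZMod N → ℝ => Real.exp (-β * hamiltonian N a z) := by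
  simpa using integrable_eval_mul_exp (N := N) ha hβ 1

theorem isProbabilityMeasure_gibbs (ha : 0 < a) (hβ : 0 < β) :
    IsProbabilityMeasure (gibbs N β a) :=
  isProbabilityMeasure_tilted (integrable_exp_hamiltonian ha hβ)

theorem integrable_eval_gibbs (ha : 0 < a) (hβ : 0 < β) (f : Poly N) :
    Integrable (fun z => eval z f) (gibbs N β a) := by
  rw [gibbs, integrable_tilted_iff (integrable_exp_hamiltonian ha hβ)]
  refine (integrable_eval_mul_exp ha hβ f).congr (Filter.Eventually.of_forall fun z => ?_)
  simp [mul_comm]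

/-! ### Expectations of polynomials -/

/-- The expectation of a polynomial observable in the Gibbs measure. -/
def gibbsExp (β a : ℝ) (f : Poly N) : ℝ := ∫ z, eval z f ∂gibbs N β a

theorem gibbsExp_one (ha : 0 < a) (hβ : 0 < β) : gibbsExp β a (1 : Poly N) = 1 := by
  have := isProbabilityMeasure_gibbs (N := N) ha hβ
  simp [gibbsExp]

theorem gibbsExp_zero : gibbsExp β a (0 : Poly N) = 0 := by simp [gibbsExp]

theorem gibbsExp_add (ha : 0 < a) (hβ : 0 < β) (f g : Poly N) :
    gibbsExp β a (f + g) = gibbsExp β a f + gibbsExp β a g := by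
  simp only [gibbsExp, map_add]
  exact integral_add (integrable_eval_gibbs ha hβ f) (integrable_eval_gibbs ha hβ g)

theorem gibbsExp_C_mul (c : ℝ) (f : Poly N) : gibbsExp β a (C c * f) = c * gibbsExp β a f := by
  simp only [gibbsExp, map_mul, eval_C]
  exact integral_const_mul _ _

theorem gibbsExp_sub (ha : 0 < a) (hβ : 0 < β) (f g : Poly N) :
    gibbsExp β a (f - g) = gibbsExp β a f - gibbsExp β a g := by
  simp only [gibbsExp, map_sub]
  exact integral_sub (integrable_eval_gibbs ha hβ f) (integrable_eval_gibbs ha hβ g)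

theorem gibbsExp_sum (ha : 0 < a) (hβ : 0 < β) {ι : Type*} (s : Finset ι) (f : ι → Poly N) :
    gibbsExp β a (∑ i ∈ s, f i) = ∑ i ∈ s, gibbsExp β a (f i) := by
  simp only [gibbsExp, map_sum]
  exact integral_finsetSum _ fun i _ => integrable_eval_gibbs ha hβ (f i)

theorem gibbsExp_mono (ha : 0 < a) (hβ : 0 < β) {f g : Poly N}
    (h : ∀ z, eval z f ≤ eval z g) : gibbsExp β a f ≤ gibbsExp β a g :=
  integral_mono (integrable_eval_gibbs ha hβ f) (integrable_eval_gibbs ha hβ g) h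

theorem abs_gibbsExp_le (ha : 0 < a) (hβ : 0 < β) {f g : Poly N}
    (h : ∀ z, |eval z f| ≤ eval z g) : |gibbsExp β a f| ≤ gibbsExp β a g := by
  rw [gibbsExp, gibbsExp, ← Real.norm_eq_abs]
  exact norm_integral_le_of_norm_le (integrable_eval_gibbs ha hβ g) (Filter.Eventually.of_forall h)

theorem gibbsExp_eq (f : Poly N) : gibbsExp β a f =
    (∫ z : ZMod N ⊕ ZMod N → ℝ, eval z f * Real.exp (-β * hamiltonian N a z)) /
      ∫ z : ZMod N ⊕ ZMod N → ℝ, Real.exp (-β * hamiltonian N a z) := by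
  rw [gibbsExp, gibbs, integral_tilted, ← integral_div]
  refine integral_congr_ae (Filter.Eventually.of_forall fun z => ?_)
  simp only [smul_eq_mul]
  ring

theorem hasLineDerivAt_eval {σ : Type*} [DecidableEq σ] (v : σ) (f : MvPolynomial σ ℝ)
    (z : σ → ℝ) :
    HasLineDerivAt ℝ (fun z => eval z f) (eval z (pderiv v f)) z (Pi.single v 1) := by
  induction f using MvPolynomial.induction_on with
  | C c => simpa [HasLineDerivAt] using hasDerivAt_const (0 : ℝ) c
  | add f g hf hg =>
    simp only [HasLineDerivAt, map_add] at *
    exact hf.add hg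
  | mul_X f u hf =>
    simp only [HasLineDerivAt, map_mul, eval_X, pderiv_mul, map_add] at *
    have hX : HasDerivAt (fun t : ℝ => (z + t • Pi.single v (1 : ℝ) : σ → ℝ) u)
        (eval z (pderiv v (X u))) 0 := by
      have h1 : eval z (pderiv v (X u : MvPolynomial σ ℝ)) = (Pi.single v (1 : ℝ) : σ → ℝ) u := by
        rw [pderiv_X]
        by_cases h : v = u
        · subst h; simp
        · simp [Ne.symm h]
      rw [h1]
      simp only [Pi.add_apply, Pi.smul_apply, smul_eq_mul]
      simpa using ((hasDerivAt_id (0 : ℝ)).mul_const ((Pi.single v (1 : ℝ) : σ → ℝ) u)).const_add (z u)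
    have h := hf.fun_mul hX
    simp only [zero_smul, add_zero] at h
    exact h

theorem gibbsExp_pderiv (ha : 0 < a) (hβ : 0 < β) (v : ZMod N ⊕ ZMod N) (f : Poly N) :
    gibbsExp β a (pderiv v f) =
      β * gibbsExp β a (f * pderiv v (quadPart N a + quartPart N)) := by
  classical
  set H := quadPart N a + quartPart N with hH
  have hw : ∀ z, HasLineDerivAt ℝ (fun z => Real.exp (-β * hamiltonian N a z))
      (-β * eval z (pderiv v H) * Real.exp (-β * hamiltonian N a z)) z (Pi.single v 1) := by
    intro z
    have h1 := hasLineDerivAt_eval v H z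
    simp only [HasLineDerivAt] at h1 ⊢
    have h2 := (h1.const_mul (-β)).exp
    simp only [zero_smul, add_zero] at h2
    rw [mul_comm]
    exact h2
  have h := integral_bilinear_hasLineDerivAt_right_eq_neg_left_of_integrable
    (μ := (volume : Measure (ZMod N ⊕ ZMod N → ℝ)))
    (B := ContinuousLinearMap.mul ℝ ℝ) (f := fun z => eval z f)
    (f' := fun z => eval z (pderiv v f))
    (g := fun z => Real.exp (-β * hamiltonian N a z))
    (g' := fun z => -β * eval z (pderiv v H) * Real.exp (-β * hamiltonian N a z))
    (v := Pi.single v 1) ?_ ?_ ?_ (fun z _ => hasLineDerivAt_eval v f z) (fun z _ => hw z)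
  · simp only [ContinuousLinearMap.mul_apply'] at h
    rw [gibbsExp_eq, gibbsExp_eq, ← mul_div_assoc]
    congr 1
    rw [← neg_eq_iff_eq_neg] at h
    rw [← h, ← integral_neg, ← integral_const_mul]
    refine integral_congr_ae (Filter.Eventually.of_forall fun z => ?_)
    simp only [map_mul]
    ring
  · simpa using integrable_eval_mul_exp ha hβ (pderiv v f)
  · refine (integrable_eval_mul_exp ha hβ (C (-β) * f * pderiv v H)).congr
      (Filter.Eventually.of_forall fun z => ?_)
    simp only [map_mul, eval_C, ContinuousLinearMap.mul_apply']
    ring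
  · simpa using integrable_eval_mul_exp ha hβ f

theorem pderiv_inr_ham (ha : 0 < a) (j : ZMod N) :
    pderiv (Sum.inr j) (quadPart N a + quartPart N) = X (Sum.inr j) := by
  classical
  have h1 : pderiv (Sum.inr j) (quartPart N) = 0 := by
    simp [quartPart, pderiv_X_of_ne Sum.inl_ne_inr]
  have h2 : pderiv (Sum.inr j) (∑ i : ZMod N, X (Sum.inr i) ^ 2 : Poly N) =
      2 * X (Sum.inr j) := by
    rw [map_sum, Finset.sum_eq_single j]
    · simp
    · intro i _ hi; simp [pderiv_X_of_ne (Sum.inr_injective.ne hi)]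
    · simp
  rw [map_add, h1, add_zero, quadPart_eq ha, pderiv_C_mul, map_add,
    pderiv_quadForm_of_forall_ne (e := Sum.inl) (fun _ => Sum.inl_ne_inr), h2, add_zero,
    ← mul_assoc, ← map_ofNat (C : ℝ →+* Poly N) 2, ← C_mul]
  norm_num

theorem pderiv_inl_ham (ha : 0 < a) (j : ZMod N) :
    pderiv (Sum.inl j) (quadPart N a + quartPart N) = C (1 + 2 * a) * X (Sum.inl j) -
      C a * (X (Sum.inl (j - 1)) + X (Sum.inl (j + 1))) + X (Sum.inl j) ^ 3 := by
  classical
  have h1 : pderiv (Sum.inl j) (quartPart N) = X (Sum.inl j) ^ 3 := by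
    rw [quartPart, pderiv_C_mul, map_sum, Finset.sum_eq_single j]
    · rw [pderiv_pow, pderiv_X_self, mul_one, ← mul_assoc, Nat.cast_ofNat,
        ← map_ofNat (C : ℝ →+* Poly N) 4, ← C_mul]
      norm_num
    · intro i _ hi; simp [pderiv_X_of_ne (Sum.inl_injective.ne hi)]
    · simp
  have h2 : pderiv (Sum.inl j) (∑ i : ZMod N, X (Sum.inr i) ^ 2 : Poly N) = 0 := by
    simp [pderiv_X_of_ne Sum.inr_ne_inl]
  have hS : ∀ i k, matA N a i k = matA N a k i := fun i k => by
    have := congrFun (congrFun (matA_isHermitian N a) k) i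
    rw [Matrix.conjTranspose_eq_transpose_of_trivial, Matrix.transpose_apply] at this
    exact this
  have h3 := map_matA_mulVec ha (varVec (N := N) Sum.inl) j
  rw [map_add, h1, quadPart_eq ha, pderiv_C_mul, map_add, pderiv_quadForm Sum.inl_injective hS, h2,
    zero_add, ← mul_assoc, ← map_ofNat (C : ℝ →+* Poly N) 2, ← C_mul]
  congr 1
  refine Eq.trans ?_ h3
  norm_num
  rfl

/-! ### Moments -/

theorem pow_mul_le {x y : ℝ} (hx : 0 ≤ x) (hy : 0 ≤ y) (n : ℕ) :
    ((n : ℝ) + 1) * (x ^ n * y) ≤ n * x ^ (n + 1) + y ^ (n + 1) := by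
  rcases hx.eq_or_lt with rfl | hx
  · rcases n with _ | n
    · simp
    · simp only [pow_succ, mul_zero, zero_mul, zero_add]; positivity
  have h := one_add_mul_le_pow (a := y / x - 1) (by have := div_nonneg hy hx.le; linarith) (n + 1)
  rw [add_sub_cancel, div_pow, le_div_iff₀ (by positivity)] at h
  have e : (1 + ((n + 1 : ℕ) : ℝ) * (y / x - 1)) * x ^ (n + 1) =
      ((n : ℝ) + 1) * (x ^ n * y) - n * x ^ (n + 1) := by
    push_cast; field_simp; ring
  linarith

theorem pow_mul_le_of_even (x y : ℝ) (k : ℕ) : x ^ (2 * k + 1) * y ≤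
    ((2 * k + 1 : ℕ) / (2 * k + 2 : ℝ)) * x ^ (2 * k + 2) + 1 / (2 * k + 2) * y ^ (2 * k + 2) := by
  have h := pow_mul_le (abs_nonneg x) (abs_nonneg y) (2 * k + 1)
  have h1 : x ^ (2 * k + 1) * y ≤ |x| ^ (2 * k + 1) * |y| := by
    rw [← abs_pow, ← abs_mul]; exact le_abs_self _
  have he : Even (2 * k + 1 + 1) := ⟨k + 1, by ring⟩
  rw [he.pow_abs, he.pow_abs] at h
  have h2 : (0 : ℝ) < 2 * k + 2 := by positivity
  rw [div_mul_eq_mul_div, div_mul_eq_mul_div, ← add_div, le_div_iff₀ h2]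
  push_cast at h ⊢
  nlinarith

/-- The bound `(2k - 1)!! β^{-k}` of the moments of order `2k`. -/
def momentBound (β : ℝ) (k : ℕ) : ℝ := ∏ i ∈ Finset.range k, ((2 * i + 1 : ℝ) / β)

theorem momentBound_nonneg (hβ : 0 < β) (k : ℕ) : 0 ≤ momentBound β k :=
  Finset.prod_nonneg fun i _ => by positivity

/-- Induction through integration by parts of x^{2k+1}. For a position, the moment is taken at a
site where it is largest: the quartic force has a favourable sign and is dropped, Young's inequality
splits the coupling, and the neighbouring moments are at most that of the site. The coefficients
containing a then cancel and leave 1, as for a standard Gaussian. -/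
theorem gibbsExp_pow_le (ha : 0 < a) (hβ : 0 < β) (k : ℕ) (v : ZMod N ⊕ ZMod N) :
    gibbsExp β a (X v ^ (2 * k) : Poly N) ≤ momentBound β k := by
  induction k generalizing v with
  | zero => simp [momentBound, gibbsExp_one ha hβ]
  | succ k ih =>
    rw [momentBound, Finset.prod_range_succ, ← momentBound, mul_div_assoc', le_div_iff₀ hβ]
    have hd : ∀ v : ZMod N ⊕ ZMod N, β * gibbsExp β a
        (X v ^ (2 * k + 1) * pderiv v (quadPart N a + quartPart N)) ≤
        momentBound β k * (2 * k + 1) := by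
      intro v
      rw [← gibbsExp_pderiv ha hβ, pderiv_pow, pderiv_X_self, mul_one, Nat.add_sub_cancel,
        ← C_eq_coe_nat, gibbsExp_C_mul, mul_comm]
      push_cast
      exact mul_le_mul_of_nonneg_right (ih v) (by positivity)
    rcases v with j | j
    · obtain ⟨i, hi⟩ := Finite.exists_max fun j : ZMod N =>
        gibbsExp β a (X (Sum.inl j) ^ (2 * (k + 1)) : Poly N)
      refine (mul_le_mul_of_nonneg_right (hi j) hβ.le).trans (le_trans ?_ (hd (Sum.inl i)))
      rw [mul_comm]
      refine mul_le_mul_of_nonneg_left ?_ hβ.le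
      set c : ℝ := ((2 * k + 1 : ℕ) : ℝ) / (2 * k + 2 : ℝ) with hc
      set d : ℝ := 1 / (2 * k + 2 : ℝ) with hdd
      have hcd : c + d = 1 := by
        rw [hc, hdd]; push_cast; field_simp; ring
      have hd0 : 0 ≤ d := by rw [hdd]; positivity
      have hlow : gibbsExp β a (C (1 + 2 * a - 2 * (a * c)) * X (Sum.inl i) ^ (2 * (k + 1)) -
          C (a * d) * X (Sum.inl (i - 1)) ^ (2 * (k + 1)) -
          C (a * d) * X (Sum.inl (i + 1)) ^ (2 * (k + 1)) : Poly N) ≤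
          gibbsExp β a (X (Sum.inl i) ^ (2 * k + 1) *
            pderiv (Sum.inl i) (quadPart N a + quartPart N)) := by
        refine gibbsExp_mono ha hβ fun z => ?_
        rw [pderiv_inl_ham ha]
        simp only [map_sub, map_mul, map_add, map_pow, eval_C, eval_X]
        have h1 := mul_le_mul_of_nonneg_left
          (pow_mul_le_of_even (z (Sum.inl i)) (z (Sum.inl (i - 1))) k) ha.le
        have h2 := mul_le_mul_of_nonneg_left
          (pow_mul_le_of_even (z (Sum.inl i)) (z (Sum.inl (i + 1))) k) ha.le
        have h3 : 0 ≤ z (Sum.inl i) ^ (2 * k + 1) * z (Sum.inl i) ^ 3 := by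
          rw [← pow_add]; exact Even.pow_nonneg ⟨k + 2, by ring⟩ _
        rw [← hc, ← hdd] at h1 h2
        rw [show 2 * (k + 1) = 2 * k + 2 by ring]
        have e : z (Sum.inl i) ^ (2 * k + 1) * z (Sum.inl i) = z (Sum.inl i) ^ (2 * k + 2) := by
          ring
        have e2 : z (Sum.inl i) ^ (2 * k + 1) * ((1 + 2 * a) * z (Sum.inl i) -
            a * (z (Sum.inl (i - 1)) + z (Sum.inl (i + 1))) + z (Sum.inl i) ^ 3) =
            (1 + 2 * a) * (z (Sum.inl i) ^ (2 * k + 1) * z (Sum.inl i)) -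
            a * (z (Sum.inl i) ^ (2 * k + 1) * z (Sum.inl (i - 1))) -
            a * (z (Sum.inl i) ^ (2 * k + 1) * z (Sum.inl (i + 1))) +
            z (Sum.inl i) ^ (2 * k + 1) * z (Sum.inl i) ^ 3 := by ring
        rw [e2, e]
        linarith
      refine le_trans ?_ hlow
      rw [gibbsExp_sub ha hβ, gibbsExp_sub ha hβ, gibbsExp_C_mul, gibbsExp_C_mul, gibbsExp_C_mul]
      have had : 0 ≤ a * d := mul_nonneg ha.le hd0
      have h1 := mul_le_mul_of_nonneg_left (hi (i - 1)) had
      have h2 := mul_le_mul_of_nonneg_left (hi (i + 1)) had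
      -- With c + d = 1 the total coefficient is 1 + 2a - 2ac - 2ad = 1.
      have hcc : c = 1 - d := by linarith
      rw [hcc]
      linarith
    · have h := hd (Sum.inr j)
      rw [pderiv_inr_ham ha, ← pow_succ, mul_comm] at h
      exact h

end Gibbs

end KleinGordon
end

noncomputable section

namespace KleinGordon

open MvPolynomial

set_option linter.unusedSectionVars false

open MeasureTheory

/-! ### Expectations of polynomials of linear forms. -/

section Moments

variable {N : ℕ} [NeZero N] {a β : ℝ}

/-! ### Moments of linear forms and of homogeneous polynomials in them -/

theorem sum_mul_pow_le {ι : Type*} (s : Finset ι) (c x : ι → ℝ) {R : ℝ}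
    (hR : ∑ i ∈ s, |c i| ≤ R) {n : ℕ} (hn : Even n) (h0 : n ≠ 0) :
    (∑ i ∈ s, c i * x i) ^ n ≤ R ^ (n - 1) * ∑ i ∈ s, |c i| * x i ^ n := by
  set S := ∑ i ∈ s, |c i| with hS
  have hS0 : 0 ≤ S := Finset.sum_nonneg fun i _ => abs_nonneg _
  have hsum : 0 ≤ ∑ i ∈ s, |c i| * x i ^ n :=
    Finset.sum_nonneg fun i _ => mul_nonneg (abs_nonneg _) (hn.pow_nonneg _)
  rcases hS0.eq_or_lt with h | h
  · have hc : ∀ i ∈ s, c i = 0 := fun i hi => abs_eq_zero.1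
      ((Finset.sum_eq_zero_iff_of_nonneg fun i _ => abs_nonneg (c i)).1 h.symm i hi)
    rw [Finset.sum_eq_zero fun i hi => by rw [hc i hi, zero_mul], zero_pow h0]
    exact mul_nonneg (pow_nonneg (h.le.trans hR) _) hsum
  · have hj := Real.pow_arith_mean_le_arith_mean_pow_of_even s (fun i => |c i| / S)
      -- Jensen's inequality with weights |c_i|/S; the signs of the c_i are moved to the points,
      -- where the even power removes them.
      (fun i => SignType.sign (c i) * x i) (fun i _ => by positivity)
      (by rw [← Finset.sum_div, ← hS, div_self h.ne']) hn
    have e1 : ∑ i ∈ s, |c i| / S * (SignType.sign (c i) * x i) = (∑ i ∈ s, c i * x i) / S := by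
      rw [Finset.sum_div]
      refine Finset.sum_congr rfl fun i _ => ?_
      nth_rewrite 3 [← abs_mul_sign (c i)]
      ring
    have e2 : ∑ i ∈ s, |c i| / S * (SignType.sign (c i) * x i) ^ n ≤
        (∑ i ∈ s, |c i| * x i ^ n) / S := by
      rw [Finset.sum_div]
      refine Finset.sum_le_sum fun i _ => ?_
      rcases lt_trichotomy (c i) 0 with hc | hc | hc
      · rw [sign_neg hc]; simp [hn.neg_pow]; exact (by ring : _ = _).le
      · simp [hc]
      · rw [sign_pos hc]; simp; exact (by ring : _ = _).le
    rw [e1, div_pow, div_le_iff₀ (by positivity)] at hj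
    refine hj.trans ((mul_le_mul_of_nonneg_right e2 (by positivity)).trans ?_)
    obtain ⟨m, rfl⟩ := Nat.exists_eq_succ_of_ne_zero h0
    rw [Nat.succ_sub_one, pow_succ, mul_comm (S ^ m), ← mul_assoc, div_mul_cancel₀ _ h.ne',
      mul_comm]
    exact mul_le_mul_of_nonneg_right (pow_le_pow_left₀ h.le hR m) hsum

theorem gibbsExp_linear_pow_le (ha : 0 < a) (hβ : 0 < β) {ι : Type*} [Fintype ι]
    (c : ι → ℝ) (e : ι → ZMod N ⊕ ZMod N) {R : ℝ} (hR : ∑ j, |c j| ≤ R) {k : ℕ} (hk : 1 ≤ k) :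
    gibbsExp β a ((∑ j, C (c j) * X (e j)) ^ (2 * k) : Poly N) ≤ R ^ (2 * k) * momentBound β k := by
  have hR0 : 0 ≤ R := (Finset.sum_nonneg fun j _ => abs_nonneg (c j)).trans hR
  have h : gibbsExp β a ((∑ j, C (c j) * X (e j)) ^ (2 * k) : Poly N) ≤
      gibbsExp β a (C (R ^ (2 * k - 1)) * ∑ j, C |c j| * X (e j) ^ (2 * k)) := by
    refine gibbsExp_mono ha hβ fun z => ?_
    simp only [map_pow, map_sum, map_mul, eval_C, eval_X]
    exact sum_mul_pow_le _ _ _ hR ⟨k, by ring⟩ (by omega)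
  refine h.trans ?_
  rw [gibbsExp_C_mul, gibbsExp_sum ha hβ]
  simp only [gibbsExp_C_mul]
  have h2 : ∑ j, |c j| * gibbsExp β a (X (e j) ^ (2 * k) : Poly N) ≤ R * momentBound β k := by
    refine le_trans (Finset.sum_le_sum fun j _ =>
      mul_le_mul_of_nonneg_left (gibbsExp_pow_le ha hβ k (e j)) (abs_nonneg _)) ?_
    rw [← Finset.sum_mul]
    exact mul_le_mul_of_nonneg_right hR (momentBound_nonneg hβ k)
  refine (mul_le_mul_of_nonneg_left h2 (pow_nonneg hR0 _)).trans_eq ?_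
  rw [← mul_assoc, ← pow_succ, Nat.sub_add_cancel (by omega)]

/-- The complex coordinates `q + i p`, `q - i p`. -/
def complexPoint (u : ZMod N ⊕ ZMod N → ℝ) : ZMod N ⊕ ZMod N → ℂ :=
  Sum.elim (fun j => u (Sum.inl j) + Complex.I * u (Sum.inr j))
    (fun j => u (Sum.inl j) - Complex.I * u (Sum.inr j))

theorem ofReal_eval (u : ZMod N ⊕ ZMod N → ℝ) (f : Poly N) :
    ((eval u f : ℝ) : ℂ) = eval (complexPoint u) (cplx f) := by
  induction f using MvPolynomial.induction_on with
  | C c => rw [cplx_C, eval_C, eval_C]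
  | add f g hf hg => simp only [map_add, Complex.ofReal_add, hf, hg]
  | mul_X f v hf =>
    rw [map_mul, map_mul, map_mul, Complex.ofReal_mul, hf, eval_X]
    congr 1
    rcases v with j | j
    · rw [cplx_X_inl]
      simp [complexPoint]
      ring
    · rw [cplx_X_inr]
      simp [complexPoint]
      linear_combination (u (Sum.inr j) : ℂ) * Complex.I_sq

theorem norm_complexPoint_sq (u : ZMod N ⊕ ZMod N → ℝ) (v : ZMod N ⊕ ZMod N) :
    ‖complexPoint u v‖ ^ 2 = u (Sum.inl (site v)) ^ 2 + u (Sum.inr (site v)) ^ 2 := by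
  rw [← Complex.normSq_eq_norm_sq, Complex.normSq_apply]
  rcases v with j | j <;> simp [complexPoint, site] <;> ring

theorem norm_complexPoint_pow_le (u : ZMod N ⊕ ZMod N → ℝ) (v : ZMod N ⊕ ZMod N) (k : ℕ) :
    ‖complexPoint u v‖ ^ (2 * k) ≤
      2 ^ (k - 1) * (u (Sum.inl (site v)) ^ (2 * k) + u (Sum.inr (site v)) ^ (2 * k)) := by
  rw [pow_mul, norm_complexPoint_sq, pow_mul, pow_mul]
  exact add_pow_le (sq_nonneg _) (sq_nonneg _) k

theorem prod_pow_le_sum {ι : Type*} [Fintype ι] (t : ι → ℝ) (ht : ∀ i, 0 ≤ t i) (d : ι → ℕ)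
    {n : ℕ} (hn : n ≠ 0) (hd : ∑ i, d i = n) :
    ∏ i, t i ^ d i ≤ ∑ i, (d i / n : ℝ) * t i ^ n := by
  have hn' : (n : ℝ) ≠ 0 := Nat.cast_ne_zero.2 hn
  have h := Real.geom_mean_le_arith_mean_weighted Finset.univ (fun i => (d i / n : ℝ))
    (fun i => t i ^ n) (fun i _ => by positivity)
    (by rw [← Finset.sum_div, ← Nat.cast_sum, hd, div_self hn'])
    (fun i _ => pow_nonneg (ht i) _)
  refine le_trans (Finset.prod_le_prod (fun i _ => pow_nonneg (ht i) _) fun i _ => ?_) h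
  rw [← Real.rpow_natCast (t i) n, ← Real.rpow_mul (ht i), mul_div_cancel₀ _ hn',
    Real.rpow_natCast]

/-- A monomial of degree 2k in ξ, η is bounded by the weighted mean of the |ξ_v|^{2k}, and
|ξ_v|^{2k} = (q² + p²)^k ≤ 2^{k-1}(q^{2k} + p^{2k}). Only moments of single coordinates remain, so
their joint law does not matter. -/
theorem abs_gibbsExp_bind₁_le (ha : 0 < a) (hβ : 0 < β) (L : ZMod N ⊕ ZMod N → Poly N) {k : ℕ}
    (hk : 1 ≤ k) {M : ℝ} (hL : ∀ v, gibbsExp β a (L v ^ (2 * k)) ≤ M) {f : Poly N}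
    (hf : f.IsHomogeneous (2 * k)) :
    |gibbsExp β a (bind₁ L f)| ≤ coeffNorm (cplx f) * (2 ^ k * M) := by
  have hk0 : 2 * k ≠ 0 := by omega
  have hk' : ((2 * k : ℕ) : ℝ) ≠ 0 := Nat.cast_ne_zero.2 hk0
  have hdeg : ∀ d ∈ (cplx f).support, ∑ v, d v = 2 * k := fun d hd => by
    have := isHomogeneous_cplx hf (mem_support_iff.1 hd)
    rw [Finsupp.weight_apply, Finsupp.sum_fintype _ _ (by simp)] at this
    simpa using this
  have h : |gibbsExp β a (bind₁ L f)| ≤ gibbsExp β a (∑ d ∈ (cplx f).support,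
      C ‖coeff d (cplx f)‖ * ∑ v, C (d v / (2 * k : ℕ) : ℝ) *
        (C (2 ^ (k - 1)) * (L (Sum.inl (site v)) ^ (2 * k) + L (Sum.inr (site v)) ^ (2 * k)))) := by
    refine abs_gibbsExp_le ha hβ fun z => ?_
    have e : eval z (bind₁ L f) = eval (fun v => eval z (L v)) f := by
      rw [← coe_aeval_eq_eval, ← coe_aeval_eq_eval]
      exact aeval_bind₁ ..
    rw [e, ← Real.norm_eq_abs, ← Complex.norm_real, ofReal_eval, eval_eq']
    refine (norm_sum_le _ _).trans ?_
    rw [map_sum]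
    refine Finset.sum_le_sum fun d hd => ?_
    rw [norm_mul, norm_prod, map_mul, eval_C]
    refine mul_le_mul_of_nonneg_left ?_ (norm_nonneg _)
    simp only [norm_pow]
    refine (prod_pow_le_sum _ (fun v => norm_nonneg _) _ hk0 (hdeg d hd)).trans ?_
    rw [map_sum]
    refine Finset.sum_le_sum fun v _ => ?_
    simp only [map_mul, map_add, map_pow, eval_C]
    exact mul_le_mul_of_nonneg_left (norm_complexPoint_pow_le _ v k) (by positivity)
  refine h.trans ?_
  rw [gibbsExp_sum ha hβ, coeffNorm, Finset.sum_mul]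
  refine Finset.sum_le_sum fun d hd => ?_
  rw [gibbsExp_C_mul, gibbsExp_sum ha hβ]
  refine mul_le_mul_of_nonneg_left ?_ (norm_nonneg _)
  have h3 : ∀ v : ZMod N ⊕ ZMod N, gibbsExp β a (C (d v / (2 * k : ℕ) : ℝ) *
      (C (2 ^ (k - 1)) * (L (Sum.inl (site v)) ^ (2 * k) + L (Sum.inr (site v)) ^ (2 * k)))) ≤
      (d v / (2 * k : ℕ) : ℝ) * (2 ^ k * M) := by
    intro v
    rw [gibbsExp_C_mul, gibbsExp_C_mul, gibbsExp_add ha hβ]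
    refine mul_le_mul_of_nonneg_left ?_ (by positivity)
    have e : (2 : ℝ) ^ k = 2 ^ (k - 1) * 2 := by rw [← pow_succ, Nat.sub_add_cancel hk]
    rw [e, mul_assoc]
    refine mul_le_mul_of_nonneg_left ?_ (by positivity)
    linarith [hL (Sum.inl (site v)), hL (Sum.inr (site v))]
  refine (Finset.sum_le_sum fun v _ => h3 v).trans_eq ?_
  rw [← Finset.sum_mul, ← Finset.sum_div, ← Nat.cast_sum, hdeg d hd, div_self hk', one_mul]

/-! ### The momentum Euler operator -/

/-- The Euler operator `∑ p_j ∂/∂p_j` of the momenta. -/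
def eulerY (f : Poly N) : Poly N := ∑ j, X (Sum.inr j) * pderiv (Sum.inr j) f

theorem isHomogeneous_eulerY {f : Poly N} {n : ℕ} (hf : f.IsHomogeneous n) :
    (eulerY f).IsHomogeneous n := by
  rcases n with _ | n
  · have : f.totalDegree = 0 := Nat.le_zero.1 hf.totalDegree_le
    rw [totalDegree_eq_zero_iff_eq_C] at this
    rw [this]
    simp [eulerY, isHomogeneous_zero]
  · refine IsHomogeneous.sum _ _ _ fun j _ => ?_
    have := (isHomogeneous_X ℝ (Sum.inr j)).mul (hf.pderiv (i := Sum.inr j))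
    rwa [Nat.add_sub_cancel, add_comm] at this

theorem eulerY_add (f g : Poly N) : eulerY (f + g) = eulerY f + eulerY g := by
  simp only [eulerY, map_add, mul_add, Finset.sum_add_distrib]

theorem eulerY_sum {ι : Type*} (s : Finset ι) (f : ι → Poly N) :
    eulerY (∑ i ∈ s, f i) = ∑ i ∈ s, eulerY (f i) := by
  simp only [eulerY, map_sum, Finset.mul_sum]
  exact Finset.sum_comm

/-- In the complex variables p_j has norm at most one and ∂/∂p_j = i(∂_ξ - ∂_η), so the sum is
dominated by that of all derivatives. -/
theorem coeffNorm_cplx_eulerY_le {f : Poly N} {n : ℕ} (hf : f.IsHomogeneous n) :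
    coeffNorm (cplx (eulerY f)) ≤ n * coeffNorm (cplx f) := by
  have hI : ‖(-Complex.I / 2 : ℂ)‖ = 1 / 2 := by simp
  have h : ∀ j : ZMod N, coeffNorm (cplx (X (Sum.inr j) * pderiv (Sum.inr j) f)) ≤
      coeffNorm (pderiv (Sum.inl j) (cplx f)) + coeffNorm (pderiv (Sum.inr j) (cplx f)) := by
    intro j
    rw [map_mul, cplx_pderiv_inr]
    refine (coeffNorm_mul_le _ _).trans ?_
    have h1 : coeffNorm (cplx (X (Sum.inr j) : Poly N)) ≤ 1 := coeffNorm_cplx_X_le _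
    have h2 : coeffNorm (C Complex.I * (pderiv (Sum.inl j) (cplx f) -
        pderiv (Sum.inr j) (cplx f))) ≤
      coeffNorm (pderiv (Sum.inl j) (cplx f)) + coeffNorm (pderiv (Sum.inr j) (cplx f)) := by
      rw [coeffNorm_C_mul, Complex.norm_I, one_mul]
      exact coeffNorm_sub_le _ _
    exact (mul_le_mul h1 h2 (coeffNorm_nonneg _) zero_le_one).trans_eq (one_mul _)
  rw [eulerY, map_sum]
  refine (coeffNorm_sum_le _ _).trans ((Finset.sum_le_sum fun j _ => h j).trans ?_)
  rw [Finset.sum_add_distrib, ← Fintype.sum_sum_type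
    (fun v => coeffNorm (pderiv v (cplx f)))]
  exact sum_coeffNorm_pderiv_le (isHomogeneous_cplx hf)

end Moments

end KleinGordon
end

noncomputable section

namespace KleinGordon

open MvPolynomial

set_option linter.unusedSectionVars false

open MeasureTheory

/-! ### Covariance with the kinetic energy, and the leading term. -/

section Variance

variable {N : ℕ} [NeZero N] {a β : ℝ}

/-! ### A lower bound of the variance -/

theorem eulerY_C (c : ℝ) : eulerY (C c : Poly N) = 0 := by simp [eulerY]

theorem eulerY_mul (f g : Poly N) : eulerY (f * g) = f * eulerY g + eulerY f * g := by
  simp only [eulerY, pderiv_mul, Finset.mul_sum, Finset.sum_mul, ← Finset.sum_add_distrib]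
  exact Finset.sum_congr rfl fun j _ => by ring

theorem eulerY_X_inl (j : ZMod N) : eulerY (X (Sum.inl j) : Poly N) = 0 := by
  simp [eulerY, pderiv_X_of_ne Sum.inl_ne_inr]

theorem eulerY_X_inr (j : ZMod N) : eulerY (X (Sum.inr j) : Poly N) = X (Sum.inr j) := by
  rw [eulerY, Finset.sum_eq_single j]
  · rw [pderiv_X_self, mul_one]
  · intro i _ hi; rw [pderiv_X_of_ne (Sum.inr_injective.ne hi.symm), mul_zero]
  · simp

/-- Twice the kinetic energy. -/
def sumSqY (N : ℕ) [NeZero N] : Poly N := ∑ j : ZMod N, X (Sum.inr j) ^ 2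

theorem eulerY_sumSqY : eulerY (sumSqY N) = C 2 * sumSqY N := by
  rw [sumSqY, eulerY_sum, Finset.mul_sum]
  refine Finset.sum_congr rfl fun j _ => ?_
  rw [sq, eulerY_mul, eulerY_X_inr, map_ofNat]
  ring

/-- Integration by parts of f y_j in the variable y_j, where ∂H/∂y_j = y_j. -/
theorem gibbsExp_mul_sumSqY (ha : 0 < a) (hβ : 0 < β) (f : Poly N) :
    β * gibbsExp β a (f * sumSqY N) = gibbsExp β a (eulerY f) + N * gibbsExp β a f := by
  have h : ∀ j : ZMod N, β * gibbsExp β a (f * X (Sum.inr j) ^ 2) =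
      gibbsExp β a (X (Sum.inr j) * pderiv (Sum.inr j) f) + gibbsExp β a f := by
    intro j
    have := gibbsExp_pderiv ha hβ (Sum.inr j) (f * X (Sum.inr j))
    rw [pderiv_inr_ham ha, pderiv_mul, pderiv_X_self, mul_one, gibbsExp_add ha hβ, mul_assoc,
      ← sq] at this
    rw [← this, mul_comm (X _)]
  rw [sumSqY, Finset.mul_sum, gibbsExp_sum ha hβ, Finset.mul_sum, Finset.sum_congr rfl fun j _ => h j,
    Finset.sum_add_distrib, eulerY, gibbsExp_sum ha hβ]
  simp [ZMod.card]

/-- The Cauchy–Schwarz inequality for the covariance of an observable with the kinetic energy. -/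
theorem sq_gibbsExp_eulerY_le_variance (ha : 0 < a) (hβ : 0 < β) (f : Poly N) :
    gibbsExp β a (eulerY f) ^ 2 ≤
      2 * N * ProbabilityTheory.variance (fun z => eval z f) (gibbs N β a) := by
  have hN : (0 : ℝ) < N := card_pos_real
  set m := gibbsExp β a f with hm
  set e := gibbsExp β a (eulerY f) with he
  set n : ℝ := N / β with hn
  have hS : gibbsExp β a (sumSqY N) = n := by
    have := gibbsExp_mul_sumSqY ha hβ (1 : Poly N)
    rw [one_mul, ← C_1, eulerY_C, C_1, gibbsExp_one ha hβ, gibbsExp_zero] at this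
    rw [hn, eq_div_iff hβ.ne']; linarith
  have hSS : gibbsExp β a (sumSqY N * sumSqY N) = 2 * N / β ^ 2 + n ^ 2 := by
    have := gibbsExp_mul_sumSqY ha hβ (sumSqY N)
    rw [eulerY_sumSqY, gibbsExp_C_mul, hS] at this
    rw [← mul_right_inj' hβ.ne', this, hn]
    field_simp
  have hfS : gibbsExp β a (f * sumSqY N) = e / β + n * m := by
    have := gibbsExp_mul_sumSqY ha hβ f
    rw [← he, ← hm] at this
    rw [← mul_right_inj' hβ.ne', this, hn]
    field_simp
  have hV : ProbabilityTheory.variance (fun z => eval z f) (gibbs N β a) =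
      gibbsExp β a (f * f) - m ^ 2 := by
    rw [ProbabilityTheory.variance_eq_integral (continuous_eval f).measurable.aemeasurable]
    have h1 : ∀ z, (eval z f - ∫ z, eval z f ∂gibbs N β a) ^ 2 =
        eval z (f * f + C (-(2 * m)) * f + C (m ^ 2) * 1) := by
      intro z
      simp only [map_add, map_mul, eval_C, map_one]
      rw [hm, gibbsExp]
      ring
    simp only [h1]
    change gibbsExp β a (f * f + C (-(2 * m)) * f + C (m ^ 2) * 1) = _
    rw [gibbsExp_add ha hβ, gibbsExp_add ha hβ, gibbsExp_C_mul, gibbsExp_C_mul, gibbsExp_one ha hβ,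
      ← hm]
    ring
  -- The regression coefficient Cov(f, S)/Var S = (e/β)/(2N/β²), with the constant k centring the
  -- residual.
  set t : ℝ := e * β / (2 * N) with ht
  set k : ℝ := m - t * n with hk
  have hpos : 0 ≤ gibbsExp β a ((f - C k - C t * sumSqY N) ^ 2) := by
    rw [← gibbsExp_zero (N := N) (β := β) (a := a)]
    exact gibbsExp_mono ha hβ fun z => by rw [map_zero, map_pow]; exact sq_nonneg _
  have hexp : (f - C k - C t * sumSqY N) ^ 2 = f * f + C (k ^ 2) * 1 +
      C (t ^ 2) * (sumSqY N * sumSqY N) + C (-(2 * k)) * f + C (-(2 * t)) * (f * sumSqY N) +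
      C (2 * k * t) * sumSqY N := by
    simp only [C_neg, C_mul, C_pow, map_ofNat]
    ring
  rw [hexp] at hpos
  simp only [gibbsExp_add ha hβ, gibbsExp_C_mul, gibbsExp_one ha hβ, hS, hSS, hfS, ← hm] at hpos
  rw [hV]
  have e1 : gibbsExp β a (f * f) + k ^ 2 * 1 + t ^ 2 * (2 * N / β ^ 2 + n ^ 2) + -(2 * k) * m +
      -(2 * t) * (e / β + n * m) + 2 * k * t * n =
      gibbsExp β a (f * f) - m ^ 2 - e ^ 2 / (2 * N) := by
    rw [hk, ht]
    field_simp
    ring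
  rw [e1, sub_nonneg, div_le_iff₀ (by positivity)] at hpos
  linarith

/-! ### Observables in the normal coordinates -/

/-- The normal coordinates `q = A^{1/4} x`, `p = A^{-1/4} y` as linear forms of `(x, y)`. -/
def normalCoord (a : ℝ) : ZMod N ⊕ ZMod N → Poly N :=
  Sum.elim (fun j => ∑ k, C (powA N a (1 / 4) j k) * X (Sum.inl k))
    (fun j => ∑ k, C (powA N a (-(1 / 4)) j k) * X (Sum.inr k))

theorem evalNormal_eq (f : Poly N) (z : ZMod N ⊕ ZMod N → ℝ) :
    evalNormal a f z = eval z (bind₁ (normalCoord a) f) := by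
  have e : eval z (bind₁ (normalCoord a) f) = eval (fun v => eval z (normalCoord a v)) f := by
    rw [← coe_aeval_eq_eval, ← coe_aeval_eq_eval]
    exact aeval_bind₁ ..
  rw [e, evalNormal]
  congr 2
  funext v
  rcases v with j | j <;> simp [normalCoord, Matrix.mulVec, dotProduct]

/-- The p_j are linear in y alone and the q_j depend on x alone, so both sets of momenta define the
same Euler operator. -/
theorem eulerY_bind₁_normalCoord (f : Poly N) :
    eulerY (bind₁ (normalCoord a) f) = bind₁ (normalCoord a) (eulerY f) := by
  induction f using MvPolynomial.induction_on with
  | C c => rw [bind₁_C_right, eulerY_C, map_zero]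
  | add f g hf hg => rw [map_add, eulerY_add, eulerY_add, map_add, hf, hg]
  | mul_X f v hf =>
    rw [map_mul, eulerY_mul, eulerY_mul, map_add, map_mul, map_mul, hf]
    congr 2
    rw [bind₁_X_right]
    rcases v with j | j
    · rw [eulerY_X_inl, map_zero, normalCoord, Sum.elim_inl, eulerY_sum]
      exact Finset.sum_eq_zero fun k _ => by
        rw [eulerY_mul, eulerY_C, eulerY_X_inl, mul_zero, zero_mul, add_zero]
    · rw [eulerY_X_inr, bind₁_X_right, normalCoord, Sum.elim_inr, eulerY_sum]
      exact Finset.sum_congr rfl fun k _ => by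
        rw [eulerY_mul, eulerY_C, eulerY_X_inr, zero_mul, add_zero]

theorem gibbsExp_X_inr_mul_X_inr (ha : 0 < a) (hβ : 0 < β) (k l : ZMod N) :
    gibbsExp β a (X (Sum.inr k) * X (Sum.inr l) : Poly N) = if k = l then 1 / β else 0 := by
  classical
  have h := gibbsExp_pderiv ha hβ (Sum.inr l) (X (Sum.inr k) : Poly N)
  rw [pderiv_inr_ham ha] at h
  split_ifs with hkl
  · subst hkl
    rw [pderiv_X_self, gibbsExp_one ha hβ] at h
    rw [eq_div_iff hβ.ne']; linarith
  · rw [pderiv_X_of_ne (Sum.inr_injective.ne hkl), gibbsExp_zero] at h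
    exact (mul_eq_zero.1 h.symm).resolve_left hβ.ne'

/-- Exact, because the operator turns H_Ω into Ω p·p, which involves only the uncorrelated momenta
y. -/
theorem gibbsExp_normalCoord_eulerY_HOm (ha : 0 < a) (hβ : 0 < β) :
    gibbsExp β a (bind₁ (normalCoord a) (eulerY (HOm N a))) =
      Om N a * (powA N a (-(1 / 2))).trace / β := by
  have e1 : eulerY (HOm N a) = C (Om N a) * ∑ j, X (Sum.inr j) * X (Sum.inr j) := by
    rw [eulerY, Finset.mul_sum]
    exact Finset.sum_congr rfl fun j _ => by rw [pderiv_inr_HOm]; ring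
  have e2 : ∀ j : ZMod N, gibbsExp β a (normalCoord a (Sum.inr j) * normalCoord a (Sum.inr j)) =
      powA N a (-(1 / 2)) j j / β := by
    intro j
    have e3 : normalCoord a (Sum.inr j) * normalCoord a (Sum.inr j) =
        ∑ k, ∑ l, C (powA N a (-(1 / 4)) j k * powA N a (-(1 / 4)) j l) *
          (X (Sum.inr k) * X (Sum.inr l) : Poly N) := by
      rw [normalCoord, Sum.elim_inr, Finset.sum_mul_sum]
      exact Finset.sum_congr rfl fun k _ => Finset.sum_congr rfl fun l _ => by rw [C_mul]; ring
    rw [e3, gibbsExp_sum ha hβ]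
    simp only [gibbsExp_sum ha hβ, gibbsExp_C_mul, gibbsExp_X_inr_mul_X_inr ha hβ]
    simp only [mul_ite, mul_zero, Finset.sum_ite_eq, Finset.mem_univ, if_true]
    have h4 : powA N a (-(1 / 4)) * powA N a (-(1 / 4)) = powA N a (-(1 / 2)) := by
      rw [powA_mul_powA ha]; norm_num
    rw [← h4, Matrix.mul_apply, Finset.sum_div]
    refine Finset.sum_congr rfl fun k _ => ?_
    rw [powA_symm _ k j]
    ring
  rw [e1, map_mul, bind₁_C_right, gibbsExp_C_mul, map_sum, gibbsExp_sum ha hβ, mul_div_assoc,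
    Matrix.trace, Finset.sum_div]
  congr 1
  refine Finset.sum_congr rfl fun j _ => ?_
  rw [map_mul, bind₁_X_right, e2]
  rfl

theorem gibbsExp_normalCoord_pow_le (ha : 0 < a) (hβ : 0 < β) {b : ℝ}
    (hb : ∀ i, ∑ j, |cfc (fun t : ℝ => Real.log t / 4) (matA N a) i j| ≤ b) {k : ℕ} (hk : 1 ≤ k)
    (v : ZMod N ⊕ ZMod N) :
    gibbsExp β a (normalCoord a v ^ (2 * k)) ≤ Real.exp (2 * b) ^ k * momentBound β k := by
  have e : Real.exp (2 * b) ^ k = Real.exp b ^ (2 * k) := by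
    rw [pow_mul, ← Real.exp_nat_mul b 2, Nat.cast_ofNat]
  rw [e]
  rcases v with j | j
  · exact gibbsExp_linear_pow_le ha hβ _ _ (sum_abs_powA_le ha hb (by norm_num) j) hk
  · exact gibbsExp_linear_pow_le ha hβ _ _ (sum_abs_powA_le ha hb (by norm_num) j) hk

end Variance

/-! ### The numerical estimate -/

/-- The factors 1/β and 3/β are kept exactly; each of the s others is at most (2r + 1)/β. -/
theorem momentBound_add_two_le {β : ℝ} (hβ : 0 < β) {s r : ℕ} (hs : s + 1 ≤ r) :
    momentBound β (s + 2) ≤ 3 / β ^ 2 * ((2 * r + 1) / β) ^ s := by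
  rw [momentBound, Finset.prod_range_succ', Finset.prod_range_succ']
  have h : ∏ i ∈ Finset.range s, ((2 * ((i + 1 + 1 : ℕ) : ℝ) + 1) / β) ≤ ((2 * r + 1) / β) ^ s := by
    have := Finset.prod_le_prod (s := Finset.range s)
      (f := fun i => (2 * ((i + 1 + 1 : ℕ) : ℝ) + 1) / β) (g := fun _ => (2 * r + 1 : ℝ) / β)
      (fun i hi => by positivity) (fun i hi => by
        have : ((i + 1 + 1 : ℕ) : ℝ) ≤ r := by
          exact_mod_cast (by have := Finset.mem_range.1 hi; omega : i + 1 + 1 ≤ r)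
        gcongr)
    rwa [Finset.prod_const, Finset.card_range] at this
  calc _ ≤ ((2 * r + 1) / β) ^ s * ((2 * ((0 + 1 : ℕ) : ℝ) + 1) / β) *
        ((2 * ((0 : ℕ) : ℝ) + 1) / β) := by gcongr
    _ = _ := by push_cast; field_simp; ring

/-- Bernoulli's inequality 1 + s/2 ≤ (3/2)^s reduces the sum to a geometric one. -/
theorem sum_two_mul_add_four_mul_pow_le {x : ℝ} (h0 : 0 ≤ x) (h1 : 3 / 2 * x < 1) (n : ℕ) :
    ∑ s ∈ Finset.range n, (2 * s + 4 : ℝ) * x ^ s ≤ 4 / (1 - 3 / 2 * x) := by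
  have h : ∀ s ∈ Finset.range n, (2 * s + 4 : ℝ) * x ^ s ≤ 4 * (3 / 2 * x) ^ s := by
    intro s _
    have := one_add_mul_le_pow (a := (1 / 2 : ℝ)) (by norm_num) s
    rw [mul_pow, ← mul_assoc]
    refine mul_le_mul_of_nonneg_right ?_ (pow_nonneg h0 s)
    norm_num at this ⊢
    linarith
  refine (Finset.sum_le_sum h).trans ?_
  rw [← Finset.mul_sum]
  have := geom_sum_le (x := 3 / 2 * x) (by positivity) h1 n
  rw [div_eq_mul_one_div 4]
  linarith

/-- A geometric sum of ratio x = 2gρ(2r + 1)/β, where 2r + 1 ≤ 2(r + 1) and the hypothesis on β give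
x ≤ 0.344. The constant 141 is tuned so that the total stays below 0.54. -/
theorem tail_le {Ω κ ρ β g α : ℝ} {r : ℕ} (hΩ : 0 < Ω) (hκ : 0 ≤ κ) (hρ : 1 ≤ ρ) (hβ : 0 < β)
    (hr : 1 ≤ r) (hα : α = 8 * κ / (99 / 50 * Ω)) (hg : g = 3 * α * r ^ 2)
    (hb : 141 * ρ ^ 2 * (κ / Ω) * (r ^ 2 * (r + 1)) ≤ β) :
    ∑ s ∈ Finset.range r, (2 * s + 4 : ℝ) * (3 / 2 * (51 / 50 * κ) * g ^ s) *
      (2 ^ (s + 2) * (ρ ^ (s + 2) * momentBound β (s + 2))) ≤ 27 / 50 * Ω / β := by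
  have hr0 : (1 : ℝ) ≤ r := by exact_mod_cast hr
  have hρ0 : 0 < ρ := by linarith
  have hα0 : 0 ≤ α := by rw [hα]; positivity
  have hg0 : 0 ≤ g := by rw [hg]; positivity
  have hb' : 141 * (ρ ^ 2 * κ * (r ^ 2 * (r + 1))) ≤ Ω * β := by
    rw [show 141 * ρ ^ 2 * (κ / Ω) * ((r : ℝ) ^ 2 * (r + 1)) =
      141 * (ρ ^ 2 * κ * (r ^ 2 * (r + 1))) / Ω by field_simp, div_le_iff₀ hΩ] at hb
    linarith
  set x : ℝ := 2 * g * ρ * ((2 * r + 1) / β) with hx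
  have hx0 : 0 ≤ x := by rw [hx]; positivity
  have hx1 : x ≤ 344 / 1000 := by
    have e : x = 4800 / 198 * (ρ * κ * (r ^ 2 * (2 * r + 1))) / (Ω * β) := by
      rw [hx, hg, hα]; field_simp; ring
    rw [e, div_le_iff₀ (by positivity)]
    have h1 : ρ * κ * (r ^ 2 * (2 * r + 1)) ≤ ρ ^ 2 * κ * (r ^ 2 * (2 * (r + 1))) := by
      have : ρ ≤ ρ ^ 2 := by nlinarith
      gcongr
      linarith
    have h2 : 0 ≤ ρ ^ 2 * κ * ((r : ℝ) ^ 2 * (r + 1)) := by positivity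
    linarith
  -- The prefactor 18.36 is (3/2)(51/50) · 2² · 3.
  have hterm : ∀ s ∈ Finset.range r, (2 * s + 4 : ℝ) * (3 / 2 * (51 / 50 * κ) * g ^ s) *
      (2 ^ (s + 2) * (ρ ^ (s + 2) * momentBound β (s + 2))) ≤
      1836 / 100 * (ρ ^ 2 * κ) / β ^ 2 * ((2 * s + 4 : ℝ) * x ^ s) := by
    intro s hs
    have hm := momentBound_add_two_le hβ (Finset.mem_range.1 hs)
    calc _ ≤ (2 * s + 4 : ℝ) * (3 / 2 * (51 / 50 * κ) * g ^ s) *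
        (2 ^ (s + 2) * (ρ ^ (s + 2) * (3 / β ^ 2 * ((2 * r + 1) / β) ^ s))) := by gcongr
      _ = _ := by rw [hx, mul_pow, mul_pow, mul_pow]; field_simp; ring
  refine (Finset.sum_le_sum hterm).trans ?_
  rw [← Finset.mul_sum]
  have h2 := sum_two_mul_add_four_mul_pow_le hx0 (by linarith) r
  have h3 : 4 / (1 - 3 / 2 * x) ≤ 829 / 100 := by
    rw [div_le_iff₀ (by linarith)]; linarith
  -- Twice 141, since r²(r + 1) ≥ 2.
  have h4 : 282 * (ρ ^ 2 * κ) ≤ Ω * β := by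
    have : (2 : ℝ) ≤ r ^ 2 * (r + 1) := by nlinarith
    nlinarith [mul_nonneg (sq_nonneg ρ) hκ]
  calc _ ≤ 1836 / 100 * (ρ ^ 2 * κ) / β ^ 2 * (829 / 100) := by
        gcongr; exact h2.trans h3
    _ ≤ 1836 / 100 * (Ω * β / 282) / β ^ 2 * (829 / 100) := by
        gcongr; linarith
    _ = (1836 / 100 / 282 * (829 / 100)) * Ω / β := by field_simp
    _ ≤ _ := by gcongr; norm_num

/-! ### The corrections and the variance bound. -/

section Main

variable {N : ℕ} [NeZero N] {a β κ : ℝ} {r : ℕ}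

theorem abs_gibbsExp_eulerY_lieE_le {χ Z : ℕ → Poly N} (h : IsAdmissible N a κ r)
    (hn : IsNormalForm N a r χ Z) (ha : 0 < a) (hβ : 0 < β) {b : ℝ}
    (hb : ∀ i, ∑ j, |cfc (fun t : ℝ => Real.log t / 4) (matA N a) i j| ≤ b) {ρ g α : ℝ}
    (hρ : Real.exp (2 * b) ≤ ρ) (hα : α = 8 * κ / (99 / 50 * Om N a)) (hg : g = 3 * α * r ^ 2)
    {s : ℕ} (hs : s + 1 ≤ r) :
    |gibbsExp β a (bind₁ (normalCoord a) (eulerY (lieE χ (s + 1) (HOm N a))))| ≤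
      N * ((2 * s + 4 : ℝ) * (3 / 2 * (51 / 50 * κ) * g ^ s) *
        (2 ^ (s + 2) * (ρ ^ (s + 2) * momentBound β (s + 2)))) := by
  have hom : (lieE χ (s + 1) (HOm N a)).IsHomogeneous (2 * (s + 2)) := by
    have := isHomogeneous_lieE (l := 0) (s := s + 1)
      (fun j h1 h2 => hn.gen_homogeneous h1 (by omega)) (isHomogeneous_HOm a)
    rwa [show 2 * (s + 1 + 0) + 2 = 2 * (s + 2) by ring] at this
  have h1 := abs_gibbsExp_bind₁_le ha hβ (normalCoord a) (k := s + 2) (by omega)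
    (gibbsExp_normalCoord_pow_le ha hβ hb (by omega)) (isHomogeneous_eulerY hom)
  have h2 := coeffNorm_cplx_eulerY_le hom
  have h3 := hn.siteNorm_lieE_HOm_le h hα hg hs
  have hN : (0 : ℝ) < N := card_pos_real
  rw [siteNorm, div_le_iff₀ hN] at h3
  have hmb := momentBound_nonneg hβ (s + 2)
  have h0 : (0 : ℝ) ≤ 2 * s + 4 := by positivity
  have h4 : 0 ≤ 3 / 2 * (51 / 50 * κ) * g ^ s * N := (coeffNorm_nonneg _).trans h3
  have h5 : coeffNorm (cplx (eulerY (lieE χ (s + 1) (HOm N a)))) ≤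
      (2 * s + 4) * (3 / 2 * (51 / 50 * κ) * g ^ s * N) := by
    refine h2.trans ?_
    push_cast
    rw [mul_add, show (2 : ℝ) * 2 = 4 by norm_num]
    exact mul_le_mul_of_nonneg_left h3 h0
  have h6 : (2 : ℝ) ^ (s + 2) * (Real.exp (2 * b) ^ (s + 2) * momentBound β (s + 2)) ≤
      2 ^ (s + 2) * (ρ ^ (s + 2) * momentBound β (s + 2)) := by gcongr
  exact h1.trans ((mul_le_mul h5 h6 (by positivity) (mul_nonneg h0 h4)).trans_eq (by ring))

theorem variance_adiabaticInvariant_ge {χ Z : ℕ → Poly N} (h : IsAdmissible N a κ r)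
    (hn : IsNormalForm N a r χ Z) (ha : 0 < a) (hmu : mu a < 1 / 20000) (hβ : 0 < β) {b ρ : ℝ}
    (hb : ∀ i, ∑ j, |cfc (fun t : ℝ => Real.log t / 4) (matA N a) i j| ≤ b)
    (hρ : Real.exp (2 * b) ≤ ρ)
    (hbig : 141 * ρ ^ 2 * (κ / Om N a) * (r ^ 2 * (r + 1)) ≤ β) :
    N / β ^ 2 * (Om N a ^ 2 / 10) ≤
      ProbabilityTheory.variance (adiabaticInvariant N a r χ) (gibbs N β a) := by
  have hN : (0 : ℝ) < N := card_pos_real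
  have hΩ := h.om_pos
  have hκ : 0 ≤ κ := (siteNorm_nonneg _).trans h.quart_le
  have hb0 : 0 ≤ b := (Finset.sum_nonneg fun _ _ => abs_nonneg _).trans (hb 0)
  have hρ1 : 1 ≤ ρ := (Real.one_le_exp (by positivity)).trans hρ
  -- The leading term is at least N/β; Ω close to one turns this into a multiple of Ω, through 0.999
  -- · 1.001 < 1.
  have hΩ1 : Om N a ≤ 1001 / 1000 := by
    have h1 : a ≤ 1 / 10000 := by
      rw [mu, div_lt_iff₀ (by positivity)] at hmu; linarith
    have h2 := Om_sq_le (N := N) ha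
    nlinarith
  set F : Poly N := bind₁ (normalCoord a) (∑ s ∈ Finset.range (r + 1), lieE χ s (HOm N a)) with hF
  set α := 8 * κ / (99 / 50 * Om N a) with hα
  set g := 3 * α * r ^ 2 with hg
  have hΦ : adiabaticInvariant N a r χ = fun z => eval z F := by
    funext z
    rw [adiabaticInvariant, evalNormal_eq]
  have hCS := sq_gibbsExp_eulerY_le_variance ha hβ F
  have hE : gibbsExp β a (eulerY F) =
      ∑ s ∈ Finset.range r, gibbsExp β a (bind₁ (normalCoord a)
        (eulerY (lieE χ (s + 1) (HOm N a)))) + Om N a * (powA N a (-(1 / 2))).trace / β := by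
    rw [hF, eulerY_bind₁_normalCoord, eulerY_sum, map_sum, gibbsExp_sum ha hβ,
      Finset.sum_range_succ', lieE_zero, gibbsExp_normalCoord_eulerY_HOm ha hβ]
  have hT : |∑ s ∈ Finset.range r, gibbsExp β a (bind₁ (normalCoord a)
        (eulerY (lieE χ (s + 1) (HOm N a))))| ≤ N * (27 / 50 * Om N a / β) := by
    have hterm := fun s (hs : s ∈ Finset.range r) =>
      abs_gibbsExp_eulerY_lieE_le h hn ha hβ hb hρ hα hg (Finset.mem_range.1 hs)
    have hsum := (Finset.abs_sum_le_sum_abs _ _).trans (Finset.sum_le_sum hterm)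
    rw [← Finset.mul_sum] at hsum
    have htail := mul_le_mul_of_nonneg_left (tail_le hΩ hκ hρ1 hβ h.one_le hα hg hbig) hN.le
    exact hsum.trans htail
  have hM : N * (999 / 1000 * Om N a / β) ≤ Om N a * (powA N a (-(1 / 2))).trace / β := by
    have h1 : N * (999 / 1000 * Om N a) ≤ Om N a * (powA N a (-(1 / 2))).trace :=
      (mul_le_of_le_one_right hN.le (by linarith)).trans (card_le_trace_powA ha)
    rw [← mul_div_assoc]
    exact div_le_div_of_nonneg_right h1 hβ.le
  have hlow : N * (459 / 1000 * Om N a / β) ≤ gibbsExp β a (eulerY F) := by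
    have h1 := (abs_le.1 hT).1
    rw [hE]
    have h2 : N * (459 / 1000 * Om N a / β) =
      N * (999 / 1000 * Om N a / β) - N * (27 / 50 * Om N a / β) := by ring
    linarith
  rw [hΦ]
  set V := ProbabilityTheory.variance (fun z => eval z F) (gibbs N β a)
  have h5 := (pow_le_pow_left₀ (by positivity) hlow 2).trans hCS
  have h6 : (N * (459 / 1000 * Om N a / β)) ^ 2 =
      2 * N * (N / β ^ 2 * (Om N a ^ 2 * (459 ^ 2 / 2000000))) := by
    field_simp; norm_num
  rw [h6] at h5
  have h7 : N / β ^ 2 * (Om N a ^ 2 * (459 ^ 2 / 2000000)) ≤ V :=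
    le_of_mul_le_mul_left h5 (by positivity)
  -- The numerical margin: 0.459²/2 = 0.1053….
  have h8 : Om N a ^ 2 / 10 ≤ Om N a ^ 2 * (459 ^ 2 / 2000000) := by
    rw [div_eq_mul_inv]
    exact mul_le_mul_of_nonneg_left (by norm_num) (sq_nonneg _)
  exact (mul_le_mul_of_nonneg_left h8 (by positivity)).trans h7

end Main

end KleinGordon
end

/-! ### Assembly of the constants. -/

open KleinGordon
theorem proposition5p4 (K1 β0 : ℝ) (hK1 : 2 < K1) (hβ0 : 0 < β0) :
    ∃ μ2 β3 β4 : ℝ, 0 < μ2 ∧ 0 < β3 ∧ 0 < β4 ∧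
      ∀ (N : ℕ) [NeZero N] (a β C0 C1 : ℝ) (r : ℕ),
        0 < a → mu a < μ2 → 0 < C0 → 0 < C1 →
        -- the seeds of `Z_0` (without on-site part) and `χ_0` are of class `𝒟(C0, σ_0)`
        (∃ ζ : ℕ → Poly N, HasSeed (Zzero N a) ζ ∧ ClassD ζ C0 (sigma0 a) ∧ ζ 0 = 0) →
        (∃ ξ : ℕ → Poly N, HasSeed (chiZero N a) ξ ∧ ClassD ξ C0 (sigma0 a)) →
        -- the seed of `H_1` in the coordinates `(q, p)` is of class `𝒟(C1, σ_1)`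
        (∃ h : ℕ → Poly N, HasSeed (toNormal a (quartPart N)) h ∧ ClassD h C1 (sigma1 a)) →
        1 ≤ r → 2 * r * mu a < muStar N a C0 →
        Dconst K1 a β ^ 2 * muFlat a ≤ 1 / 2 →
        β0 < β → β3 < β → β4 < β → Real.sqrt (3 / 2) < β →
        6 * Real.exp (Ctilde a C0) * betaStar N a C0 C1 * (r ^ 2 * (r + 1)) < β →
        (∃ χ Z : ℕ → Poly N, IsNormalForm N a r χ Z) ∧
        ∀ χ Z : ℕ → Poly N, IsNormalForm N a r χ Z →
          ProbabilityTheory.variance (adiabaticInvariant N a r χ) (gibbs N β a)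
            ≥ N / β ^ 2 * (Om N a ^ 2 / 10) := by
  -- The threshold for μ yields e^{σ_1} ≥ 100 and Ω ≤ 1.001; the threshold 1 for β provides its
  -- positivity.
  refine ⟨1 / 20000, 1, 1, by norm_num, by norm_num, by norm_num, ?_⟩
  intro N _ a β C0 C1 r ha hmu hC0 hC1 hζ hξ hh hr hrm _ _ _ hβ1 _ hbig
  obtain ⟨ξ, hξs, hξd⟩ := hξ
  obtain ⟨h, hs, hd⟩ := hh
  have hβ : 0 < β := one_pos.trans hβ1
  have hN : (0 : ℝ) < N := card_pos_real
  have hσ := sigma0_pos ha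
  have hσ1 : 0 < sigma1 a := half_pos hσ
  have hx : Real.exp (-sigma0 a) < 1 := Real.exp_lt_one_iff.2 (by linarith)
  have hy : Real.exp (-sigma1 a) < 1 := Real.exp_lt_one_iff.2 (by linarith)
  have hz : Real.exp (-(sigma0 a - sigmaStar a)) < 1 :=
    Real.exp_lt_one_iff.2 (by rw [sigmaStar]; linarith)
  have hw : muFlat a < 1 := Real.exp_lt_one_iff.2 (by rw [sigmaStar]; linarith)
  have hw0 : 0 < muFlat a := Real.exp_pos _
  have hw2 : muFlat a ^ 2 = Real.exp (-sigma1 a) := by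
    rw [muFlat, ← Real.exp_nat_mul, sigmaStar, sigma1]
    congr 1
    push_cast
    ring
  have hκ : siteNorm (toNormal a (quartPart N)) ≤ C1 / (1 - Real.exp (-sigma1 a)) := by
    refine (siteNorm_le_div _).trans ?_
    rw [div_le_iff₀' hN]
    exact hs.coeffNorm_le.trans
      (mul_le_mul_of_nonneg_left (sum_coeffNorm_le hd hC1.le hσ1) hN.le)
  have hadm := isAdmissible ha hmu hC0 hζ hs.isCyclic hκ hr hrm
  refine ⟨hadm.exists_isNormalForm, fun χ Z hn => ?_⟩
  have hb := sum_abs_log_le hξs.isCyclic (hξs.coeffNorm_le.trans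
    (mul_le_mul_of_nonneg_left (sum_coeffNorm_le hξd hC0.le hσ) hN.le))
  -- The row sums of ¼ ln A are at most b = C_0/(1 - e^{-σ_0}), and 2b ≤ C̃; thus e^{C̃} bounds the
  -- squared row sums of A^{±1/4}.
  have hρ : Real.exp (2 * (C0 / (1 - Real.exp (-sigma0 a)))) ≤ Real.exp (Ctilde a C0) := by
    rw [Real.exp_le_exp, Ctilde, ← mul_div_assoc]
    refine div_le_div_of_nonneg_left (by positivity)
      (mul_pos (sub_pos.2 hx) (sub_pos.2 hz)) ?_
    have := Real.exp_pos (-(sigma0 a - sigmaStar a))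
    exact mul_le_of_le_one_right (sub_pos.2 hx).le (by linarith)
  refine variance_adiabaticInvariant_ge hadm hn ha hmu hβ hb hρ (le_trans ?_ hbig.le)
  have hΩ := hadm.om_pos
  have ha1 : a ≤ 1 / 10000 := by
    rw [mu, div_lt_iff₀ (by positivity)] at hmu; linarith
  refine mul_le_mul_of_nonneg_right ?_ (by positivity)
  -- The factor e^{-1} in β^* is compensated here: 6 · 2⁶ = 384 while 141e < 383.3.
  have he : 141 * Real.exp 1 ≤ 6 * 2 ^ 6 := by linarith [Real.exp_one_lt_d9]
  -- Since μ_♭² = e^{-σ_1}, the denominator of β^* contains that of κ, and its other factors are at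
  -- most one.
  have hden : (1 - muFlat a ^ 2) * (1 - muFlat a) * (1 - 2 * a) ≤ 1 - Real.exp (-sigma1 a) := by
    rw [hw2, mul_assoc]
    refine mul_le_of_le_one_right (sub_pos.2 hy).le ?_
    exact mul_le_one₀ (by linarith) (by linarith) (by linarith)
  have hden0 : 0 < (1 - muFlat a ^ 2) * (1 - muFlat a) * (1 - 2 * a) := by
    rw [hw2]
    exact mul_pos (mul_pos (sub_pos.2 hy) (sub_pos.2 hw)) (by linarith)
  set ρ := Real.exp (Ctilde a C0) with hρd
  have hρ0 : 0 < ρ := Real.exp_pos _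
  rw [betaStar, Real.exp_sub, ← hρd]
  calc 141 * ρ ^ 2 * (C1 / (1 - Real.exp (-sigma1 a)) / Om N a)
      ≤ 6 * 2 ^ 6 / Real.exp 1 * ρ ^ 2 *
        (C1 / ((1 - muFlat a ^ 2) * (1 - muFlat a) * (1 - 2 * a)) / Om N a) := by
        gcongr
        rwa [le_div_iff₀ (Real.exp_pos _)]
    _ = _ := by field_simp
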